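/- Let $S$ be a complex manifold and let $\mathcal V\to S$ be a variation of graded-polarized mixed Hodge structure: a local system $\mathcal V_{\mathbb Q}$ of finite dimensional $\mathbb Q$-vector spaces on $S$ with a finite increasing filtration $\mathcal W$ by local subsystems, a finite decreasing filtration $\mathcal F$ of $\mathcal V_{\mathbb C}\otimes\mathcal O_S$ by holomorphic subbundles with $\nabla\mathcal F^p\subseteq\Omega^1_S\otimes\mathcal F^{p-1}$ for the Gauss–Manin connection $\nabla$, and rational non-degenerate forms $\mathcal S_k$ on $Gr^{\mathcal W}_k$ such that each $(Gr^{\mathcal W}_k,\mathcal F\,Gr^{\mathcal W}_k,\mathcal S_k)$ is a variation of pure, polarized Hodge structure of weight $k$. Assume that $\mathcal V$ is unipotent: the variations induced on the $Gr^{\mathcal W}_k$ are constant (it is enough that they are locally constant, i.e. that the filtrations $\mathcal F\,Gr^{\mathcal W}_k$ are flat). At each $s\in S$ let $\mathcal V_s=\bigoplus_{p,q} I^{p,q}_s$ be the Deligne bigrading of $(\mathcal F_s,\mathcal W_s)$, i.e. the unique decomposition with $\mathcal F^p_s=\bigoplus_{r\ge p,\,q}I^{r,q}_s$, $\mathcal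 W_{k,s}=\bigoplus_{r+q\le k}I^{r,q}_s$ and $I^{p,q}_s\equiv\overline{I^{q,p}_s}$ modulo $\bigoplus_{a<p,\,b<q}I^{a,b}_s$; put $\mathcal U^p=\bigoplus_q I^{p,q}$. On the $C^\infty$ bundle $E$ underlying $\mathcal V_{\mathbb C}$, let $\bar\partial$ be the part of $\nabla^{0,1}$ that maps each $\mathcal U^p$ to itself, $\partial$ the part of $\nabla^{1,0}$ that maps each $\mathcal U^p$ to itself, and $\theta$ (the Higgs field, an $\mathrm{End}(E)$-valued $(1,0)$-form) the part of $\nabla^{1,0}$ that maps each $\mathcal U^p$ to $\mathcal U^{p-1}$. Then: 1. $\theta$ is a $C^\infty$ form, and $\theta(\mathcal W_k)\subseteq\mathcal W_{k-1}$ for every $k$. 2. $\bar\partial=\nabla^{0,1}$. 3. $\bar\partial+\partial=\nabla-\theta$, and this connection is flat (its curvature vanishes). 4. $\theta$ is flat relative both to $\nabla$ and to $\bar\partial+\partial$: for $D=\nabla$ and for $D=\bar\partial+\partial$, the covariant exterior derivative $d_D\theta$, $(d_D\theta)(X,Y)=[D_X,\theta(Y)]-[D_Y,\theta(X)]-\theta([X,Y])$,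 is zero. 5. Each $\mathcal U^p$ is a $C^\infty$ subbundle which is parallel with respect to $\nabla-\theta$. 6. If $S$ is connected, $\mathcal V$ is determined by the flat connection $\nabla$, the Higgs field $\theta$ and a single fiber: let $\mathcal V'\to S$ be a second unipotent variation of graded-polarized mixed Hodge structure, with Gauss–Manin connection $\nabla'$ and Higgs field $\theta'$, and let $\Phi$ be an isomorphism of the underlying complex vector bundles which carries $\nabla$ to $\nabla'$ and $\theta$ to $\theta'$. If for one point $s_0\in S$ the map $\Phi_{s_0}:\mathcal V_{s_0}\to\mathcal V'_{s_0}$ is an isomorphism of graded-polarized mixed Hodge structures (it is defined over $\mathbb Q$ and is compatible with the weight filtrations, the Hodge filtrations and the forms $\mathcal S_k$), then $\Phi_s$ is one for every $s\in S$, so that $\Phi$ is an isomorphism $\mathcal V\cong\mathcal V'$. -/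

import Mathlib

open scoped TensorProduct Manifold ContDiff Topology

universe u v v'

noncomputable section

/-! ### Linear algebra over `ℂ ⊗ M`, for a rational vector space `M` -/

section HodgeLinearAlgebra

variable {M : Type*} [AddCommGroup M] [Module ℚ M]

/-- Complex conjugation `z ⊗ m ↦ z̄ ⊗ m` on the complexification of a rational vector space. -/
def conjC (M : Type*) [AddCommGroup M] [Module ℚ M] :
    (ℂ ⊗[ℚ] M) →ₛₗ[starRingEnd ℂ] (ℂ ⊗[ℚ] M) where
  toFun := TensorProduct.map
    ((Complex.conjAe.toAlgHom.toLinearMap : ℂ →ₗ[ℝ] ℂ).restrictScalars ℚ) LinearMap.id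
  map_add' := map_add _
  map_smul' z v := by
    induction v using TensorProduct.induction_on with
    | zero => simp
    | tmul w m => simp [TensorProduct.smul_tmul']
    | add a b ha hb => simp only [smul_add, map_add, ha, hb]

/-- The filtration step induced by `F` on the complexification of the rational quotient `A / B`
(where `B ⊆ A`): the image of `F ∩ (ℂ ⊗ A)` in `ℂ ⊗ (A / B)`. -/
def inducedOnQuotient (A B : Submodule ℚ M) (F : Submodule ℂ (ℂ ⊗[ℚ] M)) :
    Submodule ℂ (ℂ ⊗[ℚ] (A ⧸ B.submoduleOf A)) :=
  (F.comap (A.subtype.baseChange ℂ)).map ((B.submoduleOf A).mkQ.baseChange ℂ)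

/-- `F` is (the Hodge filtration of) a pure Hodge structure of weight `k` on `ℂ ⊗ M`. -/
structure IsPureHodgeStructure (k : ℤ) (F : ℤ → Submodule ℂ (ℂ ⊗[ℚ] M)) : Prop where
  antitone : Antitone F
  exhaustive : ∃ p, F p = ⊤
  separated : ∃ p, F p = ⊥
  opposed : ∀ p, IsCompl (F p) ((F (k - p + 1)).map (conjC M))

/-- The rational bilinear form `Q` polarizes the pure Hodge structure `F` of weight `k`:
parity `(-1)^k`, non-degeneracy, and the two Riemann bilinear relations. -/
structure IsPolarization (k : ℤ) (F : ℤ → Submodule ℂ (ℂ ⊗[ℚ] M))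
    (Q : LinearMap.BilinForm ℚ M) : Prop where
  parity : ∀ a b, Q a b = (-1 : ℚ) ^ k * Q b a
  nondegenerate : Q.Nondegenerate
  riemann₁ : ∀ p, ∀ u ∈ F p, ∀ v ∈ F (k - p + 1), Q.baseChange ℂ u v = 0
  riemann₂ : ∀ p q : ℤ, p + q = k → ∀ v ∈ F p ⊓ (F q).map (conjC M), v ≠ 0 →
    0 < (Complex.I ^ (p - q) * Q.baseChange ℂ v (conjC M v)).re

/-- `I` is the bigrading of the mixed Hodge structure `(F, W)` with
`I^{p,q} ≡ conj I^{q,p}` modulo `⨁_{r<p, s<q} I^{r,s}`. -/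
structure IsDeligneBigrading (W : ℤ → Submodule ℚ M) (F : ℤ → Submodule ℂ (ℂ ⊗[ℚ] M))
    (I : ℤ → ℤ → Submodule ℂ (ℂ ⊗[ℚ] M)) : Prop where
  internal : DirectSum.IsInternal (fun pq : ℤ × ℤ => I pq.1 pq.2)
  hodge : ∀ p, F p = ⨆ (r : ℤ) (s : ℤ) (_ : p ≤ r), I r s
  weight : ∀ k, (W k).baseChange ℂ = ⨆ (r : ℤ) (s : ℤ) (_ : r + s ≤ k), I r s
  conj : ∀ p q,
    I p q ⊔ (⨆ (r : ℤ) (s : ℤ) (_ : r < p ∧ s < q), I r s) =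
      (I q p).map (conjC M) ⊔ (⨆ (r : ℤ) (s : ℤ) (_ : r < p ∧ s < q), I r s)

open Classical in
/-- The Deligne bigrading `I^{p,q}` of `(F, W)`: the unique bigrading as above (it exists and is
unique whenever `(F, W)` is a mixed Hodge structure; `⊥` is a default value otherwise). -/
def deligneI (W : ℤ → Submodule ℚ M) (F : ℤ → Submodule ℂ (ℂ ⊗[ℚ] M)) :
    ℤ → ℤ → Submodule ℂ (ℂ ⊗[ℚ] M) :=
  if h : ∃ I, IsDeligneBigrading W F I then h.choose else fun _ _ => ⊥

/-- `U^p = ⨁_q I^{p,q}`. -/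
def deligneU (W : ℤ → Submodule ℚ M) (F : ℤ → Submodule ℂ (ℂ ⊗[ℚ] M)) (p : ℤ) :
    Submodule ℂ (ℂ ⊗[ℚ] M) :=
  ⨆ q, deligneI W F p q

end HodgeLinearAlgebra

open Classical in
/-- The projection onto the summand `U p` of a direct sum decomposition `⨁ U p`, along the other
summands. -/
def gradedProj {N : Type*} [AddCommGroup N] [Module ℂ N] (U : ℤ → Submodule ℂ N) (p : ℤ) :
    N →ₗ[ℂ] N :=
  if h : IsCompl (U p) (⨆ (r : ℤ) (_ : r ≠ p), U r) then
    (U p).subtype ∘ₗ Submodule.projectionOnto _ _ h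
  else 0

section TypeDecomposition

variable {E N : Type*} [AddCommGroup E] [Module ℂ E] [Module ℝ E] [IsScalarTower ℝ ℂ E]
  [AddCommGroup N] [Module ℂ N] [Module ℝ N] [IsScalarTower ℝ ℂ N]

theorem real_map_complex_smul (α : E →ₗ[ℝ] N) (z : ℂ) (v : E) :
    α (z • v) = (z.re : ℂ) • α v + (z.im : ℂ) • α (Complex.I • v) := by
  have h : z • v = z.re • v + z.im • (Complex.I • v) := by
    conv_lhs => rw [← Complex.re_add_im z, add_smul, mul_smul]
    rw [← smul_one_smul ℂ z.re v, ← smul_one_smul ℂ z.im (Complex.I • v)]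
    simp
  rw [h, map_add, map_smul, map_smul, ← smul_one_smul ℂ z.re (α v),
    ← smul_one_smul ℂ z.im (α (Complex.I • v))]
  simp

theorem real_map_I_smul_smul (α : E →ₗ[ℝ] N) (z : ℂ) (v : E) :
    α (Complex.I • (z • v)) = (z.re : ℂ) • α (Complex.I • v) - (z.im : ℂ) • α v := by
  rw [smul_smul, real_map_complex_smul]
  simp [sub_eq_add_neg, add_comm]

/-- The `(1,0)`-part `v ↦ (α v - i α(i v)) / 2` of a real-linear form `α` on a complex vector
space, with values in a complex vector space. -/
def part10 (α : E →ₗ[ℝ] N) : E →ₗ[ℂ] N where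
  toFun v := (1 / 2 : ℂ) • (α v - Complex.I • α (Complex.I • v))
  map_add' u v := by simp only [smul_add, map_add]; module
  map_smul' z v := by
    rw [real_map_I_smul_smul, real_map_complex_smul, RingHom.id_apply]
    conv_rhs => rw [← Complex.re_add_im z]
    have hI : Complex.I * Complex.I = -1 := Complex.I_mul_I
    match_scalars
    · ring
    · linear_combination ((z.im : ℂ) / 2) * hI

/-- The `(0,1)`-part `v ↦ (α v + i α(i v)) / 2` of a real-linear form `α` on a complex vector
space, with values in a complex vector space. -/
def part01 (α : E →ₗ[ℝ] N) : E →ₛₗ[starRingEnd ℂ] N where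
  toFun v := (1 / 2 : ℂ) • (α v + Complex.I • α (Complex.I • v))
  map_add' u v := by simp only [smul_add, map_add]; module
  map_smul' z v := by
    rw [real_map_I_smul_smul, real_map_complex_smul]
    have hz : (starRingEnd ℂ) z = (z.re : ℂ) - (z.im : ℂ) * Complex.I := by
      apply Complex.ext <;> simp
    rw [hz]
    have hI : Complex.I * Complex.I = -1 := Complex.I_mul_I
    match_scalars
    · ring
    · linear_combination ((z.im : ℂ) / 2) * hI

end TypeDecomposition

/-! ### Rational local systems and their associated smooth bundles -/

/-- A local system of finite dimensional rational vector spaces on `S`: a family of fibres, with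
trivializations `transport x y : Fib x ≃ Fib y` over a connected open neighbourhood `nhd x` of each
point `x`, such that the transition functions between any two trivializations are locally
constant. -/
structure RatLocalSystem (S : Type u) [TopologicalSpace S] where
  Fib : S → Type v
  [addCommGroup : ∀ s, AddCommGroup (Fib s)]
  [module : ∀ s, Module ℚ (Fib s)]
  [finite : ∀ s, Module.Finite ℚ (Fib s)]
  nhd : S → Set S
  isOpen_nhd : ∀ x, IsOpen (nhd x)
  isConnected_nhd : ∀ x, IsConnected (nhd x)
  mem_nhd : ∀ x, x ∈ nhd x
  transport : ∀ x y, y ∈ nhd x → (Fib x ≃ₗ[ℚ] Fib y)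
  transport_self : ∀ x a, transport x x (mem_nhd x) a = a
  transition_locallyConstant : ∀ x₁ x₂ y₀ (h₁ : y₀ ∈ nhd x₁) (h₂ : y₀ ∈ nhd x₂),
    ∀ᶠ y in 𝓝 y₀, ∀ (k₁ : y ∈ nhd x₁) (k₂ : y ∈ nhd x₂) (a : Fib x₁),
      (transport x₂ y k₂).symm (transport x₁ y k₁ a) =
        (transport x₂ y₀ h₂).symm (transport x₁ y₀ h₁ a)

attribute [instance] RatLocalSystem.addCommGroup RatLocalSystem.module RatLocalSystem.finite

namespace RatLocalSystem

section Topological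

variable {S : Type u} [TopologicalSpace S] (L : RatLocalSystem.{u, v} S)

/-- The fibre at `s` of the complexified local system. -/
abbrev VC (s : S) : Type v := ℂ ⊗[ℚ] L.Fib s

/-- Sections of the underlying vector bundle of the complexified local system, with no regularity
imposed. -/
abbrev Section : Type (max u v) := ∀ s, L.VC s

open Classical in
/-- The local flat section through `e ∈ VC x` (extended by zero outside `nhd x`). -/
def flatExt (x : S) (e : L.VC x) : L.Section := fun y =>
  if h : y ∈ L.nhd x then (L.transport x y h).toLinearMap.baseChange ℂ e else 0

/-- The rank of the local system at `x`. -/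
def rk (x : S) : ℕ := Module.finrank ℂ (L.VC x)

/-- Linear coordinates on the fibre `VC x`. -/
def fibCoord (x : S) : L.VC x ≃ₗ[ℂ] (Fin (L.rk x) → ℂ) :=
  (Module.finBasis ℂ (L.VC x)).equivFun

open Classical in
/-- The components of a section, near `x`, in a flat frame: `σ y` is transported back to `VC x`
along the flat trivialization, and expressed in coordinates of `VC x`. -/
def frameCoord (x : S) (σ : L.Section) (y : S) : Fin (L.rk x) → ℂ :=
  if h : y ∈ L.nhd x then
    L.fibCoord x ((L.transport x y h).symm.toLinearMap.baseChange ℂ (σ y))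
  else 0

end Topological

section Smooth

variable (E : Type*) [NormedAddCommGroup E] [NormedSpace ℂ E]
  {S : Type u} [TopologicalSpace S] [ChartedSpace E S] (L : RatLocalSystem.{u, v} S)

/-- `σ` is a `C^∞` section (of `V_ℂ ⊗ 𝓔^0`) at `x`: its flat components are smooth at `x`. -/
def SmoothAt (σ : L.Section) (x : S) : Prop :=
  ContMDiffAt 𝓘(ℝ, E) 𝓘(ℝ, Fin (L.rk x) → ℂ) ∞ (L.frameCoord x σ) x

/-- `σ` is a holomorphic section (of `V_ℂ ⊗ 𝓞`) at `x`: its flat components are holomorphic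
(complex analytic) at `x`. -/
def HolomorphicAt (σ : L.Section) (x : S) : Prop :=
  ContMDiffAt 𝓘(ℂ, E) 𝓘(ℂ, Fin (L.rk x) → ℂ) ω (L.frameCoord x σ) x

/-- A family of subspaces of the fibres is a `C^∞` subbundle: locally it has a smooth frame. -/
def IsSmoothSubbundle (G : ∀ s, Submodule ℂ (L.VC s)) : Prop :=
  ∀ x, ∃ (m : ℕ) (f : Fin m → L.Section), ∀ᶠ s in 𝓝 x,
    (∀ i, L.SmoothAt E (f i) s) ∧ LinearIndependent ℂ (fun i => f i s) ∧
      Submodule.span ℂ (Set.range fun i => f i s) = G s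

/-- A family of subspaces of the fibres is a holomorphic subbundle: locally it has a holomorphic
frame. -/
def IsHolomorphicSubbundle (G : ∀ s, Submodule ℂ (L.VC s)) : Prop :=
  ∀ x, ∃ (m : ℕ) (f : Fin m → L.Section), ∀ᶠ s in 𝓝 x,
    (∀ i, L.HolomorphicAt E (f i) s) ∧ LinearIndependent ℂ (fun i => f i s) ∧
      Submodule.span ℂ (Set.range fun i => f i s) = G s

/-- The derivative at `x` of the flat components of `σ`. The tangent space of `S` at any point is
the complex vector space `E`. -/
def dFrameCoord (σ : L.Section) (x : S) : E →ₗ[ℝ] (Fin (L.rk x) → ℂ) :=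
  (mfderiv 𝓘(ℝ, E) 𝓘(ℝ, Fin (L.rk x) → ℂ) (L.frameCoord x σ) x).toLinearMap

/-- The Gauss–Manin connection `∇_v σ` at `x`: differentiate the flat components. -/
def nabla (σ : L.Section) (x : S) (v : E) : L.VC x :=
  (L.fibCoord x).symm (L.dFrameCoord E σ x v)

/-- `∇^{1,0} σ` at `x`. -/
def nabla10 (σ : L.Section) (x : S) : E →ₗ[ℂ] L.VC x :=
  (L.fibCoord x).symm.toLinearMap ∘ₗ part10 (L.dFrameCoord E σ x)

/-- `∇^{0,1} σ` at `x`. -/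
def nabla01 (σ : L.Section) (x : S) : E →ₛₗ[starRingEnd ℂ] L.VC x :=
  (L.fibCoord x).symm.toLinearMap.comp (part01 (L.dFrameCoord E σ x))

/-- Griffiths transversality `∇ 𝓕^p ⊆ Ω^1 ⊗ 𝓕^{p-1}`, for holomorphic sections. -/
def IsHorizontal (F : ℤ → ∀ s, Submodule ℂ (L.VC s)) : Prop :=
  ∀ (p : ℤ) (σ : L.Section) (x : S),
    (∀ᶠ s in 𝓝 x, L.HolomorphicAt E σ s ∧ σ s ∈ F p s) → ∀ v : E, L.nabla E σ x v ∈ F (p - 1) x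

/-- `(L, F, Q)` is a variation of pure Hodge structure of weight `k` polarized by `Q`. -/
structure IsPolarizedVHS (k : ℤ) (F : ℤ → ∀ s, Submodule ℂ (L.VC s))
    (Q : ∀ s, LinearMap.BilinForm ℚ (L.Fib s)) : Prop where
  holomorphic : ∀ p, L.IsHolomorphicSubbundle E (F p)
  horizontal : L.IsHorizontal E F
  form_flat : ∀ x y (h : y ∈ L.nhd x) (a b : L.Fib x),
    Q y (L.transport x y h a) (L.transport x y h b) = Q x a b
  pure : ∀ s, IsPureHodgeStructure k (fun p => F p s)
  polarized : ∀ s, IsPolarization k (fun p => F p s) (Q s)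

/-- A (not necessarily flat) connection, as a differential operator: `D σ x v = D_v σ (x)`. -/
abbrev ConnectionOp : Type _ := L.Section → ∀ x : S, E → L.VC x

variable {E}

/-- The vector field `X` is `C^∞` at `x`. -/
def SmoothFieldAt [IsManifold 𝓘(ℝ, E) 1 S] (X : ∀ s : S, TangentSpace 𝓘(ℝ, E) s) (x : S) : Prop :=
  ContMDiffAt 𝓘(ℝ, E) (𝓘(ℝ, E).prod 𝓘(ℝ, E)) ∞
    (fun s => (⟨s, X s⟩ : TangentBundle 𝓘(ℝ, E) S)) x

/-- The connection `D` is flat: its curvature `[D_X, D_Y] - D_{[X,Y]}` vanishes. -/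
def IsFlat [IsManifold 𝓘(ℝ, E) 1 S] (D : L.ConnectionOp E) : Prop :=
  ∀ (X Y : ∀ s : S, TangentSpace 𝓘(ℝ, E) s) (σ : L.Section) (x : S),
    SmoothFieldAt X x → SmoothFieldAt Y x → L.SmoothAt E σ x →
    D (fun s => D σ s (Y s)) x (X x) - D (fun s => D σ s (X s)) x (Y x)
      - D σ x (VectorField.mlieBracket 𝓘(ℝ, E) X Y x) = 0

/-- The endomorphism valued 1-form `A` is flat with respect to the connection `D`: its covariant
exterior derivative `(d_D A)(X, Y) = [D_X, A(Y)] - [D_Y, A(X)] - A([X,Y])` vanishes. -/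
def IsFlatForm [IsManifold 𝓘(ℝ, E) 1 S] (D : L.ConnectionOp E)
    (A : ∀ s : S, E →ₗ[ℂ] Module.End ℂ (L.VC s)) : Prop :=
  ∀ (X Y : ∀ s : S, TangentSpace 𝓘(ℝ, E) s) (σ : L.Section) (x : S),
    SmoothFieldAt X x → SmoothFieldAt Y x → L.SmoothAt E σ x →
    (D (fun s => A s (Y s) (σ s)) x (X x) - A x (Y x) (D σ x (X x)))
      - (D (fun s => A s (X s) (σ s)) x (Y x) - A x (X x) (D σ x (Y x)))
      - A x (VectorField.mlieBracket 𝓘(ℝ, E) X Y x) (σ x) = 0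

/-- The endomorphism valued 1-form `A` is `C^∞`. -/
def IsSmoothForm [IsManifold 𝓘(ℝ, E) 1 S]
    (A : ∀ s : S, E →ₗ[ℂ] Module.End ℂ (L.VC s)) : Prop :=
  ∀ (X : ∀ s : S, TangentSpace 𝓘(ℝ, E) s) (σ : L.Section) (x : S),
    SmoothFieldAt X x → L.SmoothAt E σ x → L.SmoothAt E (fun s => A s (X s) (σ s)) x

/-- A subbundle `G` is parallel for the connection `D`: `D` maps sections of `G` to `G`. -/
def IsParallel (D : L.ConnectionOp E) (G : ∀ s, Submodule ℂ (L.VC s)) : Prop :=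
  ∀ (σ : L.Section) (x : S), L.SmoothAt E σ x → (∀ᶠ s in 𝓝 x, σ s ∈ G s) →
    ∀ v : E, D σ x v ∈ G x

end Smooth

end RatLocalSystem

/-- The real manifold underlying a complex manifold. -/
instance isManifold_real_of_complex (E : Type*) [NormedAddCommGroup E] [NormedSpace ℂ E]
    (S : Type*) [TopologicalSpace S] [ChartedSpace E S] [IsManifold 𝓘(ℂ, E) ω S] :
    IsManifold 𝓘(ℝ, E) ω S := by
  apply isManifold_of_contDiffOn
  intro e e' he he'
  have h := (contDiffGroupoid ω 𝓘(ℂ, E)).compatible he he'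
  rw [contDiffGroupoid, mem_groupoid_of_pregroupoid] at h
  exact h.1.restrict_scalars ℝ

/-! ### Weight filtrations and their graded quotients -/

/-- A finite increasing filtration of `L` by local subsystems. -/
structure WeightFiltration {S : Type u} [TopologicalSpace S] (L : RatLocalSystem.{u, v} S) where
  W : ℤ → ∀ s, Submodule ℚ (L.Fib s)
  mono : ∀ s, Monotone (fun k => W k s)
  separated : ∀ s, ∃ k, W k s = ⊥
  exhaustive : ∀ s, ∃ k, W k s = ⊤
  flat : ∀ k x y (h : y ∈ L.nhd x), (W k x).map (L.transport x y h).toLinearMap = W k y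

namespace WeightFiltration

variable {S : Type u} [TopologicalSpace S] {L : RatLocalSystem.{u, v} S} (w : WeightFiltration L)

/-- The fibre `W_k / W_{k-1}` at `s`. -/
abbrev GrFib (k : ℤ) (s : S) : Type v := w.W k s ⧸ (w.W (k - 1) s).submoduleOf (w.W k s)

/-- The class in `W_k / W_{k-1}` of an element of `W_k`. -/
def grMk (k : ℤ) (s : S) (a : w.W k s) : w.GrFib k s := Submodule.Quotient.mk a

/-- The map induced by a flat trivialization on `W_k / W_{k-1}`. -/
def grTransport (k : ℤ) (x y : S) (h : y ∈ L.nhd x) : w.GrFib k x ≃ₗ[ℚ] w.GrFib k y :=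
  Submodule.Quotient.equiv _ _ ((L.transport x y h).ofSubmodules _ _ (w.flat k x y h)) (by
    ext ⟨b, hb⟩
    simp only [Submodule.mem_map, Submodule.submoduleOf, Submodule.mem_comap,
      Submodule.subtype_apply]
    constructor
    · rintro ⟨a, ha, hab⟩
      have : L.transport x y h a = b := congrArg Subtype.val hab
      rw [← this, ← w.flat (k - 1) x y h]
      exact Submodule.mem_map_of_mem ha
    · intro hb'
      rw [← w.flat (k - 1) x y h] at hb'
      obtain ⟨a, ha, hab⟩ := hb'
      exact ⟨⟨a, w.mono x (by omega : k - 1 ≤ k) ha⟩, ha, Subtype.ext hab⟩)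

/-- The local system `Gr^W_k = W_k / W_{k-1}`. -/
def gr (k : ℤ) : RatLocalSystem.{u, v} S where
  Fib := w.GrFib k
  nhd := L.nhd
  isOpen_nhd := L.isOpen_nhd
  isConnected_nhd := L.isConnected_nhd
  mem_nhd := L.mem_nhd
  transport := w.grTransport k
  transport_self x a := by
    induction a using Submodule.Quotient.induction_on with
    | H a =>
      refine congrArg Submodule.Quotient.mk (Subtype.ext ?_)
      exact L.transport_self x a
  transition_locallyConstant x₁ x₂ y₀ h₁ h₂ := by
    filter_upwards [L.transition_locallyConstant x₁ x₂ y₀ h₁ h₂] with y hy k₁ k₂ a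
    induction a using Submodule.Quotient.induction_on with
    | H a =>
      refine congrArg Submodule.Quotient.mk (Subtype.ext ?_)
      exact hy k₁ k₂ a

/-- The filtration step induced by `F` on `Gr^W_k`. -/
def grHodge (F : ℤ → ∀ s, Submodule ℂ (L.VC s)) (k p : ℤ) (s : S) :
    Submodule ℂ ((w.gr k).VC s) :=
  inducedOnQuotient (w.W k s) (w.W (k - 1) s) (F p s)

end WeightFiltration

/-! ### Variations of graded-polarized mixed Hodge structure -/

/-- A variation of graded-polarized mixed Hodge structure on the complex manifold `S`. -/
structure VGPMHS (E : Type*) [NormedAddCommGroup E] [NormedSpace ℂ E]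
    (S : Type u) [TopologicalSpace S] [ChartedSpace E S] where
  L : RatLocalSystem.{u, v} S
  wt : WeightFiltration L
  F : ℤ → ∀ s, Submodule ℂ (L.VC s)
  pol : ∀ (k : ℤ) (s : S), LinearMap.BilinForm ℚ (wt.GrFib k s)
  hodge_antitone : ∀ s, Antitone (fun p => F p s)
  hodge_exhaustive : ∀ s, ∃ p, F p s = ⊤
  hodge_separated : ∀ s, ∃ p, F p s = ⊥
  hodge_holomorphic : ∀ p, L.IsHolomorphicSubbundle E (F p)
  horizontal : L.IsHorizontal E F
  graded : ∀ k, (wt.gr k).IsPolarizedVHS E k (wt.grHodge F k) (pol k)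

namespace VGPMHS

variable {E : Type*} [NormedAddCommGroup E] [NormedSpace ℂ E]
  {S : Type u} [TopologicalSpace S] [ChartedSpace E S] (𝒱 : VGPMHS.{u, v} E S)

/-- The complexified weight filtration. -/
def WC (k : ℤ) (s : S) : Submodule ℂ (𝒱.L.VC s) := (𝒱.wt.W k s).baseChange ℂ

/-- The variation is unipotent: for each `k`, the variation of pure Hodge structure on `Gr^W_k` is
locally constant, i.e. its Hodge filtration is flat. -/
def IsUnipotent : Prop :=
  ∀ (k p : ℤ) (x y : S) (h : y ∈ 𝒱.L.nhd x),
    (𝒱.wt.grHodge 𝒱.F k p x).map (((𝒱.wt.gr k).transport x y h).toLinearMap.baseChange ℂ) =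
      𝒱.wt.grHodge 𝒱.F k p y

/-- The summand `𝓤^p = ⨁_q I^{p,q}` of the bundle underlying `𝒱`. -/
def U (p : ℤ) (s : S) : Submodule ℂ (𝒱.L.VC s) :=
  deligneU (fun k => 𝒱.wt.W k s) (fun r => 𝒱.F r s) p

/-- The projection onto `𝓤^p` along the other summands. -/
def proj (p : ℤ) (s : S) : 𝒱.L.VC s →ₗ[ℂ] 𝒱.L.VC s := gradedProj (fun r => 𝒱.U r s) p

/-- The `𝓤^p`-component of a section. -/
def comp (p : ℤ) (σ : 𝒱.L.Section) : 𝒱.L.Section := fun s => 𝒱.proj p s (σ s)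

/-- `∂̄`: the part of `∇^{0,1}` which maps each `𝓤^p` to itself. -/
def delbar (σ : 𝒱.L.Section) (x : S) : E →ₛₗ[starRingEnd ℂ] 𝒱.L.VC x :=
  ∑ᶠ p : ℤ, (𝒱.proj p x).comp (𝒱.L.nabla01 E (𝒱.comp p σ) x)

/-- `∂`: the part of `∇^{1,0}` which maps each `𝓤^p` to itself. -/
def del (σ : 𝒱.L.Section) (x : S) : E →ₗ[ℂ] 𝒱.L.VC x :=
  ∑ᶠ p : ℤ, 𝒱.proj p x ∘ₗ 𝒱.L.nabla10 E (𝒱.comp p σ) x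

/-- The part of `∇^{1,0}` which maps each `𝓤^p` to `𝓤^{p-1}`, as an operator on sections. -/
def higgsOp (σ : 𝒱.L.Section) (x : S) : E →ₗ[ℂ] 𝒱.L.VC x :=
  ∑ᶠ p : ℤ, 𝒱.proj (p - 1) x ∘ₗ 𝒱.L.nabla10 E (𝒱.comp p σ) x

/-- The Higgs field `θ`, as an endomorphism valued `(1,0)`-form: `θ x v e` is the value at `x` of
the above operator (which is tensorial) on a local section through `e`. -/
def θ (x : S) : E →ₗ[ℂ] Module.End ℂ (𝒱.L.VC x) :=
  ((Module.finBasis ℂ (𝒱.L.VC x)).constr ℂ fun i =>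
    𝒱.higgsOp (𝒱.L.flatExt x (Module.finBasis ℂ (𝒱.L.VC x) i)) x).flip

/-- The connection `∇ - θ`. -/
def nablaSubθ : 𝒱.L.ConnectionOp E := fun σ x v => 𝒱.L.nabla E σ x v - 𝒱.θ x v (σ x)

/-- The connection `∂̄ + ∂`. -/
def delbarAddDel : 𝒱.L.ConnectionOp E := fun σ x v => 𝒱.delbar σ x v + 𝒱.del σ x v

end VGPMHS

section Isomorphisms

variable {E : Type*} [NormedAddCommGroup E] [NormedSpace ℂ E]
  {S : Type u} [TopologicalSpace S] [ChartedSpace E S]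
  (𝒱 : VGPMHS.{u, v} E S) (𝒱' : VGPMHS.{u, v'} E S)

/-- The complex linear map `Φ` between the fibres at `s` of two variations is an isomorphism of
graded-polarized mixed Hodge structures: it is defined over `ℚ`, and it maps the weight filtrations,
the Hodge filtrations and the graded polarizations to each other. -/
def IsFiberIso (s : S) (Φ : 𝒱.L.VC s ≃ₗ[ℂ] 𝒱'.L.VC s) : Prop :=
  ∃ φ : 𝒱.L.Fib s ≃ₗ[ℚ] 𝒱'.L.Fib s,
    Φ.toLinearMap = φ.toLinearMap.baseChange ℂ ∧
    (∀ k, (𝒱.wt.W k s).map φ.toLinearMap = 𝒱'.wt.W k s) ∧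
    (∀ p, (𝒱.F p s).map Φ.toLinearMap = 𝒱'.F p s) ∧
    ∀ (k : ℤ) (a b : 𝒱.wt.W k s) (a' b' : 𝒱'.wt.W k s), φ a = a' → φ b = b' →
      𝒱'.pol k s (𝒱'.wt.grMk k s a') (𝒱'.wt.grMk k s b') =
        𝒱.pol k s (𝒱.wt.grMk k s a) (𝒱.wt.grMk k s b)

/-- `Φ` is an isomorphism of flat bundles: it maps smooth sections to smooth sections and commutes
with the Gauss–Manin connections. -/
def IsFlatBundleIso (Φ : ∀ s, 𝒱.L.VC s ≃ₗ[ℂ] 𝒱'.L.VC s) : Prop :=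
  ∀ (σ : 𝒱.L.Section) (x : S), 𝒱.L.SmoothAt E σ x →
    𝒱'.L.SmoothAt E (fun s => Φ s (σ s)) x ∧
    ∀ v : E, 𝒱'.L.nabla E (fun s => Φ s (σ s)) x v = Φ x (𝒱.L.nabla E σ x v)

/-- `Φ` is compatible with the Higgs fields. -/
def IsHiggsIso (Φ : ∀ s, 𝒱.L.VC s ≃ₗ[ℂ] 𝒱'.L.VC s) : Prop :=
  ∀ (x : S) (v : E) (e : 𝒱.L.VC x), 𝒱'.θ x v (Φ x e) = Φ x (𝒱.θ x v e)

end Isomorphisms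

end

/-!
Work in a flat frame over a ball in a chart, so that the weight filtration `W` and the conjugation
are constant and the Hodge filtration `F_z` varies holomorphically with `z`. The opposite filtration
`G_p = ⨁_{r ≤ p} U^r` equals `∑_q conj (F^q) ⊓ W_{p+q}`, and `V = F^p ⊕ G_{p-1}`. As the `F_z` agree
on `Gr^W`, the filtration `G` does not depend on `z`.

Hence the projection `P_p(z)` onto `F_z^p` along `G_{p-1}` is holomorphic in `z`, by transversality
its derivative takes values in `F^{p-1}`, and `P_p - P_{p+1}` is the projection to
`U^p = F^p ⊓ G_p`. In these terms `∇^{0,1}` preserves `U^p`, and `θ` is the differential of the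
grading operator `Y`, which is multiplication by `p` on `U^p` up to an additive constant. So
`d θ = 0`; comparing degrees in `[Y, θ]` gives `[θ, θ] = 0`, and the curvature of `∇ - θ` vanishes.

A flat isomorphism `Φ` compatible with `θ = dY` carries `Y` to `Y'` everywhere if it does so at one
point. Since the eigenspaces of `Y` are the `U^p`, it then preserves the Hodge filtration.
-/

noncomputable section

/-! ### Lattices of submodules -/

section Lattice

theorem eq_of_le_of_disjoint_of_codisjoint {α : Type*} [Lattice α] [BoundedOrder α]
    [IsModularLattice α] {a b c : α} (hab : a ≤ b) (hb : Disjoint c b) (ha : Codisjoint c a) :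
    a = b :=
  eq_of_le_of_inf_le_of_sup_le (z := c) hab (by simp [hb.symm.eq_bot]) (by simp [ha.symm.eq_top])

theorem iSupIndep_of_disjoint_biSup_lt {ι R N : Type*} [LinearOrder ι] [Ring R] [AddCommGroup N]
    [Module R N] {f : ι → Submodule R N} (h : ∀ i, Disjoint (f i) (⨆ j < i, f j)) :
    iSupIndep f := by
  classical
  rw [iSupIndep_iff_finsetSum_eq_zero_imp_eq_zero]
  intro s
  induction s using Finset.induction_on_max with
  | empty => simp
  | insert a s hs ih =>
    intro v hv h0
    rw [Finset.sum_insert fun ha => lt_irrefl _ (hs a ha)] at h0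
    have hsum : ∑ i ∈ s, v i ∈ ⨆ j < a, f j := Submodule.sum_mem _ fun i hi =>
      le_iSup₂ (f := fun j (_ : j < a) => f j) i (hs i hi) (hv i (Finset.mem_insert_of_mem hi))
    have hva : v a = 0 := by
      refine Submodule.disjoint_def.1 (h a) _ (hv a (Finset.mem_insert_self _ _)) ?_
      rw [eq_neg_of_add_eq_zero_left h0]
      exact Submodule.neg_mem _ hsum
    intro i hi
    obtain rfl | hi := Finset.mem_insert.1 hi
    · exact hva
    · exact ih v (fun j hj => hv j (Finset.mem_insert_of_mem hj)) (by simpa [hva] using h0) i hi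

theorem biSup_inf_biSup_of_iSupIndep {ι α : Type*} [CompleteLattice α] [IsModularLattice α]
    [IsCompactlyGenerated α] {f : ι → α} (h : iSupIndep f) (A B : Set ι) :
    (⨆ i ∈ A, f i) ⊓ (⨆ i ∈ B, f i) = ⨆ i ∈ A ∩ B, f i := by
  have hA : (⨆ i ∈ A, f i) = (⨆ i ∈ A ∩ B, f i) ⊔ ⨆ i ∈ A \ B, f i := by
    rw [← iSup_union, Set.inter_union_sdiff]
  rw [hA, sup_inf_assoc_of_le _ (biSup_mono fun i hi => hi.2),
    (h.disjoint_biSup_biSup (Set.disjoint_sdiff_left (s := B) (t := A))).eq_bot, sup_bot_eq]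

variable {α : Type*} [CompleteLattice α]

/-- The sum of the pieces `I^{r,s}` of a bigrading over the pairs `(r, s)` satisfying `P`. -/
def bigradedSum (I : ℤ → ℤ → α) (P : ℤ → ℤ → Prop) : α :=
  ⨆ (r : ℤ) (s : ℤ) (_ : P r s), I r s

variable {I : ℤ → ℤ → α} {P Q : ℤ → ℤ → Prop}

theorem le_bigradedSum {r s : ℤ} (h : P r s) : I r s ≤ bigradedSum I P :=
  le_iSup_of_le r (le_iSup₂_of_le s h le_rfl)

theorem bigradedSum_le {a : α} (h : ∀ r s, P r s → I r s ≤ a) : bigradedSum I P ≤ a :=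
  iSup₂_le fun r s => iSup_le (h r s)

theorem bigradedSum_mono (h : ∀ r s, P r s → Q r s) : bigradedSum I P ≤ bigradedSum I Q :=
  bigradedSum_le fun r s hrs => le_bigradedSum (h r s hrs)

theorem bigradedSum_congr (h : ∀ r s, P r s ↔ Q r s) : bigradedSum I P = bigradedSum I Q :=
  (bigradedSum_mono fun r s => (h r s).1).antisymm (bigradedSum_mono fun r s => (h r s).2)

theorem bigradedSum_eq_biSup (I : ℤ → ℤ → α) (P : ℤ → ℤ → Prop) :
    bigradedSum I P = ⨆ i ∈ {i : ℤ × ℤ | P i.1 i.2}, I i.1 i.2 :=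
  (iSup_prod (f := fun i : ℤ × ℤ => ⨆ _ : P i.1 i.2, I i.1 i.2)).symm

section Independent

variable [IsModularLattice α] [IsCompactlyGenerated α]
  (hI : iSupIndep fun i : ℤ × ℤ => I i.1 i.2)

include hI

theorem bigradedSum_inf_bigradedSum (P Q : ℤ → ℤ → Prop) :
    bigradedSum I P ⊓ bigradedSum I Q = bigradedSum I fun r s => P r s ∧ Q r s := by
  simp only [bigradedSum_eq_biSup]
  exact biSup_inf_biSup_of_iSupIndep hI _ _

theorem disjoint_bigradedSum (h : ∀ r s, P r s → ¬ Q r s) :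
    Disjoint (bigradedSum I P) (bigradedSum I Q) := by
  rw [disjoint_iff, bigradedSum_inf_bigradedSum hI, eq_bot_iff]
  exact bigradedSum_le fun r s hrs => absurd hrs.2 (h r s hrs.1)

end Independent

end Lattice

theorem int_induction_of_forall_le {P : ℤ → Prop} (k₀ : ℤ) (base : ∀ k ≤ k₀, P k)
    (step : ∀ k, P (k - 1) → P k) (k : ℤ) : P k := by
  rcases le_total k k₀ with hk | hk
  · exact base k hk
  · induction k, hk using Int.leInduction with
    | base => exact base _ le_rfl
    | succ n _ ih => exact step _ (by simpa using ih)

/-! ### Mixed Hodge structures on a complex vector space with a conjugation -/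

section MixedHodgeStructure

variable {V : Type*} [AddCommGroup V] [Module ℂ V]

/-- `(W, F)` is a mixed Hodge structure on the complex vector space `V` with conjugation `c`. No
rational structure is retained, so that the notion can be transported to flat coordinates. The last
two fields say that `F` and its conjugate are opposed on each `W k / W (k - 1)`. -/
structure IsMixedHodgeStructure (c : V →ₛₗ[starRingEnd ℂ] V) (W F : ℤ → Submodule ℂ V) : Prop where
  conj_conj : ∀ v, c (c v) = v
  weight_mono : Monotone W
  weight_bot : ∃ k, W k = ⊥
  weight_top : ∃ k, W k = ⊤
  conj_mem : ∀ k, ∀ v ∈ W k, c v ∈ W k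
  hodge_anti : Antitone F
  hodge_bot : ∃ p, F p = ⊥
  hodge_top : ∃ p, F p = ⊤
  graded_sup : ∀ k p, ∀ v ∈ W k, ∃ f ∈ F p ⊓ W k, ∃ g ∈ F (k - p + 1) ⊓ W k,
    v - f - c g ∈ W (k - 1)
  graded_inf : ∀ k p, ∀ f ∈ F p ⊓ W k, ∀ g ∈ F (k - p + 1) ⊓ W k,
    f - c g ∈ W (k - 1) → f ∈ W (k - 1)

/-- The increasing filtration `G_p = ∑_q conj(F^q) ∩ W_{p+q}` of a mixed Hodge structure: `G_{p-1}`
is a complement of `F^p` (see `isCompl_oppositeFiltration`), and `U^p = F^p ∩ G_p`. -/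
def oppositeFiltration (c : V →ₛₗ[starRingEnd ℂ] V) (W F : ℤ → Submodule ℂ V) (p : ℤ) :
    Submodule ℂ V :=
  ⨆ q, (F q ⊓ W (p + q)).map c

/-- The sum of the terms of weight at most `k` in `oppositeFiltration c W F p`, which is
`oppositeFiltration c W F p ⊓ W k` for a mixed Hodge structure. -/
def oppositeFiltrationTrunc (c : V →ₛₗ[starRingEnd ℂ] V) (W F : ℤ → Submodule ℂ V) (p k : ℤ) :
    Submodule ℂ V :=
  ⨆ (q : ℤ) (_ : p + q ≤ k), (F q ⊓ W (p + q)).map c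

/-- Deligne's formula for the bigrading of a mixed Hodge structure, with the correction term
`∑_{j ≥ 2} conj(F^{q-j+1}) ∩ W_{p+q-j}` written as `G_{p-1} ∩ W_{p+q-2}`. -/
def deligneBigrading (c : V →ₛₗ[starRingEnd ℂ] V) (W F : ℤ → Submodule ℂ V) (p q : ℤ) :
    Submodule ℂ V :=
  F p ⊓ W (p + q) ⊓
    ((F q ⊓ W (p + q)).map c ⊔ (oppositeFiltration c W F (p - 1) ⊓ W (p + q - 2)))

theorem oppositeFiltrationTrunc_eq_sup (c : V →ₛₗ[starRingEnd ℂ] V) (W F : ℤ → Submodule ℂ V)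
    (p k : ℤ) :
    oppositeFiltrationTrunc c W F p k =
      (F (k - p) ⊓ W k).map c ⊔ oppositeFiltrationTrunc c W F p (k - 1) := by
  apply le_antisymm
  · refine iSup₂_le fun q hq => ?_
    obtain rfl | hlt := hq.eq_or_lt
    · exact le_sup_of_le_left (by rw [add_sub_cancel_left])
    · exact le_sup_of_le_right (le_iSup₂_of_le q (by lia) le_rfl)
  · refine sup_le (le_iSup₂_of_le (k - p) (by lia) ?_)
      (iSup₂_le fun q hq => le_iSup₂_of_le q (by lia) le_rfl)
    rw [add_sub_cancel]

theorem oppositeFiltrationTrunc_le (c : V →ₛₗ[starRingEnd ℂ] V) (W F : ℤ → Submodule ℂ V)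
    (p k : ℤ) : oppositeFiltrationTrunc c W F p k ≤ oppositeFiltration c W F p :=
  iSup₂_le fun q _ => le_iSup_of_le q le_rfl

namespace IsMixedHodgeStructure

variable {c : V →ₛₗ[starRingEnd ℂ] V} {W F : ℤ → Submodule ℂ V} (h : IsMixedHodgeStructure c W F)

include h

theorem exists_forall_le_weight_eq_bot : ∃ k₀, ∀ k ≤ k₀, W k = ⊥ :=
  let ⟨k₀, hk₀⟩ := h.weight_bot
  ⟨k₀, fun _ hk => eq_bot_iff.2 (hk₀ ▸ h.weight_mono hk)⟩

theorem mem_weight_of_conj_mem {k : ℤ} {v : V} (hv : c v ∈ W k) : v ∈ W k :=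
  h.conj_conj v ▸ h.conj_mem k _ hv

theorem oppositeFiltration_mono : Monotone (oppositeFiltration c W F) := fun p p' hp =>
  iSup_mono fun q => Submodule.map_mono (inf_le_inf_left _ (h.weight_mono (by lia)))

theorem conj_mem_oppositeFiltration {p q k : ℤ} (hk : k ≤ p + q) {f : V} (hf : f ∈ F q ⊓ W k) :
    c f ∈ oppositeFiltration c W F p :=
  le_iSup (fun q => (F q ⊓ W (p + q)).map c) q
    (Submodule.mem_map_of_mem ⟨hf.1, h.weight_mono hk hf.2⟩)

theorem oppositeFiltrationTrunc_le_weight (p k : ℤ) :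
    oppositeFiltrationTrunc c W F p k ≤ W k := by
  refine iSup₂_le fun q hq => ?_
  rintro _ ⟨v, hv, rfl⟩
  exact h.conj_mem _ _ (h.weight_mono hq hv.2)

theorem exists_oppositeFiltration_eq_trunc (p : ℤ) :
    ∃ m₀, ∀ m ≥ m₀, oppositeFiltration c W F p = oppositeFiltrationTrunc c W F p m := by
  obtain ⟨q₀, hq₀⟩ := h.hodge_bot
  refine ⟨p + q₀, fun m hm =>
    le_antisymm (iSup_le fun q => ?_) (oppositeFiltrationTrunc_le ..)⟩
  rcases le_total (p + q) m with hq | hq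
  · exact le_iSup₂_of_le q hq le_rfl
  · have hFq : F q = ⊥ := eq_bot_iff.2 (hq₀ ▸ h.hodge_anti (by lia : q₀ ≤ q))
    simp [hFq]

theorem oppositeFiltrationTrunc_inf_weight_le (p k : ℤ) :
    oppositeFiltrationTrunc c W F p (k + 1) ⊓ W k ≤ oppositeFiltrationTrunc c W F p k := by
  rintro v ⟨hv, hvk⟩
  rw [oppositeFiltrationTrunc_eq_sup, add_sub_cancel_right] at hv
  obtain ⟨_, ⟨f, hf, rfl⟩, g, hg, rfl⟩ := Submodule.mem_sup.1 hv
  have hfk : f ∈ W k := h.mem_weight_of_conj_mem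
    ((Submodule.add_mem_iff_left _ (h.oppositeFiltrationTrunc_le_weight p k hg)).1 hvk)
  refine Submodule.add_mem _ ?_ hg
  rw [oppositeFiltrationTrunc_eq_sup]
  exact Submodule.mem_sup_left (Submodule.mem_map_of_mem ⟨h.hodge_anti (by lia) hf.1, hfk⟩)

theorem oppositeFiltration_inf_weight (p k : ℤ) :
    oppositeFiltration c W F p ⊓ W k = oppositeFiltrationTrunc c W F p k := by
  refine le_antisymm ?_
    (le_inf (oppositeFiltrationTrunc_le ..) (h.oppositeFiltrationTrunc_le_weight _ _))
  have descend : ∀ n : ℕ, oppositeFiltrationTrunc c W F p (k + n) ⊓ W k ≤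
      oppositeFiltrationTrunc c W F p k := by
    intro n
    induction n with
    | zero => simp
    | succ n ih =>
      rintro v ⟨hv, hvk⟩
      refine ih ⟨h.oppositeFiltrationTrunc_inf_weight_le p _ ⟨?_, ?_⟩, hvk⟩
      · rwa [add_assoc, ← Nat.cast_succ]
      · exact h.weight_mono (by lia) hvk
  obtain ⟨m₀, hm₀⟩ := h.exists_oppositeFiltration_eq_trunc p
  rw [hm₀ (k + (m₀ - k).toNat) (by lia)]
  exact descend _

theorem disjoint_oppositeFiltration (p : ℤ) :
    Disjoint (F p) (oppositeFiltration c W F (p - 1)) := by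
  rw [Submodule.disjoint_def]
  intro v hF hG
  obtain ⟨k₀, hk₀⟩ := h.exists_forall_le_weight_eq_bot
  obtain ⟨m, hm⟩ := h.weight_top
  have eq_zero_of_mem_weight : ∀ k, v ∈ W k → v = 0 := by
    refine int_induction_of_forall_le k₀ (fun k hk hv => by simpa [hk₀ k hk] using hv)
      fun k ih hv => ih ?_
    have hv' : v ∈ oppositeFiltrationTrunc c W F (p - 1) k :=
      h.oppositeFiltration_inf_weight _ _ ▸ ⟨hG, hv⟩
    rw [oppositeFiltrationTrunc_eq_sup, Submodule.mem_sup] at hv'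
    obtain ⟨_, ⟨f, hf, rfl⟩, g, hg, rfl⟩ := hv'
    rw [show k - (p - 1) = k - p + 1 by ring] at hf
    exact h.graded_inf k p _ ⟨hF, hv⟩ f hf
      (by simpa using h.oppositeFiltrationTrunc_le_weight _ _ hg)
  exact eq_zero_of_mem_weight m (hm ▸ Submodule.mem_top)

theorem weight_le_sup (p k : ℤ) :
    W k ≤ (F p ⊓ W k) ⊔ (oppositeFiltration c W F (p - 1) ⊓ W k) := by
  obtain ⟨k₀, hk₀⟩ := h.exists_forall_le_weight_eq_bot
  induction k using int_induction_of_forall_le k₀ with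
  | base k hk => simp [hk₀ k hk]
  | step k ih =>
    intro v hv
    obtain ⟨f, hf, g, hg, hw⟩ := h.graded_sup k p v hv
    have hk : W (k - 1) ≤ W k := h.weight_mono (by lia)
    have hw' := sup_le_sup (inf_le_inf_left _ hk) (inf_le_inf_left _ hk) (ih hw)
    have hcg : c g ∈ oppositeFiltration c W F (p - 1) ⊓ W k :=
      ⟨h.conj_mem_oppositeFiltration (by lia) hg, h.conj_mem _ _ hg.2⟩
    rw [show v = v - f - c g + (f + c g) by abel]
    exact Submodule.add_mem _ hw' (Submodule.add_mem_sup hf hcg)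

theorem isCompl_oppositeFiltration (p : ℤ) :
    IsCompl (F p) (oppositeFiltration c W F (p - 1)) := by
  refine ⟨h.disjoint_oppositeFiltration p, codisjoint_iff.2 (top_le_iff.1 ?_)⟩
  obtain ⟨m, hm⟩ := h.weight_top
  simpa [hm] using h.weight_le_sup p m

theorem oppositeFiltration_eq_of_le {p : ℤ} {G : Submodule ℂ V}
    (hG : oppositeFiltration c W F (p - 1) ≤ G) (hd : Disjoint (F p) G) :
    oppositeFiltration c W F (p - 1) = G :=
  eq_of_le_of_disjoint_of_codisjoint hG hd (h.isCompl_oppositeFiltration p).codisjoint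

/-! ### Existence of the Deligne bigrading -/

theorem deligneBigrading_le_oppositeFiltration (p q : ℤ) :
    deligneBigrading c W F p q ≤ oppositeFiltration c W F p := by
  refine inf_le_right.trans (sup_le ?_ (inf_le_left.trans (h.oppositeFiltration_mono (by lia))))
  rintro _ ⟨f, hf, rfl⟩
  exact h.conj_mem_oppositeFiltration le_rfl hf

theorem deligneBigrading_le_hodge {p p' : ℤ} (hp : p ≤ p') (q : ℤ) :
    deligneBigrading c W F p' q ≤ F p :=
  inf_le_left.trans (inf_le_left.trans (h.hodge_anti hp))

theorem deligneBigrading_le_weight {p q N : ℤ} (hN : p + q ≤ N) :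
    deligneBigrading c W F p q ≤ W N :=
  inf_le_left.trans (inf_le_right.trans (h.weight_mono hN))

theorem mem_oppositeFiltration_of_mem_weight {p q : ℤ} {v : V} (hW : v ∈ W (p + q - 1))
    (hv : v ∈ (F q ⊓ W (p + q)).map c ⊔ (oppositeFiltration c W F (p - 1) ⊓ W (p + q - 2))) :
    v ∈ oppositeFiltration c W F (p - 1) := by
  obtain ⟨_, ⟨f, hf, rfl⟩, g, hg, rfl⟩ := Submodule.mem_sup.1 hv
  have hfW : f ∈ W (p + q - 1) := h.mem_weight_of_conj_mem
    ((Submodule.add_mem_iff_left _ (h.weight_mono (by lia) hg.2)).1 hW)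
  exact Submodule.add_mem _ (h.conj_mem_oppositeFiltration (by lia) ⟨hf.1, hfW⟩) hg.1

theorem eq_zero_of_mem_deligneBigrading_of_mem_weight {p q : ℤ} {v : V}
    (hv : v ∈ deligneBigrading c W F p q) (hW : v ∈ W (p + q - 1)) : v = 0 :=
  Submodule.disjoint_def.1 (h.disjoint_oppositeFiltration p) v hv.1.1
    (h.mem_oppositeFiltration_of_mem_weight hW hv.2)

theorem exists_mem_deligneBigrading_sub_mem {p q N : ℤ} (hN : p + q = N) {f g : V}
    (hf : f ∈ F p ⊓ W N) (hg : g ∈ F q ⊓ W N) (hfg : f - c g ∈ W (N - 1)) :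
    ∃ i ∈ deligneBigrading c W F p q, f - i ∈ W (N - 1) := by
  subst hN
  obtain ⟨f₁, hf₁, l, hl, hsum⟩ := Submodule.mem_sup.1 (h.weight_le_sup p _ hfg)
  rw [h.oppositeFiltration_inf_weight, oppositeFiltrationTrunc_eq_sup, Submodule.mem_sup] at hl
  obtain ⟨_, ⟨g₁, hg₁, rfl⟩, l, hl, rfl⟩ := hl
  rw [← h.oppositeFiltration_inf_weight, show p + q - 1 - 1 = p + q - 2 by ring] at hl
  rw [show p + q - 1 - (p - 1) = q by ring] at hg₁
  have hle : W (p + q - 1) ≤ W (p + q) := h.weight_mono (by lia)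
  have hdiff : f - f₁ = c (g + g₁) + l := by
    rw [map_add, sub_eq_iff_eq_add.1 hsum.symm]
    abel
  refine ⟨f - f₁, ⟨Submodule.sub_mem _ hf ⟨hf₁.1, hle hf₁.2⟩, ?_⟩, by simpa using hf₁.2⟩
  rw [hdiff]
  exact Submodule.add_mem_sup
    (Submodule.mem_map_of_mem (Submodule.add_mem _ hg ⟨hg₁.1, hle hg₁.2⟩)) hl

theorem hodge_inf_weight_le_sup (p N : ℤ) :
    F p ⊓ W N ≤
      (F p ⊓ W (N - 1)) ⊔ (deligneBigrading c W F p (N - p) ⊔ (F (p + 1) ⊓ W N)) := by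
  intro f hf
  obtain ⟨f₁, hf₁, g, hg, hw⟩ := h.graded_sup N (p + 1) f hf.2
  rw [show N - (p + 1) + 1 = N - p by ring] at hg
  have hf' : f - f₁ ∈ F p ⊓ W N := Submodule.sub_mem _ hf ⟨h.hodge_anti (by lia) hf₁.1, hf₁.2⟩
  obtain ⟨i, hi, hiw⟩ := h.exists_mem_deligneBigrading_sub_mem (by ring) hf' hg hw
  rw [show f = f - f₁ - i + (i + f₁) by abel]
  exact Submodule.add_mem_sup ⟨Submodule.sub_mem _ hf'.1 hi.1.1, hiw⟩
    (Submodule.add_mem_sup hi hf₁)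

theorem hodge_inf_weight_eq_bigradedSum (p N : ℤ) :
    F p ⊓ W N = bigradedSum (deligneBigrading c W F) fun r s => p ≤ r ∧ r + s ≤ N := by
  refine le_antisymm ?_ (bigradedSum_le fun r s hrs =>
    le_inf (h.deligneBigrading_le_hodge hrs.1 s) (h.deligneBigrading_le_weight hrs.2))
  obtain ⟨k₀, hk₀⟩ := h.exists_forall_le_weight_eq_bot
  obtain ⟨p₀, hp₀⟩ := h.hodge_bot
  induction N using int_induction_of_forall_le k₀ generalizing p with
  | base k hk => simp [hk₀ k hk]
  | step N ihN =>
    -- For fixed `N` the induction on `p` descends from `p₀`, where `F^{p₀} = 0`.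
    obtain ⟨n, rfl⟩ : ∃ n, p = -n := ⟨-p, by ring⟩
    induction n using int_induction_of_forall_le (-p₀) with
    | base n hn =>
      have : F (-n) = ⊥ := eq_bot_iff.2 (hp₀ ▸ h.hodge_anti (by lia : p₀ ≤ -n))
      simp [this]
    | step n ihn =>
      rw [show -(n - 1) = -n + 1 by ring] at ihn
      refine (h.hodge_inf_weight_le_sup (-n) N).trans (sup_le ?_ (sup_le ?_ ?_))
      · exact (ihN _).trans (bigradedSum_mono fun r s hrs => ⟨hrs.1, by lia⟩)
      · exact le_bigradedSum ⟨le_rfl, by lia⟩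
      · exact ihn.trans (bigradedSum_mono fun r s hrs => ⟨by lia, hrs.2⟩)

theorem hodge_eq_bigradedSum (p : ℤ) :
    F p = bigradedSum (deligneBigrading c W F) fun r _ => p ≤ r := by
  refine le_antisymm ?_ (bigradedSum_le fun r s hr => h.deligneBigrading_le_hodge hr s)
  obtain ⟨m, hm⟩ := h.weight_top
  rw [← inf_top_eq (F p), ← hm, h.hodge_inf_weight_eq_bigradedSum]
  exact bigradedSum_mono fun r s hrs => hrs.1

theorem weight_eq_bigradedSum (N : ℤ) :
    W N = bigradedSum (deligneBigrading c W F) fun r s => r + s ≤ N := by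
  refine le_antisymm ?_ (bigradedSum_le fun r s hrs => h.deligneBigrading_le_weight hrs)
  obtain ⟨m, hm⟩ := h.hodge_top
  rw [← top_inf_eq (W N), ← hm, h.hodge_inf_weight_eq_bigradedSum]
  exact bigradedSum_mono fun r s hrs => hrs.2

theorem iSupIndep_deligneBigrading :
    iSupIndep fun i : ℤ × ℤ => deligneBigrading c W F i.1 i.2 := by
  -- Order the pieces lexicographically: those before `(p, q)` lie in `G_{p-1} + F^p ∩ W_{p+q-1}`.
  suffices iSupIndep fun i : ℤ ×ₗ ℤ => deligneBigrading c W F (ofLex i).1 (ofLex i).2 from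
    this.comp (f := toLex) toLex.injective
  refine iSupIndep_of_disjoint_biSup_lt fun ⟨p, q⟩ => Submodule.disjoint_def.2 fun v hv hs => ?_
  change v ∈ deligneBigrading c W F p q at hv
  have hle : (⨆ j < toLex (p, q), deligneBigrading c W F (ofLex j).1 (ofLex j).2) ≤
      oppositeFiltration c W F (p - 1) ⊔ (F p ⊓ W (p + q - 1)) := by
    refine iSup₂_le fun j hj => ?_
    obtain hlt | ⟨heq, hlt⟩ := Prod.Lex.lt_iff.1 hj <;> simp only [ofLex_toLex] at hlt
    · exact le_sup_of_le_left ((h.deligneBigrading_le_oppositeFiltration _ _).trans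
        (h.oppositeFiltration_mono (by lia)))
    · rw [ofLex_toLex] at heq
      exact le_sup_of_le_right (le_inf (h.deligneBigrading_le_hodge heq.ge _)
        (h.deligneBigrading_le_weight (by lia)))
  obtain ⟨g, hg, w, hw, rfl⟩ := Submodule.mem_sup.1 (hle hs)
  obtain rfl : g = 0 := Submodule.disjoint_def.1 (h.disjoint_oppositeFiltration p) g
    ((Submodule.add_mem_iff_left _ hw.1).1 hv.1.1) hg
  rw [zero_add] at hv ⊢
  exact h.eq_zero_of_mem_deligneBigrading_of_mem_weight hv hw.2

theorem oppositeFiltration_eq_bigradedSum (p : ℤ) :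
    oppositeFiltration c W F (p - 1) =
      bigradedSum (deligneBigrading c W F) fun r _ => r < p := by
  refine (eq_of_le_of_disjoint_of_codisjoint (c := F p) (bigradedSum_le fun r s hr => ?_)
    (h.disjoint_oppositeFiltration p) ?_).symm
  · exact (h.deligneBigrading_le_oppositeFiltration r s).trans
      (h.oppositeFiltration_mono (by lia))
  · obtain ⟨m, hm⟩ := h.hodge_top
    rw [codisjoint_iff, eq_top_iff, ← hm, h.hodge_eq_bigradedSum m]
    refine bigradedSum_le fun r s _ => ?_
    rcases le_or_gt p r with hr | hr
    · exact le_sup_of_le_left (h.deligneBigrading_le_hodge hr s)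
    · exact le_sup_of_le_right (le_bigradedSum hr)

theorem map_conj_oppositeFiltration (q : ℤ) :
    (oppositeFiltration c W F (q - 1)).map c =
      bigradedSum (deligneBigrading c W F) fun _ s => s < q := by
  have hmap : (oppositeFiltration c W F (q - 1)).map c = ⨆ p, F p ⊓ W (q - 1 + p) := by
    rw [oppositeFiltration, Submodule.map_iSup]
    refine iSup_congr fun p => ?_
    ext v
    constructor
    · rintro ⟨_, ⟨w, hw, rfl⟩, rfl⟩
      rwa [h.conj_conj]
    · exact fun hv => ⟨c v, ⟨v, hv, rfl⟩, h.conj_conj v⟩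
  rw [hmap]
  apply le_antisymm
  · refine iSup_le fun p => ?_
    rw [h.hodge_inf_weight_eq_bigradedSum]
    exact bigradedSum_mono fun r s hrs => by lia
  · exact bigradedSum_le fun r s hs => le_iSup_of_le r
      (le_inf (h.deligneBigrading_le_hodge le_rfl s) (h.deligneBigrading_le_weight (by lia)))

theorem sub_conj_mem_bigradedSum {p q : ℤ} {x y : V} (hx : x ∈ deligneBigrading c W F p q)
    (hy : y ∈ deligneBigrading c W F q p) (hxy : x - c y ∈ W (p + q - 1)) :
    x - c y ∈ bigradedSum (deligneBigrading c W F) fun r s => r < p ∧ s < q := by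
  have hx' := hx.1
  have hy' := hy.1
  rw [add_comm q p] at hy'
  rw [← bigradedSum_inf_bigradedSum h.iSupIndep_deligneBigrading (fun r _ => r < p)
    fun _ s => s < q, ← h.oppositeFiltration_eq_bigradedSum, ← h.map_conj_oppositeFiltration]
  refine ⟨h.mem_oppositeFiltration_of_mem_weight hxy (Submodule.sub_mem _ hx.2
    (Submodule.mem_sup_left (Submodule.mem_map_of_mem hy'))), c x - y, ?_, by simp [h.conj_conj]⟩
  rw [add_comm p q] at hx' hxy
  refine h.mem_oppositeFiltration_of_mem_weight ?_ (Submodule.sub_mem _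
    (Submodule.mem_sup_left (Submodule.mem_map_of_mem hx')) hy.2)
  simpa [h.conj_conj] using h.conj_mem _ _ hxy

theorem exists_mem_deligneBigrading_sub_conj_mem {p q : ℤ} {y : V}
    (hy : y ∈ deligneBigrading c W F q p) :
    ∃ x ∈ deligneBigrading c W F p q, x - c y ∈ W (p + q - 1) := by
  obtain ⟨hyF, hy'⟩ := hy
  rw [add_comm q p] at hyF hy'
  obtain ⟨_, ⟨f, hf, rfl⟩, l, hl, rfl⟩ := Submodule.mem_sup.1 hy'
  have hcl : c l ∈ W (p + q - 1) := h.conj_mem _ _ (h.weight_mono (by lia) hl.2)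
  obtain ⟨x, hx, hfx⟩ := h.exists_mem_deligneBigrading_sub_mem rfl hf hyF
    (by simpa [h.conj_conj] using hcl)
  refine ⟨x, hx, ?_⟩
  rw [map_add, h.conj_conj, show x - (f + c l) = -(f - x + c l) by abel]
  exact Submodule.neg_mem _ (Submodule.add_mem _ hfx hcl)

theorem deligneBigrading_sup_eq_conj_sup (p q : ℤ) :
    deligneBigrading c W F p q ⊔
        bigradedSum (deligneBigrading c W F) (fun r s => r < p ∧ s < q) =
      (deligneBigrading c W F q p).map c ⊔
        bigradedSum (deligneBigrading c W F) (fun r s => r < p ∧ s < q) := by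
  apply le_antisymm <;> refine sup_le ?_ le_sup_right
  · intro x hx
    obtain ⟨y, hy, hyx⟩ := h.exists_mem_deligneBigrading_sub_conj_mem hx
    have hxy : x - c y ∈ W (p + q - 1) := by
      have := Submodule.neg_mem _ (h.conj_mem _ _ hyx)
      rw [add_comm q p] at this
      simpa [h.conj_conj] using this
    rw [show x = c y + (x - c y) by abel]
    exact Submodule.add_mem_sup (Submodule.mem_map_of_mem hy) (h.sub_conj_mem_bigradedSum hx hy hxy)
  · rintro _ ⟨y, hy, rfl⟩
    obtain ⟨x, hx, hxy⟩ := h.exists_mem_deligneBigrading_sub_conj_mem hy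
    rw [show c y = x - (x - c y) by abel]
    exact Submodule.sub_mem _ (Submodule.mem_sup_left hx)
      (Submodule.mem_sup_right (h.sub_conj_mem_bigradedSum hx hy hxy))

end IsMixedHodgeStructure

end MixedHodgeStructure

/-! ### Mixed Hodge structures defined over `ℚ` -/

section Rational

variable {M M' : Type*} [AddCommGroup M] [Module ℚ M] [AddCommGroup M'] [Module ℚ M']

theorem conjC_tmul (z : ℂ) (m : M) : conjC M (z ⊗ₜ m) = (starRingEnd ℂ) z ⊗ₜ[ℚ] m := rfl

theorem conjC_conjC (v : ℂ ⊗[ℚ] M) : conjC M (conjC M v) = v := by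
  induction v using TensorProduct.induction_on with
  | zero => simp
  | tmul z m => simp [conjC_tmul]
  | add a b ha hb => simp only [map_add, ha, hb]

theorem conjC_baseChange (f : M →ₗ[ℚ] M') (v : ℂ ⊗[ℚ] M) :
    conjC M' (f.baseChange ℂ v) = f.baseChange ℂ (conjC M v) := by
  induction v using TensorProduct.induction_on with
  | zero => simp
  | tmul z m => simp [conjC_tmul]
  | add a b ha hb => simp only [map_add, ha, hb]

theorem conjC_mem_baseChange (A : Submodule ℚ M) {v : ℂ ⊗[ℚ] M} (hv : v ∈ A.baseChange ℂ) :
    conjC M v ∈ A.baseChange ℂ := by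
  obtain ⟨a, rfl⟩ := hv
  exact ⟨conjC A a, (conjC_baseChange _ _).symm⟩

theorem subtype_baseChange_injective (A : Submodule ℚ M) :
    Function.Injective (A.subtype.baseChange ℂ) :=
  Module.Flat.lTensor_preserves_injective_linearMap _ A.injective_subtype

section Subquotient

variable {A B : Submodule ℚ M} (hBA : B ≤ A)

include hBA

theorem mkQ_baseChange_eq_zero_iff (b : ℂ ⊗[ℚ] A) :
    (B.submoduleOf A).mkQ.baseChange ℂ b = 0 ↔ A.subtype.baseChange ℂ b ∈ B.baseChange ℂ := by
  have hexact : Function.Exact (((B.submoduleOf A).subtype).lTensor ℂ)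
      (((B.submoduleOf A).mkQ).lTensor ℂ) :=
    Module.Flat.lTensor_exact ℂ (LinearMap.exact_subtype_mkQ _)
  let e := (Submodule.submoduleOfEquivOfLe hBA).baseChange ℚ ℂ
  have hcomp (a) : A.subtype.baseChange ℂ ((B.submoduleOf A).subtype.baseChange ℂ a) =
      B.subtype.baseChange ℂ (e a) := by
    change (A.subtype.baseChange ℂ ∘ₗ _) a = (B.subtype.baseChange ℂ ∘ₗ
      (Submodule.submoduleOfEquivOfLe hBA).toLinearMap.baseChange ℂ) a
    rw [← LinearMap.baseChange_comp, ← LinearMap.baseChange_comp]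
    rfl
  constructor
  · intro hb
    obtain ⟨a, rfl⟩ := (hexact b).1 hb
    exact ⟨e a, (hcomp a).symm⟩
  · rintro ⟨a, ha⟩
    refine (hexact b).2 ⟨e.symm a, subtype_baseChange_injective A ((hcomp _).trans ?_)⟩
    rwa [e.apply_symm_apply]

variable {k : ℤ} {F : ℤ → Submodule ℂ (ℂ ⊗[ℚ] M)}
  (hF : IsPureHodgeStructure k fun p => inducedOnQuotient A B (F p)) (p : ℤ)

include hF

theorem exists_sub_sub_conjC_mem_of_isPure {v : ℂ ⊗[ℚ] M} (hv : v ∈ A.baseChange ℂ) :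
    ∃ f ∈ F p ⊓ A.baseChange ℂ, ∃ g ∈ F (k - p + 1) ⊓ A.baseChange ℂ,
      v - f - conjC M g ∈ B.baseChange ℂ := by
  obtain ⟨a, rfl⟩ := hv
  have hmem : (B.submoduleOf A).mkQ.baseChange ℂ a ∈ _ :=
    (hF.opposed p).sup_eq_top ▸ Submodule.mem_top
  obtain ⟨_, ⟨b, hb, rfl⟩, _, ⟨_, ⟨b', hb', rfl⟩, rfl⟩, hsum⟩ := Submodule.mem_sup.1 hmem
  refine ⟨_, ⟨hb, b, rfl⟩, _, ⟨hb', b', rfl⟩, ?_⟩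
  rw [conjC_baseChange, ← map_sub, ← map_sub, ← mkQ_baseChange_eq_zero_iff hBA, map_sub, map_sub,
    ← hsum, conjC_baseChange]
  abel

theorem mem_of_sub_conjC_mem_of_isPure {f g : ℂ ⊗[ℚ] M} (hf : f ∈ F p ⊓ A.baseChange ℂ)
    (hg : g ∈ F (k - p + 1) ⊓ A.baseChange ℂ) (hfg : f - conjC M g ∈ B.baseChange ℂ) :
    f ∈ B.baseChange ℂ := by
  obtain ⟨hf, b, rfl⟩ := hf
  obtain ⟨hg, b', rfl⟩ := hg
  rw [conjC_baseChange, ← map_sub, ← mkQ_baseChange_eq_zero_iff hBA, map_sub, sub_eq_zero] at hfg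
  rw [← mkQ_baseChange_eq_zero_iff hBA]
  refine Submodule.disjoint_def.1 (hF.opposed p).disjoint _ ⟨b, hf, rfl⟩ ?_
  rw [hfg, ← conjC_baseChange]
  exact Submodule.mem_map_of_mem ⟨b', hg, rfl⟩

end Subquotient

variable {W : ℤ → Submodule ℚ M} {F : ℤ → Submodule ℂ (ℂ ⊗[ℚ] M)}

theorem isMixedHodgeStructure_of_graded (hW : Monotone W) (hWb : ∃ k, W k = ⊥)
    (hWt : ∃ k, W k = ⊤) (hF : Antitone F) (hFb : ∃ p, F p = ⊥) (hFt : ∃ p, F p = ⊤)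
    (hgr : ∀ k, IsPureHodgeStructure k fun p => inducedOnQuotient (W k) (W (k - 1)) (F p)) :
    IsMixedHodgeStructure (conjC M) (fun k => (W k).baseChange ℂ) F where
  conj_conj := conjC_conjC
  weight_mono _ _ hkl := Submodule.baseChange_mono _ (hW hkl)
  weight_bot := hWb.imp fun k hk => by simp [hk]
  weight_top := hWt.imp fun k hk => by simp [hk]
  conj_mem _ _ := conjC_mem_baseChange _
  hodge_anti := hF
  hodge_bot := hFb
  hodge_top := hFt
  graded_sup k p _ := exists_sub_sub_conjC_mem_of_isPure (hW (by lia)) (hgr k) p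
  graded_inf k p _ hf _ := mem_of_sub_conjC_mem_of_isPure (hW (by lia)) (hgr k) p hf

theorem IsDeligneBigrading.oppositeFiltration_eq_bigradedSum
    {I : ℤ → ℤ → Submodule ℂ (ℂ ⊗[ℚ] M)} (hI : IsDeligneBigrading W F I)
    (h : IsMixedHodgeStructure (conjC M) (fun k => (W k).baseChange ℂ) F) (p : ℤ) :
    oppositeFiltration (conjC M) (fun k => (W k).baseChange ℂ) F (p - 1) =
      bigradedSum I fun r _ => r < p := by
  have hind := hI.internal.submodule_iSupIndep
  have hodge (p) : F p = bigradedSum I fun r _ => p ≤ r := hI.hodge p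
  have weight (k) : (W k).baseChange ℂ = bigradedSum I fun r s => r + s ≤ k := hI.weight k
  apply h.oppositeFiltration_eq_of_le
  · refine iSup_le fun q => Submodule.map_le_iff_le_comap.2 ?_
    simp only [hodge, weight, bigradedSum_inf_bigradedSum hind]
    refine bigradedSum_le fun r s hrs => Submodule.map_le_iff_le_comap.1 ?_
    refine (le_sup_left.trans (hI.conj s r).ge).trans (sup_le (le_bigradedSum (by lia)) ?_)
    exact bigradedSum_le fun _ _ _ => le_bigradedSum (by lia)
  · rw [hodge]
    exact disjoint_bigradedSum hind fun _ _ hpr hrp => by lia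

section Definition

variable (W F)

theorem deligneU_eq_bigradedSum (p : ℤ) :
    deligneU W F p = bigradedSum (deligneI W F) fun r _ => r = p :=
  le_antisymm (iSup_le fun _ => le_bigradedSum rfl)
    (bigradedSum_le fun _ s hr => hr ▸ le_iSup (deligneI W F _) s)

theorem iSup_deligneU_ne_eq_bigradedSum (p : ℤ) :
    ⨆ (r : ℤ) (_ : r ≠ p), deligneU W F r = bigradedSum (deligneI W F) fun r _ => r ≠ p :=
  le_antisymm (iSup₂_le fun _ hr => iSup_le fun _ => le_bigradedSum hr)
    (bigradedSum_le fun r s hr => le_iSup₂_of_le r hr (le_iSup (deligneI W F r) s))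

end Definition

namespace IsMixedHodgeStructure

variable (h : IsMixedHodgeStructure (conjC M) (fun k => (W k).baseChange ℂ) F)

include h

theorem isDeligneBigrading_deligneBigrading :
    IsDeligneBigrading W F (deligneBigrading (conjC M) (fun k => (W k).baseChange ℂ) F) where
  internal := by
    refine DirectSum.isInternal_submodule_of_iSupIndep_of_iSup_eq_top
      h.iSupIndep_deligneBigrading ?_
    obtain ⟨m, hm⟩ := h.hodge_top
    rw [eq_top_iff, ← hm, h.hodge_eq_bigradedSum m]
    exact bigradedSum_le fun r s _ => le_iSup_of_le (r, s) le_rfl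
  hodge := h.hodge_eq_bigradedSum
  weight := h.weight_eq_bigradedSum
  conj := h.deligneBigrading_sup_eq_conj_sup

theorem isDeligneBigrading_deligneI : IsDeligneBigrading W F (deligneI W F) := by
  have hex : ∃ I, IsDeligneBigrading W F I := ⟨_, h.isDeligneBigrading_deligneBigrading⟩
  rw [deligneI, dif_pos hex]
  exact hex.choose_spec

theorem deligneU_eq_inf (p : ℤ) :
    deligneU W F p =
      F p ⊓ oppositeFiltration (conjC M) (fun k => (W k).baseChange ℂ) F p := by
  have hI := h.isDeligneBigrading_deligneI
  have hG := hI.oppositeFiltration_eq_bigradedSum h (p + 1)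
  have hF : F p = bigradedSum (deligneI W F) fun r _ => p ≤ r := hI.hodge p
  rw [add_sub_cancel_right] at hG
  rw [deligneU_eq_bigradedSum, hG, hF,
    bigradedSum_inf_bigradedSum hI.internal.submodule_iSupIndep]
  exact bigradedSum_congr fun r _ => by lia

theorem isCompl_deligneU (p : ℤ) :
    IsCompl (deligneU W F p) (⨆ (r : ℤ) (_ : r ≠ p), deligneU W F r) := by
  have hI := h.isDeligneBigrading_deligneI.internal
  rw [deligneU_eq_bigradedSum, iSup_deligneU_ne_eq_bigradedSum]
  refine ⟨disjoint_bigradedSum hI.submodule_iSupIndep fun _ _ hr hr' => hr' hr, ?_⟩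
  rw [codisjoint_iff, eq_top_iff, ← hI.submodule_iSup_eq_top]
  refine iSup_le fun i => ?_
  by_cases hi : i.1 = p
  · exact le_sup_of_le_left (le_bigradedSum hi)
  · exact le_sup_of_le_right (le_bigradedSum hi)

theorem hodge_le_iSup_deligneU_ne {p q : ℤ} (hpq : p < q) :
    F q ≤ ⨆ (r : ℤ) (_ : r ≠ p), deligneU W F r := by
  rw [iSup_deligneU_ne_eq_bigradedSum, h.isDeligneBigrading_deligneI.hodge]
  exact bigradedSum_mono fun r _ hr => by lia

theorem oppositeFiltration_le_iSup_deligneU_ne (p : ℤ) :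
    oppositeFiltration (conjC M) (fun k => (W k).baseChange ℂ) F (p - 1) ≤
      ⨆ (r : ℤ) (_ : r ≠ p), deligneU W F r := by
  rw [iSup_deligneU_ne_eq_bigradedSum,
    h.isDeligneBigrading_deligneI.oppositeFiltration_eq_bigradedSum h]
  exact bigradedSum_mono fun r _ hr => by lia

theorem gradedProj_deligneU_eq_sub {p : ℤ} {v f f' : ℂ ⊗[ℚ] M} (hf : f ∈ F p)
    (hvf : v - f ∈ oppositeFiltration (conjC M) (fun k => (W k).baseChange ℂ) F (p - 1))
    (hf' : f' ∈ F (p + 1))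
    (hvf' : v - f' ∈ oppositeFiltration (conjC M) (fun k => (W k).baseChange ℂ) F p) :
    gradedProj (deligneU W F) p v = f - f' := by
  have hcompl := h.isCompl_deligneU p
  rw [gradedProj, dif_pos hcompl]
  change (deligneU W F p).projection _ hcompl v = f - f'
  have hU : f - f' ∈ deligneU W F p := by
    rw [h.deligneU_eq_inf]
    refine ⟨Submodule.sub_mem _ hf (h.hodge_anti (by lia) hf'), ?_⟩
    simpa using Submodule.sub_mem _ hvf' (h.oppositeFiltration_mono (by lia : p - 1 ≤ p) hvf)
  have hU' : f' + (v - f) ∈ ⨆ (r : ℤ) (_ : r ≠ p), deligneU W F r :=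
    Submodule.add_mem _ (h.hodge_le_iSup_deligneU_ne (by lia) hf')
      (h.oppositeFiltration_le_iSup_deligneU_ne p hvf)
  rw [show v = (f - f') + (f' + (v - f)) by abel, map_add,
    Submodule.projection_apply_of_mem_left hcompl hU,
    Submodule.projection_apply_of_mem_right hcompl hU', add_zero]

end IsMixedHodgeStructure

end Rational

/-! ### Transport and perturbation of filtrations -/

section Transport

variable {V V' : Type*} [AddCommGroup V] [Module ℂ V] [AddCommGroup V'] [Module ℂ V']
  (e : V ≃ₗ[ℂ] V') {c : V →ₛₗ[starRingEnd ℂ] V} {c' : V' →ₛₗ[starRingEnd ℂ] V'}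
  (hc : ∀ v, c' (e v) = e (c v)) {W F : ℤ → Submodule ℂ V}

include hc

theorem oppositeFiltration_map (p : ℤ) :
    oppositeFiltration c' (fun k => (W k).map e.toLinearMap) (fun r => (F r).map e.toLinearMap) p =
      (oppositeFiltration c W F p).map e.toLinearMap := by
  rw [oppositeFiltration, oppositeFiltration, Submodule.map_iSup]
  refine iSup_congr fun q => ?_
  rw [← Submodule.map_inf _ e.injective]
  ext v
  constructor
  · rintro ⟨_, ⟨w, hw, rfl⟩, rfl⟩
    exact ⟨c w, ⟨w, hw, rfl⟩, (hc w).symm⟩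
  · rintro ⟨_, ⟨w, hw, rfl⟩, rfl⟩
    exact ⟨e w, ⟨w, hw, rfl⟩, hc w⟩

theorem IsMixedHodgeStructure.map (h : IsMixedHodgeStructure c W F) :
    IsMixedHodgeStructure c' (fun k => (W k).map e.toLinearMap)
      (fun r => (F r).map e.toLinearMap) where
  conj_conj := e.surjective.forall.2 fun v => by rw [hc, hc, h.conj_conj]
  weight_mono _ _ hkl := Submodule.map_mono (h.weight_mono hkl)
  weight_bot := h.weight_bot.imp fun k hk => by simp [hk]
  weight_top := h.weight_top.imp fun k hk => by simp [hk]
  conj_mem := by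
    rintro k _ ⟨v, hv, rfl⟩
    exact ⟨c v, h.conj_mem _ _ hv, (hc v).symm⟩
  hodge_anti _ _ hkl := Submodule.map_mono (h.hodge_anti hkl)
  hodge_bot := h.hodge_bot.imp fun k hk => by simp [hk]
  hodge_top := h.hodge_top.imp fun k hk => by simp [hk]
  graded_sup := by
    rintro k p _ ⟨v, hv, rfl⟩
    obtain ⟨f, hf, g, hg, hfg⟩ := h.graded_sup k p v hv
    refine ⟨e f, ⟨⟨f, hf.1, rfl⟩, ⟨f, hf.2, rfl⟩⟩, e g, ⟨⟨g, hg.1, rfl⟩, ⟨g, hg.2, rfl⟩⟩, ?_⟩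
    rw [hc]
    exact ⟨_, hfg, by simp⟩
  graded_inf k p f hf g hg hfg := by
    rw [← Submodule.map_inf _ e.injective] at hf hg
    obtain ⟨f, hf, rfl⟩ := hf
    obtain ⟨g, hg, rfl⟩ := hg
    refine ⟨f, h.graded_inf k p f hf g hg ?_, rfl⟩
    obtain ⟨w, hw, hwfg⟩ := hfg
    rwa [show f - c g = w from e.injective (by simpa [hc] using hwfg.symm)]

end Transport

section Perturbation

variable {R V : Type*} [Ring R] [AddCommGroup V] [Module R V] {W : ℤ → Submodule R V}
  {F F' B : Submodule R V} (hWb : ∃ k₀, ∀ k ≤ k₀, W k = ⊥)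
  (hdec : ∀ k, W k ≤ (F ⊓ W k) ⊔ (B ⊓ W k))

include hWb hdec

theorem disjoint_of_graded_le (hWt : ∃ k, W k = ⊤) (hFB : Disjoint F B)
    (hgr : ∀ k, ∀ f' ∈ F' ⊓ W k, ∃ f ∈ F ⊓ W k, f' - f ∈ W (k - 1)) : Disjoint F' B := by
  rw [Submodule.disjoint_def]
  intro v hF hB
  obtain ⟨k₀, hk₀⟩ := hWb
  obtain ⟨m, hm⟩ := hWt
  have eq_zero_of_mem_weight : ∀ k, v ∈ W k → v = 0 := by
    refine int_induction_of_forall_le k₀ (fun k hk hv => by simpa [hk₀ k hk] using hv)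
      fun k ih hv => ih ?_
    obtain ⟨f, hf, hw⟩ := hgr k v ⟨hF, hv⟩
    obtain ⟨f₁, hf₁, b, hb, hsum⟩ := Submodule.mem_sup.1 (hdec _ hw)
    obtain rfl : v = f + f₁ + b := by rw [add_assoc, hsum, add_sub_cancel]
    have hzero : f + f₁ = 0 := Submodule.disjoint_def.1 hFB _ (Submodule.add_mem _ hf.1 hf₁.1)
      ((Submodule.add_mem_iff_left _ hb.1).1 hB)
    rw [hzero, zero_add]
    exact hb.2
  exact eq_zero_of_mem_weight m (hm ▸ Submodule.mem_top)

theorem exists_decomposition_of_graded_le (hWm : Monotone W)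
    (hgr : ∀ k, ∀ f ∈ F ⊓ W k, ∃ f' ∈ F' ⊓ W k, f - f' ∈ W (k - 1)) {k : ℤ} {w : V}
    (hw : w ∈ W k) :
    ∃ f ∈ F ⊓ W k, ∃ f' ∈ F' ⊓ W k, w - f ∈ B ∧ w - f' ∈ B ∧ f - f' ∈ W (k - 1) := by
  obtain ⟨k₀, hk₀⟩ := hWb
  induction k using int_induction_of_forall_le k₀ generalizing w with
  | base k hk =>
    obtain rfl : w = 0 := by simpa [hk₀ k hk] using hw
    exact ⟨0, Submodule.zero_mem _, 0, Submodule.zero_mem _, by simp⟩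
  | step k ih =>
    obtain ⟨f, hf, b, hb, rfl⟩ := Submodule.mem_sup.1 (hdec k hw)
    obtain ⟨f', hf', hff'⟩ := hgr k f hf
    obtain ⟨-, -, g', hg', -, hgB, -⟩ := ih hff'
    refine ⟨f, hf, f' + g', Submodule.add_mem _ hf' ⟨hg'.1, hWm (by lia) hg'.2⟩, ?_, ?_, ?_⟩
    · simpa using hb.1
    · rw [show f + b - (f' + g') = b + (f - f' - g') by abel]
      exact Submodule.add_mem _ hb.1 hgB
    · rw [← sub_sub]
      exact Submodule.sub_mem _ hff' hg'.2

end Perturbation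

/-! ### Calculus relative to a subspace -/

section Calculus

variable {𝕜 E N : Type*} [RCLike 𝕜] [NormedAddCommGroup E] [NormedSpace 𝕜 E]
  [NormedAddCommGroup N] [NormedSpace 𝕜 N] [FiniteDimensional 𝕜 N]

theorem exists_clm_eq_zero_iff_mem (M : Submodule 𝕜 N) :
    ∃ ℓ : N →L[𝕜] N, ∀ v, ℓ v = 0 ↔ v ∈ M := by
  obtain ⟨C, hC⟩ := M.exists_isCompl
  exact ⟨LinearMap.toContinuousLinearMap (C.projection M hC.symm), fun v =>
    Submodule.projection_apply_eq_zero_iff hC.symm⟩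

theorem fderiv_mem_of_sub_mem {f : E → N} {z : E} (M : Submodule 𝕜 N)
    (hf : DifferentiableAt 𝕜 f z) (h : ∀ᶠ y in 𝓝 z, f y - f z ∈ M) (v : E) :
    fderiv 𝕜 f z v ∈ M := by
  obtain ⟨ℓ, hℓ⟩ := exists_clm_eq_zero_iff_mem M
  have hconst : (fun y => ℓ (f y)) =ᶠ[𝓝 z] fun _ => ℓ (f z) := by
    filter_upwards [h] with y hy
    rwa [← sub_eq_zero, ← map_sub, hℓ]
  have hderiv : HasFDerivAt (fun y => ℓ (f y)) (ℓ ∘L fderiv 𝕜 f z) z :=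
    ℓ.hasFDerivAt.comp z hf.hasFDerivAt
  have hzero : ℓ ∘L fderiv 𝕜 f z = 0 :=
    hderiv.unique ((hasFDerivAt_const (ℓ (f z)) z).congr_of_eventuallyEq hconst)
  exact (hℓ _).1 (congrArg (fun L => L v) hzero)

theorem sub_mem_of_fderiv_mem [NormedSpace ℝ E] {f : E → N} {Ω : Set E} (hΩ : IsOpen Ω)
    (hc : IsPreconnected Ω) (M : Submodule 𝕜 N) (hf : ∀ y ∈ Ω, DifferentiableAt 𝕜 f y)
    (h : ∀ y ∈ Ω, ∀ v, fderiv 𝕜 f y v ∈ M) {z z' : E} (hz : z ∈ Ω) (hz' : z' ∈ Ω) :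
    f z - f z' ∈ M := by
  obtain ⟨ℓ, hℓ⟩ := exists_clm_eq_zero_iff_mem M
  have hderiv : ∀ y ∈ Ω, HasFDerivAt (fun y => ℓ (f y)) (ℓ ∘L fderiv 𝕜 f y) y := fun y hy =>
    ℓ.hasFDerivAt.comp y (hf y hy).hasFDerivAt
  have hconst := hΩ.is_const_of_fderiv_eq_zero (𝕜 := 𝕜) hc
    (fun y hy => (hderiv y hy).differentiableAt.differentiableWithinAt)
    (fun y hy => by
      rw [(hderiv y hy).fderiv]
      ext v
      exact (hℓ _).2 (h y hy v)) hz hz'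
  rw [← hℓ, map_sub, hconst, sub_self]

section Projection

variable {ι : Type*} [Fintype ι] {f : ι → N} {B : Submodule 𝕜 N}

variable (f B) in
/-- The map `(a, b) ↦ ∑ i, a i • f i + b`, invertible when `f` is a basis of a complement of `B`. -/
def combinationCoprod : ((ι → 𝕜) × B) →L[𝕜] N :=
  (∑ i, ((ContinuousLinearMap.proj (R := 𝕜) (φ := fun _ : ι => 𝕜) i).comp
    (ContinuousLinearMap.fst 𝕜 (ι → 𝕜) B)).smulRight (f i)) +
    B.subtypeL.comp (ContinuousLinearMap.snd 𝕜 (ι → 𝕜) B)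

omit [FiniteDimensional 𝕜 N] in
theorem combinationCoprod_apply (x : (ι → 𝕜) × B) :
    combinationCoprod f B x = ∑ i, x.1 i • f i + x.2 := by
  simp [combinationCoprod, sum_apply]

theorem combinationCoprod_isInvertible (hf : LinearIndependent 𝕜 f)
    (h : IsCompl (Submodule.span 𝕜 (Set.range f)) B) : (combinationCoprod f B).IsInvertible := by
  have hinj : Function.Injective (combinationCoprod f B) := by
    rw [injective_iff_map_eq_zero]
    rintro ⟨a, b⟩ hab
    rw [combinationCoprod_apply] at hab
    have hcomb : ∑ i, a i • f i = 0 := by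
      refine Submodule.disjoint_def.1 h.disjoint _
        ((Submodule.mem_span_range_iff_exists_fun 𝕜).2 ⟨a, rfl⟩) ?_
      rw [eq_neg_of_add_eq_zero_left hab]
      exact B.neg_mem b.2
    simp only [hcomb, zero_add] at hab
    exact Prod.ext (funext (Fintype.linearIndependent_iff.1 hf a hcomb)) (Subtype.ext hab)
  have hsurj : Function.Surjective (combinationCoprod f B) := fun w => by
    obtain ⟨u, hu, b, hb, rfl⟩ := Submodule.mem_sup.1
      (h.sup_eq_top ▸ Submodule.mem_top : w ∈ Submodule.span 𝕜 (Set.range f) ⊔ B)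
    obtain ⟨a, rfl⟩ := (Submodule.mem_span_range_iff_exists_fun 𝕜).1 hu
    exact ⟨(a, ⟨b, hb⟩), combinationCoprod_apply _⟩
  exact ⟨(LinearEquiv.ofBijective (combinationCoprod f B).toLinearMap
    ⟨hinj, hsurj⟩).toContinuousLinearEquiv, by ext x <;> rfl⟩

omit [FiniteDimensional 𝕜 N] in
theorem eq_sub_snd_inverse_combinationCoprod (h : (combinationCoprod f B).IsInvertible) {u w : N}
    (hu : u ∈ Submodule.span 𝕜 (Set.range f)) (hw : w - u ∈ B) :
    u = w - ((combinationCoprod f B).inverse w).2 := by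
  obtain ⟨a, rfl⟩ := (Submodule.mem_span_range_iff_exists_fun 𝕜).1 hu
  have hsol : combinationCoprod f B (a, ⟨_, hw⟩) = w := by simp [combinationCoprod_apply]
  obtain ⟨e, he⟩ := h
  rw [← he] at hsol ⊢
  rw [ContinuousLinearMap.inverse_equiv, ContinuousLinearEquiv.coe_coe,
    e.symm_apply_eq.2 hsol.symm, sub_sub_cancel]

omit [Fintype ι] in
theorem contDiffAt_projection [Finite ι] {n : WithTop ℕ∞} {f : ι → E → N} {K : E → Submodule 𝕜 N}
    {P : E → N →L[𝕜] N} {z : E}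
    (hf : ∀ᶠ y in 𝓝 z, (∀ i, ContDiffAt 𝕜 n (f i) y) ∧ LinearIndependent 𝕜 (fun i => f i y) ∧
      Submodule.span 𝕜 (Set.range fun i => f i y) = K y)
    (hP : ∀ᶠ y in 𝓝 z, Disjoint (K y) B ∧ ∀ w, P y w ∈ K y ∧ w - P y w ∈ B) :
    ContDiffAt 𝕜 n P z := by
  cases nonempty_fintype ι
  have hinv : ∀ᶠ y in 𝓝 z, (combinationCoprod (fun i => f i y) B).IsInvertible ∧
      P y = ContinuousLinearMap.id 𝕜 N - (B.subtypeL.comp (ContinuousLinearMap.snd 𝕜 _ B)).comp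
        (combinationCoprod (fun i => f i y) B).inverse := by
    filter_upwards [hf, hP] with y ⟨_, hli, hspan⟩ ⟨hdisj, hPy⟩
    rw [← hspan] at hdisj hPy
    have hcompl : IsCompl (Submodule.span 𝕜 (Set.range fun i => f i y)) B :=
      ⟨hdisj, Submodule.codisjoint_iff_exists_add_eq.2 fun w =>
        ⟨_, _, (hPy w).1, (hPy w).2, add_sub_cancel _ _⟩⟩
    have hy := combinationCoprod_isInvertible hli hcompl
    refine ⟨hy, ContinuousLinearMap.ext fun w => ?_⟩
    exact eq_sub_snd_inverse_combinationCoprod hy (hPy w).1 (hPy w).2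
  have hcont : ContDiffAt 𝕜 n (fun y => combinationCoprod (fun i => f i y) B) z :=
    (ContDiffAt.sum fun i _ => contDiffAt_const.smulRight (hf.self_of_nhds.1 i)).add
      contDiffAt_const
  refine ContDiffAt.congr_of_eventuallyEq ?_ (hinv.mono fun y hy => hy.2)
  refine contDiffAt_const.sub (contDiffAt_const.clm_comp ?_)
  exact ContDiffAt.comp (g := ContinuousLinearMap.inverse) z
    (ContinuousLinearMap.IsInvertible.contDiffAt_map_inverse hinv.self_of_nhds.1) hcont

end Projection

end Calculus

/-! ### Unipotent variations in a flat frame over a convex open set -/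

section LocalModel

variable {E N : Type*} [NormedAddCommGroup E] [NormedSpace ℂ E] [NormedAddCommGroup N]
  [NormedSpace ℂ N] [FiniteDimensional ℂ N]

/-- A unipotent variation of mixed Hodge structure on a convex open subset `Ω` of a vector space,
written in a flat frame: the weight filtration `W` and the conjugation `c` are constant, and `K p z`
is the step of index `p` of the Hodge filtration at `z`. -/
structure IsLocalVariation (Ω : Set E) (c : N →ₛₗ[starRingEnd ℂ] N) (W : ℤ → Submodule ℂ N)
    (K : ℤ → E → Submodule ℂ N) : Prop where
  isOpen : IsOpen Ω
  convex : Convex ℝ Ω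
  mixedHodge : ∀ z ∈ Ω, IsMixedHodgeStructure c W fun p => K p z
  graded_le : ∀ z ∈ Ω, ∀ z' ∈ Ω, ∀ p k, ∀ f ∈ K p z ⊓ W k, ∃ f' ∈ K p z' ⊓ W k, f - f' ∈ W (k - 1)
  exists_frame : ∀ p, ∀ z ∈ Ω, ∃ (m : ℕ) (f : Fin m → E → N), ∀ᶠ y in 𝓝 z,
    (∀ i, ContDiffAt ℂ ω (f i) y) ∧ LinearIndependent ℂ (fun i => f i y) ∧
      Submodule.span ℂ (Set.range fun i => f i y) = K p y
  horizontal : ∀ p, ∀ z ∈ Ω, ∀ f : E → N, (∀ᶠ y in 𝓝 z, ContDiffAt ℂ ω f y ∧ f y ∈ K p y) →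
    ∀ v, fderiv ℂ f z v ∈ K (p - 1) z

open Classical in
/-- The projection onto `K p z` along the term of index `p - 1` of the filtration opposite to
`K · z₀`; it is `0` when these are not complementary. -/
def hodgeProj (c : N →ₛₗ[starRingEnd ℂ] N) (W : ℤ → Submodule ℂ N) (K : ℤ → E → Submodule ℂ N)
    (z₀ : E) (p : ℤ) (z : E) : N →L[ℂ] N :=
  if h : IsCompl (K p z) (oppositeFiltration c W (fun r => K r z₀) (p - 1)) then
    LinearMap.toContinuousLinearMap ((K p z).projection _ h) else 0

/-- The projection onto the summand of index `p` of the grading by the `𝓤^p`. -/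
def summandProj (c : N →ₛₗ[starRingEnd ℂ] N) (W : ℤ → Submodule ℂ N) (K : ℤ → E → Submodule ℂ N)
    (z₀ : E) (p : ℤ) (z : E) : N →L[ℂ] N :=
  hodgeProj c W K z₀ p z - hodgeProj c W K z₀ (p + 1) z

/-- The sum `∑_{a < p ≤ b}` of the projections onto the steps of the Hodge filtration. Up to an
additive constant it is the endomorphism with eigenvalue `p` on `𝓤^p`, and its derivative is the
Higgs field. -/
def gradingOp (c : N →ₛₗ[starRingEnd ℂ] N) (W : ℤ → Submodule ℂ N) (K : ℤ → E → Submodule ℂ N)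
    (z₀ : E) (a b : ℤ) (z : E) : N →L[ℂ] N :=
  ∑ p ∈ Finset.Ioc a b, hodgeProj c W K z₀ p z

/-- The Hodge filtrations `K · z` with `z ∈ Ω` have all their jumps in `[a, b]`, expressed through
the projections onto their steps. -/
structure IsHodgeRange (Ω : Set E) (c : N →ₛₗ[starRingEnd ℂ] N) (W : ℤ → Submodule ℂ N)
    (K : ℤ → E → Submodule ℂ N) (z₀ : E) (a b : ℤ) : Prop where
  le : a ≤ b
  eq_one : ∀ z ∈ Ω, ∀ p ≤ a, hodgeProj c W K z₀ p z = 1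
  eq_zero : ∀ z ∈ Ω, ∀ p > b, hodgeProj c W K z₀ p z = 0

/-- The sum `∑_{p + q ≤ k} F^q ∩ W_{p+q}`, whose conjugate is `oppositeFiltrationTrunc`. -/
def hodgeWeightSum (W F : ℤ → Submodule ℂ N) (p k : ℤ) : Submodule ℂ N :=
  ⨆ (q : ℤ) (_ : p + q ≤ k), F q ⊓ W (p + q)

omit [FiniteDimensional ℂ N] in
theorem mem_hodgeWeightSum {W F : ℤ → Submodule ℂ N} {p k q : ℤ} (hq : p + q ≤ k) {w : N}
    (hw : w ∈ F q ⊓ W (p + q)) : w ∈ hodgeWeightSum W F p k :=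
  Submodule.mem_iSup_of_mem q (Submodule.mem_iSup_of_mem hq hw)

omit [FiniteDimensional ℂ N] in
theorem hodgeWeightSum_mono (W F : ℤ → Submodule ℂ N) (p : ℤ) : Monotone (hodgeWeightSum W F p) :=
  fun _ _ hk => iSup₂_le fun _ hq _ hw => mem_hodgeWeightSum (hq.trans hk) hw

namespace IsLocalVariation

variable {Ω : Set E} {c : N →ₛₗ[starRingEnd ℂ] N} {W : ℤ → Submodule ℂ N}
  {K : ℤ → E → Submodule ℂ N} (h : IsLocalVariation Ω c W K) {z₀ : E} (hz₀ : z₀ ∈ Ω)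

include h hz₀

omit [FiniteDimensional ℂ N] in
theorem exists_decomposition {z : E} (hz : z ∈ Ω) (p : ℤ) {k : ℤ} {w : N} (hw : w ∈ W k) :
    ∃ f ∈ K p z₀ ⊓ W k, ∃ f' ∈ K p z ⊓ W k,
      w - f ∈ oppositeFiltration c W (fun r => K r z₀) (p - 1) ∧
      w - f' ∈ oppositeFiltration c W (fun r => K r z₀) (p - 1) ∧ f - f' ∈ W (k - 1) :=
  exists_decomposition_of_graded_le (h.mixedHodge z₀ hz₀).exists_forall_le_weight_eq_bot
    ((h.mixedHodge z₀ hz₀).weight_le_sup p) (h.mixedHodge z₀ hz₀).weight_mono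
    (h.graded_le z₀ hz₀ z hz p) hw

omit [FiniteDimensional ℂ N] in
theorem isCompl_oppositeFiltration {z : E} (hz : z ∈ Ω) (p : ℤ) :
    IsCompl (K p z) (oppositeFiltration c W (fun r => K r z₀) (p - 1)) := by
  have h₀ := h.mixedHodge z₀ hz₀
  obtain ⟨m, hm⟩ := h₀.weight_top
  refine ⟨disjoint_of_graded_le h₀.exists_forall_le_weight_eq_bot (h₀.weight_le_sup p) ⟨m, hm⟩
    (h₀.disjoint_oppositeFiltration p) (h.graded_le z hz z₀ hz₀ p),
    Submodule.codisjoint_iff_exists_add_eq.2 fun w => ?_⟩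
  obtain ⟨-, -, f', hf', -, hB, -⟩ :=
    h.exists_decomposition hz₀ hz p (hm ▸ Submodule.mem_top : w ∈ W m)
  exact ⟨f', _, hf'.1, hB, add_sub_cancel _ _⟩

theorem hodgeProj_spec {z : E} (hz : z ∈ Ω) (p : ℤ) (w : N) :
    hodgeProj c W K z₀ p z w ∈ K p z ∧
      w - hodgeProj c W K z₀ p z w ∈ oppositeFiltration c W (fun r => K r z₀) (p - 1) := by
  have hc := h.isCompl_oppositeFiltration hz₀ hz p
  rw [hodgeProj, dif_pos hc]
  exact ⟨Submodule.projection_apply_mem hc w, Submodule.sub_projection_mem hc w⟩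

theorem hodgeProj_eq {z : E} (hz : z ∈ Ω) (p : ℤ) {w f : N} (hf : f ∈ K p z)
    (hwf : w - f ∈ oppositeFiltration c W (fun r => K r z₀) (p - 1)) :
    hodgeProj c W K z₀ p z w = f := by
  obtain ⟨hP, hwP⟩ := h.hodgeProj_spec hz₀ hz p w
  refine sub_eq_zero.1 (Submodule.disjoint_def.1 (h.isCompl_oppositeFiltration hz₀ hz p).disjoint _
    (Submodule.sub_mem _ hP hf) ?_)
  simpa using Submodule.sub_mem _ hwf hwP

theorem hodgeProj_of_mem {z : E} (hz : z ∈ Ω) {p : ℤ} {w : N} (hw : w ∈ K p z) :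
    hodgeProj c W K z₀ p z w = w :=
  h.hodgeProj_eq hz₀ hz p hw (by simp)

theorem hodgeProj_of_mem_oppositeFiltration {z : E} (hz : z ∈ Ω) {p : ℤ} {w : N}
    (hw : w ∈ oppositeFiltration c W (fun r => K r z₀) (p - 1)) : hodgeProj c W K z₀ p z w = 0 :=
  h.hodgeProj_eq hz₀ hz p (Submodule.zero_mem _) (by simpa using hw)

theorem hodgeProj_mem_weight {z : E} (hz : z ∈ Ω) (p : ℤ) {k : ℤ} {w : N} (hw : w ∈ W k) :
    hodgeProj c W K z₀ p z w ∈ W k := by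
  obtain ⟨-, -, f', hf', -, hB, -⟩ := h.exists_decomposition hz₀ hz p hw
  rw [h.hodgeProj_eq hz₀ hz p hf'.1 hB]
  exact hf'.2

theorem hodgeProj_sub_mem_weight {z z' : E} (hz : z ∈ Ω) (hz' : z' ∈ Ω) (p : ℤ) {k : ℤ} {w : N}
    (hw : w ∈ W k) :
    hodgeProj c W K z₀ p z w - hodgeProj c W K z₀ p z' w ∈ W (k - 1) := by
  have sub_mem_of_base : ∀ y ∈ Ω,
      hodgeProj c W K z₀ p z₀ w - hodgeProj c W K z₀ p y w ∈ W (k - 1) := fun y hy => by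
    obtain ⟨f, hf, f', hf', hA, hB, hd⟩ := h.exists_decomposition hz₀ hy p hw
    rwa [h.hodgeProj_eq hz₀ hy p hf'.1 hB, h.hodgeProj_eq hz₀ hz₀ p hf.1 hA]
  simpa using Submodule.sub_mem _ (sub_mem_of_base z' hz') (sub_mem_of_base z hz)

theorem contDiffAt_hodgeProj {z : E} (hz : z ∈ Ω) (p : ℤ) :
    ContDiffAt ℂ ω (hodgeProj c W K z₀ p) z := by
  obtain ⟨m, f, hf⟩ := h.exists_frame p z hz
  refine contDiffAt_projection (B := oppositeFiltration c W (fun r => K r z₀) (p - 1)) hf ?_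
  filter_upwards [h.isOpen.mem_nhds hz] with y hy
  exact ⟨(h.isCompl_oppositeFiltration hz₀ hy p).disjoint, h.hodgeProj_spec hz₀ hy p⟩

theorem hasFDerivAt_hodgeProj {z : E} (hz : z ∈ Ω) (p : ℤ) :
    HasFDerivAt (hodgeProj c W K z₀ p) (fderiv ℂ (hodgeProj c W K z₀ p) z) z :=
  ((h.contDiffAt_hodgeProj hz₀ hz p).differentiableAt (by simp)).hasFDerivAt

theorem hasFDerivAt_hodgeProj_apply {z : E} (hz : z ∈ Ω) (p : ℤ) (w : N) :
    HasFDerivAt (fun y => hodgeProj c W K z₀ p y w)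
      ((fderiv ℂ (hodgeProj c W K z₀ p) z).flip w) z := by
  simpa using (h.hasFDerivAt_hodgeProj hz₀ hz p).clm_apply (hasFDerivAt_const w z)

theorem fderiv_hodgeProj_mem_hodge {z : E} (hz : z ∈ Ω) (p : ℤ) (v : E) (w : N) :
    fderiv ℂ (hodgeProj c W K z₀ p) z v w ∈ K (p - 1) z := by
  have hhor := h.horizontal p z hz (fun y => hodgeProj c W K z₀ p y w) (by
    filter_upwards [h.isOpen.mem_nhds hz] with y hy
    exact ⟨(h.contDiffAt_hodgeProj hz₀ hy p).clm_apply contDiffAt_const,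
      (h.hodgeProj_spec hz₀ hy p w).1⟩) v
  rwa [(h.hasFDerivAt_hodgeProj_apply hz₀ hz p w).fderiv] at hhor

theorem fderiv_hodgeProj_mem_weight {z : E} (hz : z ∈ Ω) (p : ℤ) {k : ℤ} (v : E) {w : N}
    (hw : w ∈ W k) : fderiv ℂ (hodgeProj c W K z₀ p) z v w ∈ W (k - 1) := by
  have hderiv := h.hasFDerivAt_hodgeProj_apply hz₀ hz p w
  have hmem := fderiv_mem_of_sub_mem (W (k - 1)) hderiv.differentiableAt (by
    filter_upwards [h.isOpen.mem_nhds hz] with y hy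
    exact h.hodgeProj_sub_mem_weight hz₀ hy hz p hw) v
  rwa [hderiv.fderiv] at hmem

/-! #### Flatness of the opposite filtration -/

omit hz₀ in
/-- Griffiths transversality and unipotence together lower `p + q` when an element of
`F^q ∩ W_{p+q}` is differentiated, so that its variation is controlled by induction on the
weight. -/
theorem hodgeWeightSum_le (p k : ℤ) : ∀ z ∈ Ω, ∀ z' ∈ Ω,
    hodgeWeightSum W (fun q => K q z) p k ≤ hodgeWeightSum W (fun q => K q z') p k := by
  rcases Ω.eq_empty_or_nonempty with rfl | ⟨z₀, hz₀⟩
  · simp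
  obtain ⟨k₀, hk₀⟩ := (h.mixedHodge z₀ hz₀).exists_forall_le_weight_eq_bot
  induction k using int_induction_of_forall_le k₀ with
  | base k hk => exact fun z _ z' _ => iSup₂_le fun q hq => by simp [hk₀ (p + q) (by lia)]
  | step k ih =>
    refine fun z hz z' hz' => iSup₂_le fun q hq w hw => ?_
    have hvar : hodgeProj c W K z q z w - hodgeProj c W K z q z' w ∈
        hodgeWeightSum W (fun q => K q z') p (k - 1) := by
      refine sub_mem_of_fderiv_mem h.isOpen h.convex.isPreconnected _
        (fun y hy => (h.hasFDerivAt_hodgeProj_apply hz hy q w).differentiableAt)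
        (fun y hy v => ih y hy z' hz' ?_) hz hz'
      rw [(h.hasFDerivAt_hodgeProj_apply hz hy q w).fderiv]
      refine mem_hodgeWeightSum (q := q - 1) (by lia)
        ⟨h.fderiv_hodgeProj_mem_hodge hz hy q v w, ?_⟩
      rw [← add_sub_assoc]
      exact h.fderiv_hodgeProj_mem_weight hz hy q v hw.2
    have hproj : hodgeProj c W K z q z' w ∈ hodgeWeightSum W (fun q => K q z') p k :=
      mem_hodgeWeightSum hq ⟨(h.hodgeProj_spec hz hz' q w).1, h.hodgeProj_mem_weight hz hz' q hw.2⟩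
    rw [h.hodgeProj_of_mem hz hz hw.1] at hvar
    simpa using Submodule.add_mem _ (hodgeWeightSum_mono _ _ _ (sub_one_lt k).le hvar) hproj

omit hz₀ in
theorem oppositeFiltration_eq {z z' : E} (hz : z ∈ Ω) (hz' : z' ∈ Ω) (p : ℤ) :
    oppositeFiltration c W (fun r => K r z) p = oppositeFiltration c W (fun r => K r z') p := by
  have oppositeFiltration_le : ∀ z ∈ Ω, ∀ z' ∈ Ω, oppositeFiltration c W (fun r => K r z) p ≤
      oppositeFiltration c W (fun r => K r z') p := by
    intro z hz z' hz'
    rw [oppositeFiltration, oppositeFiltration, ← Submodule.map_iSup, ← Submodule.map_iSup]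
    refine Submodule.map_mono (iSup_le fun q w hw => ?_)
    have hle : hodgeWeightSum W (fun q => K q z') p (p + q) ≤ ⨆ r, K r z' ⊓ W (p + r) :=
      iSup_mono fun r => iSup_le fun _ => le_rfl
    exact hle
      (h.hodgeWeightSum_le p (p + q) z hz z' hz' (mem_hodgeWeightSum le_rfl hw))
  exact le_antisymm (oppositeFiltration_le z hz z' hz') (oppositeFiltration_le z' hz' z hz)

/-! #### Products of the projections and of their derivatives -/

theorem hodgeProj_mul_of_le {z z' : E} (hz : z ∈ Ω) (hz' : z' ∈ Ω) {p r : ℤ} (hpr : p ≤ r) :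
    hodgeProj c W K z₀ r z * hodgeProj c W K z₀ p z' = hodgeProj c W K z₀ r z := by
  ext w
  have hker := h.hodgeProj_of_mem_oppositeFiltration hz₀ hz (p := r)
    ((h.mixedHodge z₀ hz₀).oppositeFiltration_mono (by lia : p - 1 ≤ r - 1)
      (h.hodgeProj_spec hz₀ hz' p w).2)
  rw [map_sub, sub_eq_zero] at hker
  exact hker.symm

theorem hodgeProj_mul_of_ge {z : E} (hz : z ∈ Ω) {p r : ℤ} (hpr : p ≤ r) :
    hodgeProj c W K z₀ p z * hodgeProj c W K z₀ r z = hodgeProj c W K z₀ r z := by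
  ext w
  exact h.hodgeProj_of_mem hz₀ hz ((h.mixedHodge z hz).hodge_anti hpr
    (h.hodgeProj_spec hz₀ hz r w).1)

theorem hodgeProj_mul_fderiv_of_lt {z : E} (hz : z ∈ Ω) (v : E) {p r : ℤ} (hrp : r < p) :
    hodgeProj c W K z₀ r z * fderiv ℂ (hodgeProj c W K z₀ p) z v =
      fderiv ℂ (hodgeProj c W K z₀ p) z v := by
  ext w
  exact h.hodgeProj_of_mem hz₀ hz ((h.mixedHodge z hz).hodge_anti (by lia : r ≤ p - 1)
    (h.fderiv_hodgeProj_mem_hodge hz₀ hz p v w))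

theorem hodgeProj_mul_fderiv_of_le {z : E} (hz : z ∈ Ω) (v : E) {p r : ℤ} (hpr : p ≤ r) :
    hodgeProj c W K z₀ r z * fderiv ℂ (hodgeProj c W K z₀ p) z v = 0 := by
  have hconst : (fun y => hodgeProj c W K z₀ r z * hodgeProj c W K z₀ p y) =ᶠ[𝓝 z]
      fun _ => hodgeProj c W K z₀ r z := by
    filter_upwards [h.isOpen.mem_nhds hz] with y hy using h.hodgeProj_mul_of_le hz₀ hz hy hpr
  have hderiv := (h.hasFDerivAt_hodgeProj hz₀ hz p).const_mul (hodgeProj c W K z₀ r z)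
  exact congrArg (fun L => L v)
    (hderiv.unique ((hasFDerivAt_const _ z).congr_of_eventuallyEq hconst))

theorem fderiv_hodgeProj_mul_of_le {z : E} (hz : z ∈ Ω) (v : E) {p r : ℤ} (hrp : r ≤ p) :
    fderiv ℂ (hodgeProj c W K z₀ p) z v * hodgeProj c W K z₀ r z =
      fderiv ℂ (hodgeProj c W K z₀ p) z v := by
  have hprod : (fun y => hodgeProj c W K z₀ p y * hodgeProj c W K z₀ r z) =ᶠ[𝓝 z]
      hodgeProj c W K z₀ p := by
    filter_upwards [h.isOpen.mem_nhds hz] with y hy using h.hodgeProj_mul_of_le hz₀ hy hz hrp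
  have hderiv := (h.hasFDerivAt_hodgeProj hz₀ hz p).mul_const' (hodgeProj c W K z₀ r z)
  exact congrArg (fun L => L v)
    (hderiv.unique ((h.hasFDerivAt_hodgeProj hz₀ hz p).congr_of_eventuallyEq hprod))

theorem fderiv_hodgeProj_mul_of_lt {z : E} (hz : z ∈ Ω) (v : E) {p r : ℤ} (hpr : p < r) :
    fderiv ℂ (hodgeProj c W K z₀ p) z v * hodgeProj c W K z₀ r z = 0 := by
  have hprod : hodgeProj c W K z₀ p * hodgeProj c W K z₀ r =ᶠ[𝓝 z] hodgeProj c W K z₀ r := by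
    filter_upwards [h.isOpen.mem_nhds hz] with y hy using h.hodgeProj_mul_of_ge hz₀ hy hpr.le
  have hderiv := (h.hasFDerivAt_hodgeProj hz₀ hz p).mul' (h.hasFDerivAt_hodgeProj hz₀ hz r)
  have hleibniz : hodgeProj c W K z₀ p z * fderiv ℂ (hodgeProj c W K z₀ r) z v +
      fderiv ℂ (hodgeProj c W K z₀ p) z v * hodgeProj c W K z₀ r z =
      fderiv ℂ (hodgeProj c W K z₀ r) z v := congrArg (fun L => L v)
    (hderiv.unique ((h.hasFDerivAt_hodgeProj hz₀ hz r).congr_of_eventuallyEq hprod))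
  rwa [h.hodgeProj_mul_fderiv_of_lt hz₀ hz v hpr, add_eq_left] at hleibniz

/-! #### The grading operator -/

theorem summandProj_mul_hodgeProj {z : E} (hz : z ∈ Ω) (q r : ℤ) :
    summandProj c W K z₀ q z * hodgeProj c W K z₀ r z =
      if r ≤ q then summandProj c W K z₀ q z else 0 := by
  rw [summandProj, sub_mul]
  split_ifs with hr
  · rw [h.hodgeProj_mul_of_le hz₀ hz hz hr, h.hodgeProj_mul_of_le hz₀ hz hz (by lia)]
  · rw [h.hodgeProj_mul_of_ge hz₀ hz (by lia), h.hodgeProj_mul_of_ge hz₀ hz (by lia), sub_self]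

theorem hodgeProj_mul_summandProj {z : E} (hz : z ∈ Ω) (q r : ℤ) :
    hodgeProj c W K z₀ r z * summandProj c W K z₀ q z =
      if r ≤ q then summandProj c W K z₀ q z else 0 := by
  rw [summandProj, mul_sub]
  split_ifs with hr
  · rw [h.hodgeProj_mul_of_ge hz₀ hz hr, h.hodgeProj_mul_of_ge hz₀ hz (by lia)]
  · rw [h.hodgeProj_mul_of_le hz₀ hz hz (by lia), h.hodgeProj_mul_of_le hz₀ hz hz (by lia),
      sub_self]

theorem summandProj_mul {z : E} (hz : z ∈ Ω) (p q : ℤ) :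
    summandProj c W K z₀ p z * summandProj c W K z₀ q z =
      if p = q then summandProj c W K z₀ p z else 0 := by
  conv_lhs => rw [summandProj, sub_mul]
  rw [h.hodgeProj_mul_summandProj hz₀ hz, h.hodgeProj_mul_summandProj hz₀ hz]
  rcases lt_trichotomy p q with hpq | rfl | hpq
  · rw [if_pos hpq.le, if_pos (by lia), if_neg hpq.ne, sub_self]
  · rw [if_pos le_rfl, if_neg (by lia), if_pos rfl, sub_zero]
  · rw [if_neg (by lia), if_neg (by lia), if_neg hpq.ne', sub_self]

theorem contDiffAt_summandProj {z : E} (hz : z ∈ Ω) (p : ℤ) :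
    ContDiffAt ℂ ω (summandProj c W K z₀ p) z :=
  (h.contDiffAt_hodgeProj hz₀ hz p).sub (h.contDiffAt_hodgeProj hz₀ hz (p + 1))

theorem contDiffAt_gradingOp (a b : ℤ) {z : E} (hz : z ∈ Ω) :
    ContDiffAt ℂ ω (gradingOp c W K z₀ a b) z :=
  ContDiffAt.sum fun p _ => h.contDiffAt_hodgeProj hz₀ hz p

theorem fderiv_gradingOp (a b : ℤ) {z : E} (hz : z ∈ Ω) (v : E) :
    fderiv ℂ (gradingOp c W K z₀ a b) z v =
      ∑ p ∈ Finset.Ioc a b, fderiv ℂ (hodgeProj c W K z₀ p) z v := by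
  have hsum : HasFDerivAt (gradingOp c W K z₀ a b)
      (∑ p ∈ Finset.Ioc a b, fderiv ℂ (hodgeProj c W K z₀ p) z) z :=
    HasFDerivAt.fun_sum fun p _ => h.hasFDerivAt_hodgeProj hz₀ hz p
  rw [hsum.fderiv, sum_apply]

theorem fderiv_gradingOp_mem_weight (a b : ℤ) {k : ℤ} {z : E} (hz : z ∈ Ω) (v : E) {w : N}
    (hw : w ∈ W k) : fderiv ℂ (gradingOp c W K z₀ a b) z v w ∈ W (k - 1) := by
  rw [h.fderiv_gradingOp hz₀ a b hz, sum_apply]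
  exact Submodule.sum_mem _ fun p _ => h.fderiv_hodgeProj_mem_weight hz₀ hz p v hw

theorem hodgeProj_mul_fderiv_gradingOp (a b : ℤ) {z : E} (hz : z ∈ Ω) (v : E) (r : ℤ) :
    hodgeProj c W K z₀ r z * fderiv ℂ (gradingOp c W K z₀ a b) z v =
      fderiv ℂ (gradingOp c W K z₀ a b) z v * hodgeProj c W K z₀ (r + 1) z := by
  rw [h.fderiv_gradingOp hz₀ a b hz, Finset.mul_sum, Finset.sum_mul]
  refine Finset.sum_congr rfl fun p _ => ?_
  rcases lt_or_ge r p with hrp | hpr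
  · rw [h.hodgeProj_mul_fderiv_of_lt hz₀ hz v hrp, h.fderiv_hodgeProj_mul_of_le hz₀ hz v hrp]
  · rw [h.hodgeProj_mul_fderiv_of_le hz₀ hz v hpr,
      h.fderiv_hodgeProj_mul_of_lt hz₀ hz v (Int.lt_add_one_of_le hpr)]

theorem summandProj_mul_fderiv_gradingOp (a b : ℤ) {z : E} (hz : z ∈ Ω) (v : E) (p : ℤ) :
    summandProj c W K z₀ p z * fderiv ℂ (gradingOp c W K z₀ a b) z v =
      fderiv ℂ (gradingOp c W K z₀ a b) z v * summandProj c W K z₀ (p + 1) z := by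
  rw [summandProj, summandProj, sub_mul, mul_sub, h.hodgeProj_mul_fderiv_gradingOp hz₀ a b hz,
    h.hodgeProj_mul_fderiv_gradingOp hz₀ a b hz]

theorem exists_isHodgeRange : ∃ a b : ℤ, ∀ a' ≤ a, ∀ b' ≥ b, IsHodgeRange Ω c W K z₀ a' b' := by
  have h₀ := h.mixedHodge z₀ hz₀
  obtain ⟨a, ha⟩ := h₀.hodge_top
  obtain ⟨b, hb⟩ := h₀.hodge_bot
  refine ⟨min a b, b, fun a' ha' b' hb' => ⟨by lia, fun z hz p hp => ?_, fun p hz q hq => ?_⟩⟩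
  · have htop : K p z₀ = ⊤ := eq_top_iff.2 (ha ▸ h₀.hodge_anti (by lia : p ≤ a))
    have hbot : oppositeFiltration c W (fun r => K r z₀) (p - 1) = ⊥ := by
      simpa [htop] using h₀.disjoint_oppositeFiltration p
    ext w
    have hspec := (h.hodgeProj_spec hz₀ hz p w).2
    rw [hbot, Submodule.mem_bot, sub_eq_zero] at hspec
    exact hspec.symm
  · have hbot : K q z₀ = ⊥ := eq_bot_iff.2 (hb ▸ h₀.hodge_anti (by lia : b ≤ q))
    have htop : oppositeFiltration c W (fun r => K r z₀) (q - 1) = ⊤ := by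
      simpa [hbot] using (h₀.isCompl_oppositeFiltration q).codisjoint
    ext w
    exact h.hodgeProj_of_mem_oppositeFiltration hz₀ hz (htop ▸ Submodule.mem_top)

variable {a b : ℤ} (hab : IsHodgeRange Ω c W K z₀ a b)

include hab

omit hz₀ in
theorem fderiv_hodgeProj_eq_zero {z : E} (hz : z ∈ Ω) {p : ℤ} (hp : p ∉ Finset.Ioc a b) :
    fderiv ℂ (hodgeProj c W K z₀ p) z = 0 := by
  obtain ⟨L, hL⟩ : ∃ L, hodgeProj c W K z₀ p =ᶠ[𝓝 z] fun _ => L := by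
    rcases le_or_gt p a with hpa | hpa
    · exact ⟨1, by filter_upwards [h.isOpen.mem_nhds hz] with y hy using hab.eq_one y hy p hpa⟩
    · have hpb : p > b := by simpa [hpa] using hp
      exact ⟨0, by filter_upwards [h.isOpen.mem_nhds hz] with y hy using hab.eq_zero y hy p hpb⟩
  exact ((hasFDerivAt_const L z).congr_of_eventuallyEq hL).fderiv

theorem commutator_hodgeProj {z : E} (hz : z ∈ Ω) (v : E) (r : ℤ) :
    fderiv ℂ (gradingOp c W K z₀ a b) z v * hodgeProj c W K z₀ r z -
      hodgeProj c W K z₀ r z * fderiv ℂ (gradingOp c W K z₀ a b) z v =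
      fderiv ℂ (hodgeProj c W K z₀ r) z v := by
  have hterm : ∀ p, fderiv ℂ (hodgeProj c W K z₀ p) z v * hodgeProj c W K z₀ r z -
      hodgeProj c W K z₀ r z * fderiv ℂ (hodgeProj c W K z₀ p) z v =
      if p = r then fderiv ℂ (hodgeProj c W K z₀ r) z v else 0 := by
    intro p
    rcases lt_trichotomy p r with hp | rfl | hp
    · rw [h.fderiv_hodgeProj_mul_of_lt hz₀ hz v hp, h.hodgeProj_mul_fderiv_of_le hz₀ hz v hp.le,
        if_neg hp.ne, sub_self]
    · rw [h.fderiv_hodgeProj_mul_of_le hz₀ hz v le_rfl,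
        h.hodgeProj_mul_fderiv_of_le hz₀ hz v le_rfl, if_pos rfl, sub_zero]
    · rw [h.fderiv_hodgeProj_mul_of_le hz₀ hz v hp.le, h.hodgeProj_mul_fderiv_of_lt hz₀ hz v hp,
        if_neg hp.ne', sub_self]
  rw [h.fderiv_gradingOp hz₀ a b hz, Finset.mul_sum, Finset.sum_mul, ← Finset.sum_sub_distrib,
    Finset.sum_congr rfl fun p _ => hterm p, Finset.sum_ite_eq', ite_eq_left_iff]
  exact fun hr => by rw [h.fderiv_hodgeProj_eq_zero hab hz hr, zero_apply]

theorem commutator_gradingOp {z : E} (hz : z ∈ Ω) (v : E) :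
    fderiv ℂ (gradingOp c W K z₀ a b) z v * gradingOp c W K z₀ a b z -
      gradingOp c W K z₀ a b z * fderiv ℂ (gradingOp c W K z₀ a b) z v =
      fderiv ℂ (gradingOp c W K z₀ a b) z v := by
  conv_rhs => rw [h.fderiv_gradingOp hz₀ a b hz]
  conv_lhs => rw [gradingOp, Finset.mul_sum, Finset.sum_mul, ← Finset.sum_sub_distrib]
  exact Finset.sum_congr rfl fun p _ => h.commutator_hodgeProj hz₀ hab hz v p

theorem fderiv_summandProj {z : E} (hz : z ∈ Ω) (v : E) (p : ℤ) :
    fderiv ℂ (summandProj c W K z₀ p) z v =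
      fderiv ℂ (gradingOp c W K z₀ a b) z v * summandProj c W K z₀ p z -
        summandProj c W K z₀ p z * fderiv ℂ (gradingOp c W K z₀ a b) z v := by
  have hderiv : HasFDerivAt (summandProj c W K z₀ p) _ z :=
    (h.hasFDerivAt_hodgeProj hz₀ hz p).sub (h.hasFDerivAt_hodgeProj hz₀ hz (p + 1))
  rw [hderiv.fderiv, summandProj, sub_apply, ← h.commutator_hodgeProj hz₀ hab hz v,
    ← h.commutator_hodgeProj hz₀ hab hz v, mul_sub, sub_mul, sub_sub_sub_comm]

theorem summandProj_sub_one_mul_fderiv {z : E} (hz : z ∈ Ω) (v : E) (p : ℤ) :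
    summandProj c W K z₀ (p - 1) z * fderiv ℂ (summandProj c W K z₀ p) z v =
      fderiv ℂ (gradingOp c W K z₀ a b) z v * summandProj c W K z₀ p z := by
  rw [h.fderiv_summandProj hz₀ hab hz, mul_sub, ← mul_assoc, ← mul_assoc,
    h.summandProj_mul_fderiv_gradingOp hz₀ a b hz, sub_add_cancel, mul_assoc,
    h.summandProj_mul hz₀ hz, h.summandProj_mul hz₀ hz, if_pos rfl, if_neg (by lia), zero_mul,
    sub_zero]

theorem summandProj_mul_fderiv {z : E} (hz : z ∈ Ω) (v : E) (p : ℤ) :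
    summandProj c W K z₀ p z * fderiv ℂ (summandProj c W K z₀ p) z v =
      -(summandProj c W K z₀ p z * fderiv ℂ (gradingOp c W K z₀ a b) z v) := by
  rw [h.fderiv_summandProj hz₀ hab hz, mul_sub, ← mul_assoc, ← mul_assoc,
    h.summandProj_mul_fderiv_gradingOp hz₀ a b hz, mul_assoc, h.summandProj_mul hz₀ hz,
    h.summandProj_mul hz₀ hz, if_neg (by lia), if_pos rfl, mul_zero, zero_sub,
    h.summandProj_mul_fderiv_gradingOp hz₀ a b hz]

/-- Differentiating `[Y_w, Y] = Y_w` in the direction `v`, where `Y_w = dY(w)`, and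
antisymmetrizing gives `2 [Y_w, Y_v] = 0`. -/
theorem fderiv_gradingOp_commute {z : E} (hz : z ∈ Ω) (v w : E) :
    fderiv ℂ (gradingOp c W K z₀ a b) z v * fderiv ℂ (gradingOp c W K z₀ a b) z w =
      fderiv ℂ (gradingOp c W K z₀ a b) z w * fderiv ℂ (gradingOp c W K z₀ a b) z v := by
  set Y := gradingOp c W K z₀ a b
  have hY := h.contDiffAt_gradingOp hz₀ a b hz
  have hderiv : HasFDerivAt Y (fderiv ℂ Y z) z := (hY.differentiableAt (by simp)).hasFDerivAt
  have hderiv₂ : ∀ w, HasFDerivAt (fun y => fderiv ℂ Y y w) ((fderiv ℂ (fderiv ℂ Y) z).flip w) z :=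
    fun w => by
      simpa using ((hY.fderiv_right (m := ω) (by simp)).differentiableAt
        (by simp)).hasFDerivAt.clm_apply (hasFDerivAt_const w z)
  have hleibniz : ∀ v w, fderiv ℂ Y z w * fderiv ℂ Y z v + fderiv ℂ (fderiv ℂ Y) z v w * Y z -
      (Y z * fderiv ℂ (fderiv ℂ Y) z v w + fderiv ℂ Y z v * fderiv ℂ Y z w) =
      fderiv ℂ (fderiv ℂ Y) z v w := fun v w => by
    have heq : (fun y => fderiv ℂ Y y w) * Y - Y * (fun y => fderiv ℂ Y y w) =ᶠ[𝓝 z]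
        fun y => fderiv ℂ Y y w := by
      filter_upwards [h.isOpen.mem_nhds hz] with y hy using h.commutator_gradingOp hz₀ hab hy w
    exact congrArg (fun L => L v) ((((hderiv₂ w).mul' hderiv).sub
      (hderiv.mul' (hderiv₂ w))).unique ((hderiv₂ w).congr_of_eventuallyEq heq))
  have hdiff := hleibniz w v
  rw [← (hY.isSymmSndFDerivAt (by simp)) v w] at hdiff
  have htwo :
      (2 : ℂ) • (fderiv ℂ Y z v * fderiv ℂ Y z w - fderiv ℂ Y z w * fderiv ℂ Y z v) = 0 := by
    rw [two_smul, ← sub_eq_zero.2 (hdiff.trans (hleibniz v w).symm)]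
    abel
  exact sub_eq_zero.1 ((smul_eq_zero.1 htwo).resolve_left two_ne_zero)

end IsLocalVariation

namespace IsHodgeRange

omit [NormedAddCommGroup E] [NormedSpace ℂ E]

variable {Ω : Set E} {c : N →ₛₗ[starRingEnd ℂ] N} {W : ℤ → Submodule ℂ N}
  {K : ℤ → E → Submodule ℂ N} {z₀ : E} {a b : ℤ} (hab : IsHodgeRange Ω c W K z₀ a b)

include hab

theorem summandProj_eq_zero {z : E} (hz : z ∈ Ω) {p : ℤ} (hp : p ∉ Finset.Icc a b) :
    summandProj c W K z₀ p z = 0 := by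
  rw [Finset.mem_Icc, not_and_or, not_le, not_le] at hp
  rcases hp with hp | hp
  · rw [summandProj, hab.eq_one z hz p hp.le, hab.eq_one z hz (p + 1) hp, sub_self]
  · rw [summandProj, hab.eq_zero z hz p hp, hab.eq_zero z hz (p + 1) (by lia), sub_self]

theorem sum_summandProj {z : E} (hz : z ∈ Ω) :
    ∑ p ∈ Finset.Icc a b, summandProj c W K z₀ p z = 1 := by
  have telescope : ∀ n : ℕ, ∑ p ∈ Finset.Icc a (a + n), summandProj c W K z₀ p z =
      hodgeProj c W K z₀ a z - hodgeProj c W K z₀ (a + n + 1) z := by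
    intro n
    induction n with
    | zero => simp [summandProj]
    | succ n ih =>
      have hinsert : Finset.Icc a (a + (n + 1 : ℕ)) =
          insert (a + (n : ℤ) + 1) (Finset.Icc a (a + n)) := by
        ext p
        simp only [Finset.mem_Icc, Finset.mem_insert]
        lia
      rw [hinsert, Finset.sum_insert (by simp), ih, summandProj, Nat.cast_succ, ← add_assoc,
        add_comm, sub_add_sub_cancel]
  obtain ⟨n, rfl⟩ := Int.le.dest hab.le
  rw [telescope, hab.eq_one z hz a le_rfl, hab.eq_zero z hz _ (by lia), sub_zero]

theorem sum_summandProj_apply {z : E} (hz : z ∈ Ω) (w : N) :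
    ∑ p ∈ Finset.Icc a b, summandProj c W K z₀ p z w = w := by
  rw [← sum_apply, hab.sum_summandProj hz, one_apply_eq_self]

end IsHodgeRange

/-! #### Recovering the Hodge filtration from the Higgs field -/

theorem sum_Ioc_ite_le {M : Type*} [AddCommGroup M] [Module ℂ M] {a b q : ℤ}
    (hq : q ∈ Finset.Icc a b) (x : M) :
    ∑ r ∈ Finset.Ioc a b, (if r ≤ q then x else 0) = ((q - a : ℤ) : ℂ) • x := by
  obtain ⟨haq, hqb⟩ := Finset.mem_Icc.1 hq
  have hfilter : (Finset.Ioc a b).filter (· ≤ q) = Finset.Ioc a q := by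
    ext r
    simp only [Finset.mem_filter, Finset.mem_Ioc]
    lia
  rw [← Finset.sum_filter, Finset.sum_const, hfilter, Int.card_Ioc, ← Nat.cast_smul_eq_nsmul ℂ,
    ← Int.cast_natCast, Int.toNat_of_nonneg (by lia)]

namespace IsLocalVariation

section Eigenspaces

variable {Ω : Set E} {c : N →ₛₗ[starRingEnd ℂ] N} {W : ℤ → Submodule ℂ N}
  {K : ℤ → E → Submodule ℂ N} (h : IsLocalVariation Ω c W K) {z₀ : E} (hz₀ : z₀ ∈ Ω)

include h hz₀

theorem summandProj_mul_gradingOp {a b q : ℤ} (hq : q ∈ Finset.Icc a b) {z : E} (hz : z ∈ Ω) :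
    summandProj c W K z₀ q z * gradingOp c W K z₀ a b z =
      ((q - a : ℤ) : ℂ) • summandProj c W K z₀ q z := by
  rw [gradingOp, Finset.mul_sum, ← sum_Ioc_ite_le hq]
  exact Finset.sum_congr rfl fun r _ => h.summandProj_mul_hodgeProj hz₀ hz q r

theorem gradingOp_mul_summandProj {a b q : ℤ} (hq : q ∈ Finset.Icc a b) {z : E} (hz : z ∈ Ω) :
    gradingOp c W K z₀ a b z * summandProj c W K z₀ q z =
      ((q - a : ℤ) : ℂ) • summandProj c W K z₀ q z := by
  rw [gradingOp, Finset.sum_mul, ← sum_Ioc_ite_le hq]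
  exact Finset.sum_congr rfl fun r _ => h.hodgeProj_mul_summandProj hz₀ hz q r

theorem summandProj_apply_mem_hodge {p q : ℤ} (hpq : p ≤ q) {z : E} (hz : z ∈ Ω) (w : N) :
    summandProj c W K z₀ q z w ∈ K p z := by
  have hmono := (h.mixedHodge z hz).hodge_anti
  exact Submodule.sub_mem _ (hmono hpq (h.hodgeProj_spec hz₀ hz q w).1)
    (hmono (by lia : p ≤ q + 1) (h.hodgeProj_spec hz₀ hz (q + 1) w).1)

theorem summandProj_apply_eq_zero {p q : ℤ} (hqp : q < p) {z : E} (hz : z ∈ Ω) {w : N}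
    (hw : w ∈ K p z) : summandProj c W K z₀ q z w = 0 := by
  have hmono := (h.mixedHodge z hz).hodge_anti
  rw [summandProj, sub_apply, h.hodgeProj_of_mem hz₀ hz (hmono hqp.le hw),
    h.hodgeProj_of_mem hz₀ hz (hmono (Int.add_one_le_of_lt hqp) hw), sub_self]

end Eigenspaces

section Recovery

variable {N' : Type*} [NormedAddCommGroup N'] [NormedSpace ℂ N'] [FiniteDimensional ℂ N']
  {Ω : Set E} {c : N →ₛₗ[starRingEnd ℂ] N} {W : ℤ → Submodule ℂ N} {K : ℤ → E → Submodule ℂ N}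
  {c' : N' →ₛₗ[starRingEnd ℂ] N'} {W' : ℤ → Submodule ℂ N'} {K' : ℤ → E → Submodule ℂ N'}
  (h : IsLocalVariation Ω c W K) (h' : IsLocalVariation Ω c' W' K') {z₀ z₁ z : E} (hz₀ : z₀ ∈ Ω)
  (hz₁ : z₁ ∈ Ω) (hz : z ∈ Ω) {a b : ℤ}

include h h' hz₀ hz₁ hz

theorem gradingOp_comm_of_fderiv_gradingOp_comm (C : N →L[ℂ] N')
    (hC : ∀ z ∈ Ω, ∀ v w, fderiv ℂ (gradingOp c' W' K' z₀ a b) z v (C w) =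
      C (fderiv ℂ (gradingOp c W K z₀ a b) z v w))
    (hz₁C : ∀ w, gradingOp c' W' K' z₀ a b z₁ (C w) = C (gradingOp c W K z₀ a b z₁ w)) (w : N) :
    gradingOp c' W' K' z₀ a b z (C w) = C (gradingOp c W K z₀ a b z w) := by
  have hderiv : ∀ y ∈ Ω, HasFDerivAt
      (fun y => gradingOp c' W' K' z₀ a b y (C w) - C (gradingOp c W K z₀ a b y w))
      ((fderiv ℂ (gradingOp c' W' K' z₀ a b) y).flip (C w) -
        C ∘L (fderiv ℂ (gradingOp c W K z₀ a b) y).flip w) y := fun y hy => by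
    have hY := ((h.contDiffAt_gradingOp hz₀ a b hy).differentiableAt (by simp)).hasFDerivAt
    have hY' := ((h'.contDiffAt_gradingOp hz₀ a b hy).differentiableAt (by simp)).hasFDerivAt
    refine ((hY'.clm_apply (hasFDerivAt_const (C w) y)).sub
      (C.hasFDerivAt.comp y (hY.clm_apply (hasFDerivAt_const w y)))).congr_fderiv ?_
    ext v
    simp
  have hconst := sub_mem_of_fderiv_mem h.isOpen h.convex.isPreconnected ⊥
    (fun y hy => (hderiv y hy).differentiableAt) (fun y hy v => by
      rw [(hderiv y hy).fderiv, Submodule.mem_bot]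
      simp [hC y hy v w]) hz hz₁
  rwa [Submodule.mem_bot, hz₁C, sub_self, sub_zero, sub_eq_zero] at hconst

omit hz₁ in
theorem summandProj_comm_of_gradingOp_comm (hab : IsHodgeRange Ω c W K z₀ a b)
    (hab' : IsHodgeRange Ω c' W' K' z₀ a b) (C : N →L[ℂ] N')
    (hC : ∀ w, gradingOp c' W' K' z₀ a b z (C w) = C (gradingOp c W K z₀ a b z w)) {q : ℤ}
    (hq : q ∈ Finset.Icc a b) (w : N) :
    summandProj c' W' K' z₀ q z (C w) = C (summandProj c W K z₀ q z w) := by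
  have orthogonal : ∀ q ∈ Finset.Icc a b, ∀ r ∈ Finset.Icc a b, q ≠ r →
      summandProj c' W' K' z₀ q z (C (summandProj c W K z₀ r z w)) = 0 := by
    intro q hq r hr hqr
    have hleft := congrArg (fun L => L (C (summandProj c W K z₀ r z w)))
      (h'.summandProj_mul_gradingOp hz₀ hq hz)
    have hright := congrArg (fun L => L w) (h.gradingOp_mul_summandProj hz₀ hr hz)
    simp only [mul_apply_eq_comp, smul_apply] at hleft hright
    rw [hC, hright, map_smul, map_smul] at hleft
    by_contra hne
    have hcast := Int.cast_injective (α := ℂ) (smul_left_injective ℂ hne hleft)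
    lia
  calc summandProj c' W' K' z₀ q z (C w)
      = summandProj c' W' K' z₀ q z (C (summandProj c W K z₀ q z w)) := by
        conv_lhs => rw [← hab.sum_summandProj_apply hz w, map_sum, map_sum]
        exact Finset.sum_eq_single_of_mem q hq fun r hr hrq => orthogonal q hq r hr hrq.symm
    _ = C (summandProj c W K z₀ q z w) := by
        conv_rhs => rw [← hab'.sum_summandProj_apply hz (C _)]
        exact (Finset.sum_eq_single_of_mem q hq fun r hr hrq => orthogonal r hr q hq hrq).symm

theorem map_hodge_le_of_comm (hab : IsHodgeRange Ω c W K z₀ a b)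
    (hab' : IsHodgeRange Ω c' W' K' z₀ a b) (C : N →ₗ[ℂ] N')
    (hC : ∀ z ∈ Ω, ∀ v w, fderiv ℂ (gradingOp c' W' K' z₀ a b) z v (C w) =
      C (fderiv ℂ (gradingOp c W K z₀ a b) z v w))
    (hz₁C : ∀ p w, hodgeProj c' W' K' z₀ p z₁ (C w) = C (hodgeProj c W K z₀ p z₁ w)) (p : ℤ) :
    (K p z).map C ≤ K' p z := by
  rintro _ ⟨w, hw, rfl⟩
  have hcomm := h.gradingOp_comm_of_fderiv_gradingOp_comm h' hz₀ hz₁ hz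
    (LinearMap.toContinuousLinearMap C) hC (by simp [gradingOp, sum_apply, hz₁C])
  rw [← hab'.sum_summandProj_apply hz (C w)]
  refine Submodule.sum_mem _ fun q hq => ?_
  rcases lt_or_ge q p with hqp | hpq
  · have hzero := h.summandProj_comm_of_gradingOp_comm h' hz₀ hz hab hab' _ hcomm hq w
    rw [h.summandProj_apply_eq_zero hz₀ hqp hz hw, map_zero] at hzero
    exact hzero ▸ Submodule.zero_mem _
  · exact h'.summandProj_apply_mem_hodge hz₀ hpq hz _

theorem map_hodge_eq_of_comm (hab : IsHodgeRange Ω c W K z₀ a b)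
    (hab' : IsHodgeRange Ω c' W' K' z₀ a b) (C : N ≃ₗ[ℂ] N')
    (hC : ∀ z ∈ Ω, ∀ v w, fderiv ℂ (gradingOp c' W' K' z₀ a b) z v (C w) =
      C (fderiv ℂ (gradingOp c W K z₀ a b) z v w))
    (hconj : ∀ w, c' (C w) = C (c w)) (hW : ∀ k, (W k).map C.toLinearMap = W' k)
    (hK : ∀ p, (K p z₁).map C.toLinearMap = K' p z₁) (p : ℤ) :
    (K p z).map C.toLinearMap = K' p z := by
  have hz₁C : ∀ p w, hodgeProj c' W' K' z₀ p z₁ (C w) = C (hodgeProj c W K z₀ p z₁ w) := by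
    intro p w
    obtain ⟨hmem, hsub⟩ := h.hodgeProj_spec hz₀ hz₁ p w
    refine h'.hodgeProj_eq hz₀ hz₁ p (hK p ▸ Submodule.mem_map_of_mem hmem) ?_
    have hG := oppositeFiltration_map C hconj (W := W) (F := fun r => K r z₁) (p - 1)
    simp only [hW, hK] at hG
    rw [h.oppositeFiltration_eq hz₀ hz₁] at hsub
    rw [h'.oppositeFiltration_eq hz₀ hz₁, hG, ← map_sub]
    exact Submodule.mem_map_of_mem hsub
  refine le_antisymm (h.map_hodge_le_of_comm h' hz₀ hz₁ hz hab hab' C.toLinearMap hC hz₁C p)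
    fun w hw => ⟨C.symm w, ?_, C.apply_symm_apply w⟩
  refine h'.map_hodge_le_of_comm h hz₀ hz₁ hz hab' hab C.symm.toLinearMap (fun z hz v w => ?_)
    (fun p w => ?_) p (Submodule.mem_map_of_mem hw)
  · refine (C.symm_apply_eq.2 ?_).symm
    simpa using hC z hz v (C.symm w)
  · refine (C.symm_apply_eq.2 ?_).symm
    simpa using hz₁C p (C.symm w)

end Recovery

end IsLocalVariation

end LocalModel

/-! ### Charts of a complex manifold -/

section Charts

theorem contMDiffAt_iff_contDiffAt_chart {𝕜 E F S : Type*} [NontriviallyNormedField 𝕜]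
    [NormedAddCommGroup E] [NormedSpace 𝕜 E] [NormedAddCommGroup F] [NormedSpace 𝕜 F]
    [TopologicalSpace S] [ChartedSpace E S] {n : ℕ∞ω} [IsManifold 𝓘(𝕜, E) n S] {f : S → F}
    {x s : S} (hs : s ∈ (chartAt E x).source) :
    ContMDiffAt 𝓘(𝕜, E) 𝓘(𝕜, F) n f s ↔
      ContDiffAt 𝕜 n (fun z => f ((chartAt E x).symm z)) (chartAt E x s) := by
  rw [contMDiffAt_iff_source_of_mem_source hs, contMDiffWithinAt_iff_contDiffWithinAt]
  simp only [modelWithCornersSelf_coe, Set.range_id, contDiffWithinAt_univ]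
  rfl

theorem contDiffAt_iff_of_eventuallyEq {𝕜 E F : Type*} [NontriviallyNormedField 𝕜]
    [NormedAddCommGroup E] [NormedSpace 𝕜 E] [NormedAddCommGroup F] [NormedSpace 𝕜 F]
    {n : ℕ∞ω} {f g : E → F} {z : E} (hfg : f =ᶠ[𝓝 z] g) :
    ContDiffAt 𝕜 n f z ↔ ContDiffAt 𝕜 n g z :=
  ⟨fun hf => hf.congr_of_eventuallyEq hfg.symm, fun hg => hg.congr_of_eventuallyEq hfg⟩

variable {E : Type*} [NormedAddCommGroup E] [NormedSpace ℂ E]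
  {S : Type u} [TopologicalSpace S] [ChartedSpace E S]

variable (E) in
/-- The derivative at `s` of the chart at `x`. -/
def chartDeriv (x s : S) : E →L[ℝ] E :=
  mfderiv 𝓘(ℝ, E) 𝓘(ℝ, E) (extChartAt 𝓘(ℝ, E) x) s

/-- The vector field `X` in the chart at `x`. -/
def fieldRep (x : S) (X : ∀ s : S, TangentSpace 𝓘(ℝ, E) s) (z : E) : E :=
  chartDeriv E x ((chartAt E x).symm z) (X ((chartAt E x).symm z))

theorem fieldRep_chart {x s : S} (hs : s ∈ (chartAt E x).source)
    (X : ∀ s : S, TangentSpace 𝓘(ℝ, E) s) :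
    fieldRep x X (chartAt E x s) = chartDeriv E x s (X s) := by
  have hleft : (chartAt E x).symm (chartAt E x s) = s := (chartAt E x).left_inv hs
  rw [fieldRep]
  generalize (chartAt E x).symm (chartAt E x s) = s' at hleft
  subst hleft
  rfl

variable [IsManifold 𝓘(ℂ, E) ω S]

theorem hasMFDerivAt_chart {x s : S} (hs : s ∈ (chartAt E x).source) :
    HasMFDerivAt 𝓘(ℝ, E) 𝓘(ℝ, E) (chartAt E x) s (chartDeriv E x s) :=
  (mdifferentiableAt_extChartAt (I := 𝓘(ℝ, E)) hs).hasMFDerivAt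

theorem chartDeriv_I_smul {x s : S} (hs : s ∈ (chartAt E x).source) (v : E) :
    chartDeriv E x s (Complex.I • v) = Complex.I • chartDeriv E x s v := by
  have : IsManifold 𝓘(ℂ, E) 1 S := IsManifold.of_le (n := ω) le_top
  let T : E →L[ℂ] E := mfderiv 𝓘(ℂ, E) 𝓘(ℂ, E) (chartAt E x) s
  have hT : HasMFDerivAt 𝓘(ℂ, E) 𝓘(ℂ, E) (chartAt E x) s T :=
    (mdifferentiableAt_extChartAt (I := 𝓘(ℂ, E)) hs).hasMFDerivAt
  have hreal : HasMFDerivAt 𝓘(ℝ, E) 𝓘(ℝ, E) (chartAt E x) s (T.restrictScalars ℝ) :=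
    ⟨hT.1, hT.2.restrictScalars ℝ⟩
  have heq : chartDeriv E x s = T.restrictScalars ℝ := hreal.mfderiv
  rw [heq]
  exact T.map_smul Complex.I v

theorem chartDeriv_isInvertible {x s : S} (hs : s ∈ (chartAt E x).source) :
    (chartDeriv E x s).IsInvertible :=
  isInvertible_mfderiv_extChartAt (I := 𝓘(ℝ, E)) (by rwa [extChartAt_source])

theorem contDiffAt_fieldRep {x : S} {X : ∀ s : S, TangentSpace 𝓘(ℝ, E) s}
    (hX : RatLocalSystem.SmoothFieldAt X x) :
    ContDiffAt ℝ ∞ (fieldRep x X) (chartAt E x x) := by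
  rw [RatLocalSystem.SmoothFieldAt, Bundle.contMDiffAt_section,
    contMDiffAt_iff_contDiffAt_chart (mem_chart_source E x)] at hX
  refine hX.congr_of_eventuallyEq ?_
  filter_upwards [(chartAt E x).open_target.mem_nhds (mem_chart_target E x)] with z hz
  have hs := (chartAt E x).map_target hz
  refine (congrArg (fun T => T (X ((chartAt E x).symm z)))
    (TangentBundle.continuousLinearMapAt_trivializationAt (I := 𝓘(ℝ, E)) hs)).symm.trans ?_
  exact Bundle.Trivialization.continuousLinearMapAt_apply_of_mem (R := ℝ) _ (by simpa using hs) _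

theorem mpullbackWithin_extChartAt_symm_eventuallyEq {x : S}
    (X : ∀ s : S, TangentSpace 𝓘(ℝ, E) s) :
    VectorField.mpullbackWithin 𝓘(ℝ, E) 𝓘(ℝ, E) (extChartAt 𝓘(ℝ, E) x).symm X
      (Set.range 𝓘(ℝ, E)) =ᶠ[𝓝 (chartAt E x x)] fieldRep x X := by
  have htarget : ∀ᶠ z in 𝓝 (chartAt E x x), z ∈ (extChartAt 𝓘(ℝ, E) x).target :=
    extChartAt_target_mem_nhds (I := 𝓘(ℝ, E)) x
  filter_upwards [htarget] with z hz
  have hcomp := mfderivWithin_extChartAt_symm_comp_mfderiv_extChartAt' (I := 𝓘(ℝ, E))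
    ((extChartAt 𝓘(ℝ, E) x).map_target hz)
  rw [(extChartAt 𝓘(ℝ, E) x).right_inv hz] at hcomp
  rw [VectorField.mpullbackWithin_apply]
  exact (isInvertible_mfderivWithin_extChartAt_symm hz).inverse_apply_eq.2
    (congrArg (fun T => T (X ((extChartAt 𝓘(ℝ, E) x).symm z))) hcomp).symm

theorem chartDeriv_mlieBracket {x : S} (X Y : ∀ s : S, TangentSpace 𝓘(ℝ, E) s) :
    chartDeriv E x x (VectorField.mlieBracket 𝓘(ℝ, E) X Y x) =
      fderiv ℝ (fieldRep x Y) (chartAt E x x) (fieldRep x X (chartAt E x x)) -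
        fderiv ℝ (fieldRep x X) (chartAt E x x) (fieldRep x Y (chartAt E x x)) := by
  let X' : E → E := VectorField.mpullbackWithin 𝓘(ℝ, E) 𝓘(ℝ, E) (extChartAt 𝓘(ℝ, E) x).symm X
    (Set.range 𝓘(ℝ, E))
  let Y' : E → E := VectorField.mpullbackWithin 𝓘(ℝ, E) 𝓘(ℝ, E) (extChartAt 𝓘(ℝ, E) x).symm Y
    (Set.range 𝓘(ℝ, E))
  have hX : X' =ᶠ[𝓝 (chartAt E x x)] fieldRep x X := mpullbackWithin_extChartAt_symm_eventuallyEq X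
  have hY : Y' =ᶠ[𝓝 (chartAt E x x)] fieldRep x Y := mpullbackWithin_extChartAt_symm_eventuallyEq Y
  have hbracket : VectorField.mlieBracket 𝓘(ℝ, E) X Y x = (chartDeriv E x x).inverse
      (VectorField.lieBracket ℝ X' Y' (chartAt E x x)) := by
    rw [VectorField.mlieBracket, VectorField.mlieBracketWithin_apply, Set.preimage_univ,
      Set.univ_inter, ← VectorField.lieBracketWithin_univ,
      ← ModelWithCorners.range_eq_univ 𝓘(ℝ, E)]
    rfl
  obtain ⟨e, he⟩ := chartDeriv_isInvertible (E := E) (mem_chart_source E x)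
  rw [hbracket, ← he, ContinuousLinearMap.inverse_equiv]
  refine (e.apply_symm_apply _).trans ?_
  rw [VectorField.lieBracket, hX.fderiv_eq, hY.fderiv_eq, hX.self_of_nhds, hY.self_of_nhds]

end Charts

/-! ### Sections of a local system in a chart and a flat frame -/

namespace RatLocalSystem

section Frames

variable {S : Type u} [TopologicalSpace S] (L : RatLocalSystem.{u, v} S)

/-- The flat trivialization of the complexified local system. -/
def transportC (x y : S) (h : y ∈ L.nhd x) : L.VC x ≃ₗ[ℂ] L.VC y :=
  (L.transport x y h).baseChange ℚ ℂ _ _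

/-- The flat coordinates of the fibre at `y`, with respect to the flat trivialization around `x`. -/
def frame (x y : S) (h : y ∈ L.nhd x) : L.VC y ≃ₗ[ℂ] (Fin (L.rk x) → ℂ) :=
  (L.transportC x y h).symm.trans (L.fibCoord x)

variable {L}

theorem transportC_apply {x y : S} (h : y ∈ L.nhd x) (w : L.VC x) :
    L.transportC x y h w = (L.transport x y h).toLinearMap.baseChange ℂ w := rfl

theorem conjC_transportC {x y : S} (h : y ∈ L.nhd x) (w : L.VC x) :
    conjC _ (L.transportC x y h w) = L.transportC x y h (conjC _ w) :=
  conjC_baseChange _ _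

theorem frameCoord_of_mem {x y : S} (h : y ∈ L.nhd x) (σ : L.Section) :
    L.frameCoord x σ y = L.frame x y h (σ y) := by
  rw [frameCoord, dif_pos h]
  rfl

theorem eventually_transportC_symm_transportC {x s : S} (hs : s ∈ L.nhd x) :
    ∀ᶠ y in 𝓝 s, ∀ (k₁ : y ∈ L.nhd s) (k₂ : y ∈ L.nhd x) (w : L.VC s),
      (L.transportC x y k₂).symm (L.transportC s y k₁ w) = (L.transportC x s hs).symm w := by
  filter_upwards [L.transition_locallyConstant s x s (L.mem_nhd s) hs] with y hy k₁ k₂ w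
  have hrat : (L.transport x y k₂).symm.toLinearMap ∘ₗ (L.transport s y k₁).toLinearMap =
      (L.transport x s hs).symm.toLinearMap := by
    ext a
    have hconst := hy k₁ k₂ a
    rwa [L.transport_self] at hconst
  change (L.transport x y k₂).symm.toLinearMap.baseChange ℂ
    ((L.transport s y k₁).toLinearMap.baseChange ℂ w) =
      (L.transport x s hs).symm.toLinearMap.baseChange ℂ w
  rw [← hrat, LinearMap.baseChange_comp]
  rfl

theorem eventually_frame_transportC {x s : S} (hs : s ∈ L.nhd x) :
    ∀ᶠ y in 𝓝 s, ∃ (k₁ : y ∈ L.nhd s) (k₂ : y ∈ L.nhd x), ∀ w : L.VC s,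
      L.frame x y k₂ (L.transportC s y k₁ w) = L.frame x s hs w := by
  filter_upwards [eventually_transportC_symm_transportC hs, (L.isOpen_nhd s).mem_nhds (L.mem_nhd s),
    (L.isOpen_nhd x).mem_nhds hs] with y hy k₁ k₂
  exact ⟨k₁, k₂, fun w => congrArg (L.fibCoord x) (hy k₁ k₂ w)⟩

theorem eventually_frameCoord {x s : S} (hs : s ∈ L.nhd x) :
    ∀ᶠ y in 𝓝 s, ∀ σ : L.Section,
      L.frameCoord s σ y = L.fibCoord s ((L.frame x s hs).symm (L.frameCoord x σ y)) := by
  filter_upwards [eventually_frame_transportC hs] with y ⟨k₁, k₂, hy⟩ σ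
  obtain ⟨w, hw⟩ := (L.transportC s y k₁).surjective (σ y)
  rw [frameCoord_of_mem k₁, frameCoord_of_mem k₂, ← hw, hy, LinearEquiv.symm_apply_apply, frame,
    LinearEquiv.trans_apply, LinearEquiv.symm_apply_apply]

theorem eventually_frameCoord_flatExt {x s : S} (hs : s ∈ L.nhd x) (e : L.VC s) :
    ∀ᶠ y in 𝓝 s, L.frameCoord x (L.flatExt s e) y = L.frame x s hs e := by
  filter_upwards [eventually_frame_transportC hs] with y ⟨k₁, k₂, hy⟩
  rw [frameCoord_of_mem k₂, flatExt, dif_pos k₁, ← transportC_apply, hy]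

end Frames

section Charts

variable {E : Type*} [PseudoMetricSpace E] {S : Type u} [TopologicalSpace S] [ChartedSpace E S]
  {L : RatLocalSystem.{u, v} S}

variable (E) in
/-- The section `σ` in the chart and in the flat frame at `x`. -/
def localRep (x : S) (σ : L.Section) (z : E) : Fin (L.rk x) → ℂ :=
  L.frameCoord x σ ((chartAt E x).symm z)

/-- The coordinate change from the flat frame at `x` to the flat frame at `s`. -/
def frameChange {x s : S} (hs : s ∈ L.nhd x) : (Fin (L.rk x) → ℂ) ≃L[ℂ] (Fin (L.rk s) → ℂ) :=
  ((L.frame x s hs).symm.trans (L.fibCoord s)).toContinuousLinearEquiv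

theorem localRep_of_mem {x s : S} (hs : s ∈ L.nhd x) (hs' : s ∈ (chartAt E x).source)
    (σ : L.Section) : localRep E x σ (chartAt E x s) = L.frame x s hs (σ s) := by
  rw [localRep, (chartAt E x).left_inv hs', frameCoord_of_mem hs]

theorem eventually_localRep {x s : S} (hs : s ∈ L.nhd x) (hs' : s ∈ (chartAt E x).source)
    (σ : L.Section) :
    (fun z => L.frameCoord s σ ((chartAt E x).symm z)) =ᶠ[𝓝 (chartAt E x s)]
      frameChange hs ∘ localRep E x σ := by
  have htendsto := (chartAt E x).continuousAt_symm ((chartAt E x).map_source hs')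
  rw [ContinuousAt, (chartAt E x).left_inv hs'] at htendsto
  filter_upwards [htendsto.eventually (eventually_frameCoord hs)] with z hz using hz σ

variable (E L) in
/-- The ball of radius `r` around the image of `x` in the chart at `x` is contained in the image of
the chart, and in the domain of the flat frame at `x`. -/
structure IsGoodBall (x : S) (r : ℝ) : Prop where
  pos : 0 < r
  mem_target : ∀ z ∈ Metric.ball (chartAt E x x) r, z ∈ (chartAt E x).target
  mem_nhd : ∀ z ∈ Metric.ball (chartAt E x x) r, (chartAt E x).symm z ∈ L.nhd x

variable (E L) in
theorem exists_isGoodBall (x : S) : ∃ r₀ > 0, ∀ r, 0 < r → r ≤ r₀ → L.IsGoodBall E x r := by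
  obtain ⟨r₀, hr₀, hball⟩ := Metric.isOpen_iff.1
    ((chartAt E x).isOpen_inter_preimage_symm (L.isOpen_nhd x)) (chartAt E x x)
    ⟨mem_chart_target E x, by simpa using L.mem_nhd x⟩
  exact ⟨r₀, hr₀, fun r hr hrr => ⟨hr, fun z hz => (hball (Metric.ball_subset_ball hrr hz)).1,
    fun z hz => (hball (Metric.ball_subset_ball hrr hz)).2⟩⟩

namespace IsGoodBall

variable {x : S} {r : ℝ} (hr : L.IsGoodBall E x r)

include hr

theorem mem_self : chartAt E x x ∈ Metric.ball (chartAt E x x) r := Metric.mem_ball_self hr.pos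

theorem mem_source {z : E} (hz : z ∈ Metric.ball (chartAt E x x) r) :
    (chartAt E x).symm z ∈ (chartAt E x).source := (chartAt E x).map_target (hr.mem_target z hz)

theorem chart_symm {z : E} (hz : z ∈ Metric.ball (chartAt E x x) r) :
    chartAt E x ((chartAt E x).symm z) = z := (chartAt E x).right_inv (hr.mem_target z hz)

theorem tendsto_symm {z : E} (hz : z ∈ Metric.ball (chartAt E x x) r) :
    Filter.Tendsto (chartAt E x).symm (𝓝 z) (𝓝 ((chartAt E x).symm z)) :=
  (chartAt E x).continuousAt_symm (hr.mem_target z hz)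

theorem exists_eq_chart {z : E} (hz : z ∈ Metric.ball (chartAt E x x) r) :
    ∃ s, chartAt E x s = z ∧ s ∈ L.nhd x ∧ s ∈ (chartAt E x).source :=
  ⟨_, hr.chart_symm hz, hr.mem_nhd z hz, hr.mem_source hz⟩

theorem eventually_ball {s : S} (hs : s ∈ (chartAt E x).source)
    (hz : chartAt E x s ∈ Metric.ball (chartAt E x x) r) :
    ∀ᶠ y in 𝓝 s, y ∈ (chartAt E x).source ∧ chartAt E x y ∈ Metric.ball (chartAt E x x) r ∧
      y ∈ L.nhd x := by
  filter_upwards [(chartAt E x).open_source.mem_nhds hs,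
    ((chartAt E x).continuousAt hs).eventually (Metric.isOpen_ball.mem_nhds hz)] with y hy hy'
  exact ⟨hy, hy', (chartAt E x).left_inv hy ▸ hr.mem_nhd _ hy'⟩

end IsGoodBall

open Classical in
/-- The section with representation `f` in the chart and in the flat frame at `x`, extended by zero
outside the domain of the frame. -/
def sectionOf (x : S) (f : E → Fin (L.rk x) → ℂ) : L.Section := fun s =>
  if h : s ∈ L.nhd x then (L.frame x s h).symm (f (chartAt E x s)) else 0

theorem frame_sectionOf {x s : S} (hs : s ∈ L.nhd x) (f : E → Fin (L.rk x) → ℂ) :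
    L.frame x s hs (sectionOf x f s) = f (chartAt E x s) := by
  rw [sectionOf, dif_pos hs, LinearEquiv.apply_symm_apply]

theorem localRep_sectionOf {x : S} {r : ℝ} (hr : L.IsGoodBall E x r) (f : E → Fin (L.rk x) → ℂ)
    {z : E} (hz : z ∈ Metric.ball (chartAt E x x) r) :
    localRep E x (sectionOf (L := L) x f) z = f z := by
  rw [localRep, frameCoord_of_mem (hr.mem_nhd z hz), frame_sectionOf, hr.chart_symm hz]

end Charts

section Smooth

variable {E : Type*} [NormedAddCommGroup E] [NormedSpace ℂ E]
  {S : Type u} [TopologicalSpace S] [ChartedSpace E S] {L : RatLocalSystem.{u, v} S}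

theorem nabla10_apply (σ : L.Section) (s : S) (v : E) :
    L.nabla10 E σ s v =
      (1 / 2 : ℂ) • (L.nabla E σ s v - Complex.I • L.nabla E σ s (Complex.I • v)) := by
  change (L.fibCoord s).symm ((1 / 2 : ℂ) • (L.dFrameCoord E σ s v -
    Complex.I • L.dFrameCoord E σ s (Complex.I • v))) = _
  rw [map_smul, map_sub, map_smul]
  rfl

theorem nabla01_apply (σ : L.Section) (s : S) (v : E) :
    L.nabla01 E σ s v =
      (1 / 2 : ℂ) • (L.nabla E σ s v + Complex.I • L.nabla E σ s (Complex.I • v)) := by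
  change (L.fibCoord s).symm ((1 / 2 : ℂ) • (L.dFrameCoord E σ s v +
    Complex.I • L.dFrameCoord E σ s (Complex.I • v))) = _
  rw [map_smul, map_add, map_smul]
  rfl

theorem nabla10_add_nabla01 (σ : L.Section) (s : S) (v : E) :
    L.nabla10 E σ s v + L.nabla01 E σ s v = L.nabla E σ s v := by
  rw [nabla10_apply, nabla01_apply]
  module

variable [IsManifold 𝓘(ℂ, E) ω S]

theorem smoothAt_iff {x s : S} (hs : s ∈ L.nhd x) (hs' : s ∈ (chartAt E x).source)
    {σ : L.Section} :
    L.SmoothAt E σ s ↔ ContDiffAt ℝ ∞ (localRep E x σ) (chartAt E x s) := by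
  rw [SmoothAt, contMDiffAt_iff_contDiffAt_chart hs',
    contDiffAt_iff_of_eventuallyEq (eventually_localRep hs hs' σ)]
  exact (((frameChange hs).toLinearEquiv.restrictScalars ℝ).toContinuousLinearEquiv
    ).comp_contDiffAt_iff

theorem holomorphicAt_iff {x s : S} (hs : s ∈ L.nhd x) (hs' : s ∈ (chartAt E x).source)
    {σ : L.Section} :
    L.HolomorphicAt E σ s ↔ ContDiffAt ℂ ω (localRep E x σ) (chartAt E x s) := by
  rw [HolomorphicAt, contMDiffAt_iff_contDiffAt_chart hs',
    contDiffAt_iff_of_eventuallyEq (eventually_localRep hs hs' σ)]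
  exact (frameChange hs).comp_contDiffAt_iff

theorem frame_nabla {x s : S} (hs : s ∈ L.nhd x) (hs' : s ∈ (chartAt E x).source)
    {σ : L.Section} (hσ : DifferentiableAt ℝ (localRep E x σ) (chartAt E x s)) (v : E) :
    L.frame x s hs (L.nabla E σ s v) =
      fderiv ℝ (localRep E x σ) (chartAt E x s) (chartDeriv E x s v) := by
  let A : (Fin (L.rk x) → ℂ) →L[ℝ] (Fin (L.rk s) → ℂ) :=
    (frameChange hs).toContinuousLinearMap.restrictScalars ℝ
  have hderiv := HasMFDerivAt.comp s (A.hasFDerivAt.comp _ hσ.hasFDerivAt).hasMFDerivAt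
    (hasMFDerivAt_chart (E := E) hs')
  have heq : L.frameCoord s σ =ᶠ[𝓝 s] (A ∘ localRep E x σ) ∘ chartAt E x := by
    filter_upwards [eventually_frameCoord hs, (chartAt E x).open_source.mem_nhds hs'] with y hy hy'
    rw [hy, Function.comp_apply, Function.comp_apply, localRep, (chartAt E x).left_inv hy']
    rfl
  have hcoord : L.dFrameCoord E σ s v =
      A (fderiv ℝ (localRep E x σ) (chartAt E x s) (chartDeriv E x s v)) :=
    congrArg (fun T => T v) (hderiv.congr_of_eventuallyEq heq).mfderiv
  rw [nabla, hcoord]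
  change L.frame x s hs ((L.fibCoord s).symm (L.fibCoord s ((L.frame x s hs).symm _))) = _
  rw [LinearEquiv.symm_apply_apply, LinearEquiv.apply_symm_apply]

theorem localRep_nabla {x : S} {r : ℝ} (hr : L.IsGoodBall E x r)
    {σ : L.Section} (Y : ∀ s : S, TangentSpace 𝓘(ℝ, E) s) {z : E}
    (hz : z ∈ Metric.ball (chartAt E x x) r) (hσ : DifferentiableAt ℝ (localRep E x σ) z) :
    localRep E x (fun s => L.nabla E σ s (Y s)) z =
      fderiv ℝ (localRep E x σ) z (fieldRep x Y z) := by
  obtain ⟨s, rfl, hs, hs'⟩ := hr.exists_eq_chart hz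
  rw [localRep_of_mem hs hs', fieldRep_chart hs']
  exact frame_nabla hs hs' hσ (Y s)

end Smooth

end RatLocalSystem

/-! ### Real derivatives of complex linear operators applied to vectors -/

section ComplexClmApply

variable {E F G : Type*} [NormedAddCommGroup E] [NormedSpace ℂ E]
  [NormedAddCommGroup F] [NormedSpace ℂ F] [NormedAddCommGroup G] [NormedSpace ℂ G]

theorem hasFDerivAt_complexClm_apply {A : E → F →L[ℂ] G} {A' : E →L[ℝ] F →L[ℂ] G} {X : E → F}
    {X' : E →L[ℝ] F} {z : E} (hA : HasFDerivAt A A' z) (hX : HasFDerivAt X X' z) :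
    HasFDerivAt (fun y => A y (X y)) (((A z).restrictScalars ℝ) ∘L X' +
      ((ContinuousLinearMap.restrictScalarsL ℂ F G ℝ ℝ) ∘L A').flip (X z)) z :=
  ((ContinuousLinearMap.restrictScalarsL ℂ F G ℝ ℝ).hasFDerivAt.comp z hA).clm_apply hX

theorem contDiffAt_complexClm_apply {n : ℕ∞ω} {A : E → F →L[ℂ] G} {X : E → F} {z : E}
    (hA : ContDiffAt ℝ n A z) (hX : ContDiffAt ℝ n X z) :
    ContDiffAt ℝ n (fun y => A y (X y)) z :=
  ((ContinuousLinearMap.restrictScalarsL ℂ F G ℝ ℝ).contDiff.comp_contDiffAt _ hA).clm_apply hX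

end ComplexClmApply

/-! ### Unipotent variations in a chart and a flat frame -/

theorem baseChange_map_eq_map_baseChange {M M' : Type*} [AddCommGroup M] [Module ℚ M]
    [AddCommGroup M'] [Module ℚ M'] (A : Submodule ℚ M) (f : M →ₗ[ℚ] M') :
    (A.map f).baseChange ℂ = (A.baseChange ℂ).map (f.baseChange ℂ) := by
  rw [Submodule.baseChange_eq_span, Submodule.baseChange_eq_span, Submodule.map_span,
    Submodule.map_coe, Submodule.map_coe, Submodule.map_coe, Set.image_image, Set.image_image]
  rfl

namespace VGPMHS

open RatLocalSystem

section LocalModel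

variable {E : Type*} [NormedAddCommGroup E] [NormedSpace ℂ E]
  {S : Type u} [TopologicalSpace S] [ChartedSpace E S] (𝒱 : VGPMHS.{u, v} E S)

theorem isMixedHodgeStructure (s : S) :
    IsMixedHodgeStructure (conjC (𝒱.L.Fib s)) (fun k => 𝒱.WC k s) fun p => 𝒱.F p s :=
  isMixedHodgeStructure_of_graded (𝒱.wt.mono s) (𝒱.wt.separated s) (𝒱.wt.exhaustive s)
    (𝒱.hodge_antitone s) (𝒱.hodge_separated s) (𝒱.hodge_exhaustive s)
    fun k => (𝒱.graded k).pure s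

/-- The conjugation in flat coordinates. -/
def localConj (x : S) : (Fin (𝒱.L.rk x) → ℂ) →ₛₗ[starRingEnd ℂ] (Fin (𝒱.L.rk x) → ℂ) :=
  ((𝒱.L.fibCoord x).toLinearMap.comp (conjC (𝒱.L.Fib x))).comp (𝒱.L.fibCoord x).symm.toLinearMap

/-- The weight filtration in flat coordinates. -/
def localWeight (x : S) (k : ℤ) : Submodule ℂ (Fin (𝒱.L.rk x) → ℂ) :=
  (𝒱.WC k x).map (𝒱.L.fibCoord x).toLinearMap

open Classical in
/-- The Hodge filtration in the chart and in the flat frame at `x`; it is `⊥` outside the domain of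
the frame. -/
def localHodge (x : S) (p : ℤ) (z : E) : Submodule ℂ (Fin (𝒱.L.rk x) → ℂ) :=
  if h : (chartAt E x).symm z ∈ 𝒱.L.nhd x then
    (𝒱.F p ((chartAt E x).symm z)).map (𝒱.L.frame x _ h).toLinearMap else ⊥

/-- The projection to `𝓤^p` in the chart and in the flat frame at `x`. -/
def localProj (x : S) (p : ℤ) (z : E) : (Fin (𝒱.L.rk x) → ℂ) →L[ℂ] (Fin (𝒱.L.rk x) → ℂ) :=
  summandProj (𝒱.localConj x) (𝒱.localWeight x) (𝒱.localHodge x) (chartAt E x x) p z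

/-- The primitive of the Higgs field given by the grading by the `𝓤^p`, in the chart and in the flat
frame at `x`. -/
def localGradingOp (x : S) (a b : ℤ) (z : E) : (Fin (𝒱.L.rk x) → ℂ) →L[ℂ] (Fin (𝒱.L.rk x) → ℂ) :=
  gradingOp (𝒱.localConj x) (𝒱.localWeight x) (𝒱.localHodge x) (chartAt E x x) a b z

variable {𝒱}

theorem localConj_frame {x s : S} (hs : s ∈ 𝒱.L.nhd x) (w : 𝒱.L.VC s) :
    𝒱.localConj x (𝒱.L.frame x s hs w) = 𝒱.L.frame x s hs (conjC _ w) := by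
  obtain ⟨w, rfl⟩ := (𝒱.L.transportC x s hs).surjective w
  rw [conjC_transportC, frame, LinearEquiv.trans_apply, LinearEquiv.trans_apply,
    LinearEquiv.symm_apply_apply, LinearEquiv.symm_apply_apply]
  simp [localConj]

theorem map_transportC_WC {x s : S} (hs : s ∈ 𝒱.L.nhd x) (k : ℤ) :
    (𝒱.WC k x).map (𝒱.L.transportC x s hs).toLinearMap = 𝒱.WC k s := by
  rw [WC, WC, ← 𝒱.wt.flat k x s hs, baseChange_map_eq_map_baseChange]
  rfl

theorem map_frame_WC {x s : S} (hs : s ∈ 𝒱.L.nhd x) (k : ℤ) :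
    (𝒱.WC k s).map (𝒱.L.frame x s hs).toLinearMap = 𝒱.localWeight x k := by
  rw [← map_transportC_WC hs, ← Submodule.map_comp, localWeight]
  congr 1
  exact LinearMap.ext fun w => by simp [frame]

theorem localHodge_of_mem {x s : S} (hs : s ∈ 𝒱.L.nhd x) (hs' : s ∈ (chartAt E x).source) (p : ℤ) :
    𝒱.localHodge x p (chartAt E x s) = (𝒱.F p s).map (𝒱.L.frame x s hs).toLinearMap := by
  have hleft : (chartAt E x).symm (chartAt E x s) = s := (chartAt E x).left_inv hs'
  rw [localHodge]
  generalize (chartAt E x).symm (chartAt E x s) = s' at hleft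
  subst hleft
  rw [dif_pos hs]

theorem frame_mem_localHodge_iff {x s : S} (hs : s ∈ 𝒱.L.nhd x) (hs' : s ∈ (chartAt E x).source)
    {p : ℤ} {w : 𝒱.L.VC s} :
    𝒱.L.frame x s hs w ∈ 𝒱.localHodge x p (chartAt E x s) ↔ w ∈ 𝒱.F p s := by
  rw [localHodge_of_mem hs hs']
  exact (𝒱.L.frame x s hs).injective.mem_set_image

theorem frame_mem_localWeight_iff {x s : S} (hs : s ∈ 𝒱.L.nhd x) {k : ℤ} {w : 𝒱.L.VC s} :
    𝒱.L.frame x s hs w ∈ 𝒱.localWeight x k ↔ w ∈ 𝒱.WC k s := by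
  rw [← map_frame_WC hs]
  exact (𝒱.L.frame x s hs).injective.mem_set_image

theorem isMixedHodgeStructure_localHodge {x s : S} (hs : s ∈ 𝒱.L.nhd x)
    (hs' : s ∈ (chartAt E x).source) :
    IsMixedHodgeStructure (𝒱.localConj x) (𝒱.localWeight x)
      fun p => 𝒱.localHodge x p (chartAt E x s) := by
  have hmap := (𝒱.isMixedHodgeStructure s).map (𝒱.L.frame x s hs) (localConj_frame hs)
  simpa only [map_frame_WC hs, ← localHodge_of_mem hs hs'] using hmap

theorem oppositeFiltration_localHodge {x s : S} (hs : s ∈ 𝒱.L.nhd x)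
    (hs' : s ∈ (chartAt E x).source) (p : ℤ) :
    oppositeFiltration (𝒱.localConj x) (𝒱.localWeight x)
        (fun p => 𝒱.localHodge x p (chartAt E x s)) p =
      (oppositeFiltration (conjC _) (fun k => 𝒱.WC k s) (fun p => 𝒱.F p s) p).map
        (𝒱.L.frame x s hs).toLinearMap := by
  have hmap := oppositeFiltration_map (𝒱.L.frame x s hs) (localConj_frame hs)
    (W := fun k => 𝒱.WC k s) (F := fun p => 𝒱.F p s) p
  simpa only [map_frame_WC hs, ← localHodge_of_mem hs hs'] using hmap

theorem grTransport_mkQ_eq_mkQ_iff {x s : S} (hs : s ∈ 𝒱.L.nhd x) {k : ℤ}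
    {b : ℂ ⊗[ℚ] 𝒱.wt.W k x} {b' : ℂ ⊗[ℚ] 𝒱.wt.W k s} :
    (𝒱.wt.grTransport k x s hs).toLinearMap.baseChange ℂ
        (((𝒱.wt.W (k - 1) x).submoduleOf (𝒱.wt.W k x)).mkQ.baseChange ℂ b) =
      ((𝒱.wt.W (k - 1) s).submoduleOf (𝒱.wt.W k s)).mkQ.baseChange ℂ b' ↔
    𝒱.L.transportC x s hs ((𝒱.wt.W k x).subtype.baseChange ℂ b) -
      (𝒱.wt.W k s).subtype.baseChange ℂ b' ∈ 𝒱.WC (k - 1) s := by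
  let T : 𝒱.wt.W k x ≃ₗ[ℚ] 𝒱.wt.W k s :=
    (𝒱.L.transport x s hs).ofSubmodules _ _ (𝒱.wt.flat k x s hs)
  have hquot : (𝒱.wt.grTransport k x s hs).toLinearMap.baseChange ℂ
        (((𝒱.wt.W (k - 1) x).submoduleOf (𝒱.wt.W k x)).mkQ.baseChange ℂ b) =
      ((𝒱.wt.W (k - 1) s).submoduleOf (𝒱.wt.W k s)).mkQ.baseChange ℂ
        (T.toLinearMap.baseChange ℂ b) := by
    rw [← LinearMap.comp_apply, ← LinearMap.comp_apply, ← LinearMap.baseChange_comp,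
      ← LinearMap.baseChange_comp]
    rfl
  have hsub : 𝒱.L.transportC x s hs ((𝒱.wt.W k x).subtype.baseChange ℂ b) =
      (𝒱.wt.W k s).subtype.baseChange ℂ (T.toLinearMap.baseChange ℂ b) := by
    rw [transportC_apply, ← LinearMap.comp_apply, ← LinearMap.comp_apply,
      ← LinearMap.baseChange_comp, ← LinearMap.baseChange_comp]
    rfl
  rw [hquot, hsub, ← map_sub, WC, ← mkQ_baseChange_eq_zero_iff (𝒱.wt.mono s (by lia)), map_sub,
    sub_eq_zero]

namespace IsUnipotent

variable (h𝒱 : 𝒱.IsUnipotent)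

include h𝒱

theorem exists_transportC_sub_mem {x s : S} (hs : s ∈ 𝒱.L.nhd x) (p k : ℤ) :
    ∀ f ∈ 𝒱.F p x ⊓ 𝒱.WC k x, ∃ f' ∈ 𝒱.F p s ⊓ 𝒱.WC k s,
      𝒱.L.transportC x s hs f - f' ∈ 𝒱.WC (k - 1) s := by
  rintro _ ⟨hf, b, rfl⟩
  obtain ⟨b', hb', hbb'⟩ := (h𝒱 k p x s hs).le (Submodule.mem_map_of_mem ⟨b, hf, rfl⟩)
  exact ⟨_, ⟨hb', b', rfl⟩, (grTransport_mkQ_eq_mkQ_iff hs).1 hbb'.symm⟩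

theorem exists_sub_transportC_mem {x s : S} (hs : s ∈ 𝒱.L.nhd x) (p k : ℤ) :
    ∀ f' ∈ 𝒱.F p s ⊓ 𝒱.WC k s, ∃ f ∈ 𝒱.F p x ⊓ 𝒱.WC k x,
      𝒱.L.transportC x s hs f - f' ∈ 𝒱.WC (k - 1) s := by
  rintro _ ⟨hf, b', rfl⟩
  obtain ⟨_, ⟨b, hb, rfl⟩, hbb'⟩ := (h𝒱 k p x s hs).ge ⟨b', hf, rfl⟩
  exact ⟨_, ⟨hb, b, rfl⟩, (grTransport_mkQ_eq_mkQ_iff hs).1 hbb'⟩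

theorem exists_frame_sub_frame_mem {x s s' : S} (hs : s ∈ 𝒱.L.nhd x) (hs' : s' ∈ 𝒱.L.nhd x)
    (p k : ℤ) {w : 𝒱.L.VC s} (hw : w ∈ 𝒱.F p s ⊓ 𝒱.WC k s) :
    ∃ w' ∈ 𝒱.F p s' ⊓ 𝒱.WC k s',
      𝒱.L.frame x s hs w - 𝒱.L.frame x s' hs' w' ∈ 𝒱.localWeight x (k - 1) := by
  obtain ⟨f, hf, hfw⟩ := h𝒱.exists_sub_transportC_mem hs p k w hw
  obtain ⟨w', hw', hfw'⟩ := h𝒱.exists_transportC_sub_mem hs' p k f hf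
  refine ⟨w', hw', ?_⟩
  rw [← frame_mem_localWeight_iff hs, map_sub] at hfw
  rw [← frame_mem_localWeight_iff hs', map_sub] at hfw'
  have hflat : 𝒱.L.frame x s hs (𝒱.L.transportC x s hs f) =
      𝒱.L.frame x s' hs' (𝒱.L.transportC x s' hs' f) := by simp [frame]
  rw [hflat] at hfw
  simpa using Submodule.sub_mem _ hfw' hfw

end IsUnipotent

variable {x : S} {r : ℝ} (hr : 𝒱.L.IsGoodBall E x r)

include hr

theorem localHodge_graded_le (h𝒱 : 𝒱.IsUnipotent) {z z' : E}
    (hz : z ∈ Metric.ball (chartAt E x x) r) (hz' : z' ∈ Metric.ball (chartAt E x x) r) (p k : ℤ)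
    {f : Fin (𝒱.L.rk x) → ℂ} (hf : f ∈ 𝒱.localHodge x p z ⊓ 𝒱.localWeight x k) :
    ∃ f' ∈ 𝒱.localHodge x p z' ⊓ 𝒱.localWeight x k, f - f' ∈ 𝒱.localWeight x (k - 1) := by
  obtain ⟨s, rfl, hs, hsx⟩ := hr.exists_eq_chart hz
  obtain ⟨s', rfl, hs', hsx'⟩ := hr.exists_eq_chart hz'
  obtain ⟨w, rfl⟩ := (𝒱.L.frame x s hs).surjective f
  have hw : w ∈ 𝒱.F p s ⊓ 𝒱.WC k s :=
    ⟨(frame_mem_localHodge_iff hs hsx).1 hf.1, (frame_mem_localWeight_iff hs).1 hf.2⟩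
  obtain ⟨w', hw', hww'⟩ := h𝒱.exists_frame_sub_frame_mem hs hs' p k hw
  exact ⟨_, ⟨(frame_mem_localHodge_iff hs' hsx').2 hw'.1, (frame_mem_localWeight_iff hs').2 hw'.2⟩,
    hww'⟩

variable [IsManifold 𝓘(ℂ, E) ω S]

theorem exists_localHodge_frame (p : ℤ) {z : E} (hz : z ∈ Metric.ball (chartAt E x x) r) :
    ∃ (m : ℕ) (f : Fin m → E → Fin (𝒱.L.rk x) → ℂ), ∀ᶠ y in 𝓝 z,
      (∀ i, ContDiffAt ℂ ω (f i) y) ∧ LinearIndependent ℂ (fun i => f i y) ∧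
        Submodule.span ℂ (Set.range fun i => f i y) = 𝒱.localHodge x p y := by
  obtain ⟨m, f, hf⟩ := 𝒱.hodge_holomorphic p ((chartAt E x).symm z)
  refine ⟨m, fun i => localRep E x (f i), ?_⟩
  filter_upwards [(hr.tendsto_symm hz).eventually hf, Metric.isOpen_ball.mem_nhds hz] with y hy hyb
  obtain ⟨s, rfl, hs, hs'⟩ := hr.exists_eq_chart hyb
  rw [(chartAt E x).left_inv hs'] at hy
  obtain ⟨hhol, hindep, hspan⟩ := hy
  simp only [localRep_of_mem hs hs']
  refine ⟨fun i => (holomorphicAt_iff hs hs').1 (hhol i),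
    hindep.map' (𝒱.L.frame x s hs).toLinearMap (LinearEquiv.ker _), ?_⟩
  rw [localHodge_of_mem hs hs', ← hspan, Submodule.map_span, ← Set.range_comp]
  rfl

theorem fderiv_mem_localHodge (p : ℤ) {z : E} (hz : z ∈ Metric.ball (chartAt E x x) r)
    {f : E → Fin (𝒱.L.rk x) → ℂ}
    (hf : ∀ᶠ y in 𝓝 z, ContDiffAt ℂ ω f y ∧ f y ∈ 𝒱.localHodge x p y) (v : E) :
    fderiv ℂ f z v ∈ 𝒱.localHodge x (p - 1) z := by
  obtain ⟨s, rfl, hs, hs'⟩ := hr.exists_eq_chart hz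
  let σ : 𝒱.L.Section := sectionOf x f
  have hrep : ∀ y ∈ Metric.ball (chartAt E x x) r, localRep E x σ =ᶠ[𝓝 y] f := fun y hy => by
    filter_upwards [Metric.isOpen_ball.mem_nhds hy] with y' hy' using localRep_sectionOf hr f hy'
  have hσ : ∀ᶠ y in 𝓝 s, 𝒱.L.HolomorphicAt E σ y ∧ σ y ∈ 𝒱.F p y := by
    filter_upwards [((chartAt E x).continuousAt hs').eventually hf, hr.eventually_ball hs' hz]
      with y ⟨hsmooth, hmem⟩ ⟨hy', hyb, hy⟩
    rw [holomorphicAt_iff hy hy', contDiffAt_iff_of_eventuallyEq (hrep _ hyb),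
      ← frame_mem_localHodge_iff hy hy', frame_sectionOf hy f]
    exact ⟨hsmooth, hmem⟩
  obtain ⟨e, he⟩ := chartDeriv_isInvertible (E := E) hs'
  obtain ⟨u, rfl⟩ := e.surjective v
  have hdiff : DifferentiableAt ℂ f (chartAt E x s) := hf.self_of_nhds.1.differentiableAt (by simp)
  have hderiv : 𝒱.L.frame x s hs (𝒱.L.nabla E σ s u) = fderiv ℂ f (chartAt E x s) (e u) := by
    rw [frame_nabla hs hs' ((hrep _ hz).differentiableAt_iff.2 (hdiff.restrictScalars ℝ)),
      (hrep _ hz).fderiv_eq, hdiff.fderiv_restrictScalars ℝ, ← he]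
    rfl
  rw [← hderiv, frame_mem_localHodge_iff hs hs']
  exact 𝒱.horizontal p σ s hσ u

theorem isLocalVariation (h𝒱 : 𝒱.IsUnipotent) :
    IsLocalVariation (Metric.ball (chartAt E x x) r) (𝒱.localConj x) (𝒱.localWeight x)
      (𝒱.localHodge x) where
  isOpen := Metric.isOpen_ball
  convex := convex_ball _ _
  mixedHodge z hz := by
    obtain ⟨s, rfl, hs, hs'⟩ := hr.exists_eq_chart hz
    exact isMixedHodgeStructure_localHodge hs hs'
  graded_le _ hz _ hz' p k _ hf := localHodge_graded_le hr h𝒱 hz hz' p k hf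
  exists_frame p _ hz := exists_localHodge_frame hr p hz
  horizontal p _ hz _ hf v := fderiv_mem_localHodge hr p hz hf v

theorem frame_proj (h𝒱 : 𝒱.IsUnipotent) {s : S} (hs : s ∈ 𝒱.L.nhd x)
    (hs' : s ∈ (chartAt E x).source) (hz : chartAt E x s ∈ Metric.ball (chartAt E x x) r) (p : ℤ)
    (e : 𝒱.L.VC s) :
    𝒱.L.frame x s hs (𝒱.proj p s e) =
      𝒱.localProj x p (chartAt E x s) (𝒱.L.frame x s hs e) := by
  have h := isLocalVariation hr h𝒱
  have hodgeProj_frame : ∀ q, ∃ f ∈ 𝒱.F q s,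
      e - f ∈ oppositeFiltration (conjC _) (fun k => 𝒱.WC k s) (fun p => 𝒱.F p s) (q - 1) ∧
      hodgeProj (𝒱.localConj x) (𝒱.localWeight x) (𝒱.localHodge x) (chartAt E x x) q
        (chartAt E x s) (𝒱.L.frame x s hs e) = 𝒱.L.frame x s hs f := by
    intro q
    obtain ⟨hmem, hsub⟩ := h.hodgeProj_spec hr.mem_self hz q (𝒱.L.frame x s hs e)
    rw [h.oppositeFiltration_eq hr.mem_self hz, oppositeFiltration_localHodge hs hs'] at hsub
    rw [localHodge_of_mem hs hs'] at hmem
    obtain ⟨f, hf, hfe⟩ := hmem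
    refine ⟨f, hf, ?_, hfe.symm⟩
    rw [← hfe] at hsub
    refine (𝒱.L.frame x s hs).injective.mem_set_image.1 ?_
    rw [map_sub]
    exact hsub
  obtain ⟨f, hf, hef, hPf⟩ := hodgeProj_frame p
  obtain ⟨f', hf', hef', hPf'⟩ := hodgeProj_frame (p + 1)
  rw [add_sub_cancel_right] at hef'
  have hproj : 𝒱.proj p s e = f - f' :=
    (𝒱.isMixedHodgeStructure s).gradedProj_deligneU_eq_sub hf hef hf' hef'
  rw [hproj, map_sub, localProj, summandProj, sub_apply, hPf, hPf']

end LocalModel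

end VGPMHS

/-! ### The operators `∂̄`, `∂` and the Higgs field in flat coordinates -/

namespace VGPMHS

open RatLocalSystem

section Higgs

variable {E : Type*} [NormedAddCommGroup E] [NormedSpace ℂ E]
  {S : Type u} [TopologicalSpace S] [ChartedSpace E S] (𝒱 : VGPMHS.{u, v} E S)

/-- On the ball of radius `r` around `x` in the chart at `x`, the flat frame is defined and the
Hodge filtration has all its jumps in `[a, b]`. -/
structure IsAdapted (x : S) (r : ℝ) (a b : ℤ) : Prop where
  good : 𝒱.L.IsGoodBall E x r
  range : IsHodgeRange (Metric.ball (chartAt E x x) r) (𝒱.localConj x) (𝒱.localWeight x)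
    (𝒱.localHodge x) (chartAt E x x) a b

/-- The Higgs field in the chart and in the flat frame at `x`. -/
def localHiggs (x : S) (a b : ℤ) (z : E) :
    E →L[ℂ] (Fin (𝒱.L.rk x) → ℂ) →L[ℂ] (Fin (𝒱.L.rk x) → ℂ) :=
  fderiv ℂ (𝒱.localGradingOp x a b) z

variable {𝒱} [IsManifold 𝓘(ℂ, E) ω S]

theorem IsUnipotent.eventually_isAdapted (h𝒱 : 𝒱.IsUnipotent) {x : S} {r : ℝ}
    (hr : 𝒱.L.IsGoodBall E x r) :
    ∃ a₀ b₀ : ℤ, ∀ a ≤ a₀, ∀ b ≥ b₀, 𝒱.IsAdapted x r a b := by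
  obtain ⟨a₀, b₀, h⟩ := (isLocalVariation hr h𝒱).exists_isHodgeRange hr.mem_self
  exact ⟨a₀, b₀, fun a ha b hb => ⟨hr, h a ha b hb⟩⟩

theorem IsUnipotent.exists_isAdapted (h𝒱 : 𝒱.IsUnipotent) (x : S) :
    ∃ r a b, 𝒱.IsAdapted x r a b := by
  obtain ⟨r, hr, h⟩ := exists_isGoodBall E 𝒱.L x
  obtain ⟨a, b, h⟩ := h𝒱.eventually_isAdapted (h r hr le_rfl)
  exact ⟨r, a, b, h a le_rfl b le_rfl⟩

variable (h𝒱 : 𝒱.IsUnipotent) {x : S} {r : ℝ} {a b : ℤ} (hA : 𝒱.IsAdapted x r a b)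

include h𝒱 hA

theorem localProj_mul {z : E} (hz : z ∈ Metric.ball (chartAt E x x) r) (p q : ℤ) :
    𝒱.localProj x p z * 𝒱.localProj x q z = if p = q then 𝒱.localProj x p z else 0 :=
  (isLocalVariation hA.good h𝒱).summandProj_mul hA.good.mem_self hz p q

theorem contDiffAt_localProj {z : E} (hz : z ∈ Metric.ball (chartAt E x x) r) (p : ℤ) :
    ContDiffAt ℂ ω (𝒱.localProj x p) z :=
  (isLocalVariation hA.good h𝒱).contDiffAt_summandProj hA.good.mem_self hz p

theorem contDiffAt_localHiggs {z : E} (hz : z ∈ Metric.ball (chartAt E x x) r) :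
    ContDiffAt ℂ ω (𝒱.localHiggs x a b) z :=
  ((isLocalVariation hA.good h𝒱).contDiffAt_gradingOp hA.good.mem_self a b hz).fderiv_right le_rfl

theorem localHiggs_commute {z : E} (hz : z ∈ Metric.ball (chartAt E x x) r) (v w : E) :
    𝒱.localHiggs x a b z v * 𝒱.localHiggs x a b z w =
      𝒱.localHiggs x a b z w * 𝒱.localHiggs x a b z v :=
  (isLocalVariation hA.good h𝒱).fderiv_gradingOp_commute hA.good.mem_self hA.range hz v w

theorem fderiv_localHiggs_symm {z : E} (hz : z ∈ Metric.ball (chartAt E x x) r) (v w : E) :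
    fderiv ℂ (𝒱.localHiggs x a b) z v w = fderiv ℂ (𝒱.localHiggs x a b) z w v :=
  (((isLocalVariation hA.good h𝒱).contDiffAt_gradingOp hA.good.mem_self a b hz).isSymmSndFDerivAt
    (by simp)) v w

theorem localRep_comp (σ : 𝒱.L.Section) (p : ℤ) {z : E}
    (hz : z ∈ Metric.ball (chartAt E x x) r) :
    localRep E x (𝒱.comp p σ) z = 𝒱.localProj x p z (localRep E x σ z) := by
  obtain ⟨s, rfl, hs, hs'⟩ := hA.good.exists_eq_chart hz
  rw [localRep_of_mem hs hs', localRep_of_mem hs hs']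
  exact frame_proj hA.good h𝒱 hs hs' hz p (σ s)

variable {s : S} (hs : s ∈ 𝒱.L.nhd x) (hs' : s ∈ (chartAt E x).source)
  (hz : chartAt E x s ∈ Metric.ball (chartAt E x x) r)

include hz

omit h𝒱 [IsManifold 𝓘(ℂ, E) ω S] in
theorem frame_finsum {τ : ℂ →+* ℂ} {T : ℤ → E →ₛₗ[τ] 𝒱.L.VC s}
    {B : E → (Fin (𝒱.L.rk x) → ℂ) →L[ℂ] (Fin (𝒱.L.rk x) → ℂ)} {w : E → Fin (𝒱.L.rk x) → ℂ}
    (hT : ∀ p v, 𝒱.L.frame x s hs (T p v) = B v (𝒱.localProj x p (chartAt E x s) (w v))) (v : E) :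
    𝒱.L.frame x s hs ((∑ᶠ p, T p) v) = B v (w v) := by
  rw [finsum_eq_sum_of_support_subset (s := Finset.Icc a b), LinearMap.sum_apply, map_sum]
  · simp only [hT]
    rw [← map_sum]
    exact congrArg (B v) (hA.range.sum_summandProj_apply hz (w v))
  · intro p hp
    by_contra hp'
    refine hp (LinearMap.ext fun v => (𝒱.L.frame x s hs).injective ?_)
    rw [hT, localProj, hA.range.summandProj_eq_zero hz (by simpa using hp'), zero_apply, map_zero,
      LinearMap.zero_apply, map_zero]

include hs'

variable {σ : 𝒱.L.Section} (hσ : DifferentiableAt ℝ (localRep E x σ) (chartAt E x s))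

include hσ

theorem frame_nabla_comp (p : ℤ) (v : E) :
    𝒱.L.frame x s hs (𝒱.L.nabla E (𝒱.comp p σ) s v) =
      fderiv ℂ (𝒱.localProj x p) (chartAt E x s) (chartDeriv E x s v)
        (𝒱.L.frame x s hs (σ s)) +
      𝒱.localProj x p (chartAt E x s) (𝒱.L.frame x s hs (𝒱.L.nabla E σ s v)) := by
  have hP := ((contDiffAt_localProj h𝒱 hA hz p).differentiableAt (by simp)).hasFDerivAt
  have hrep : localRep E x (𝒱.comp p σ) =ᶠ[𝓝 (chartAt E x s)]
      fun y => 𝒱.localProj x p y (localRep E x σ y) := by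
    filter_upwards [Metric.isOpen_ball.mem_nhds hz] with y hy using localRep_comp h𝒱 hA σ p hy
  have hprod := (hasFDerivAt_complexClm_apply (hP.restrictScalars ℝ)
    hσ.hasFDerivAt).congr_of_eventuallyEq hrep
  rw [frame_nabla hs hs' hprod.differentiableAt, frame_nabla hs hs' hσ, hprod.fderiv,
    ← localRep_of_mem hs hs', add_comm]
  rfl

theorem frame_nabla10_comp (p : ℤ) (v : E) :
    𝒱.L.frame x s hs (𝒱.L.nabla10 E (𝒱.comp p σ) s v) =
      fderiv ℂ (𝒱.localProj x p) (chartAt E x s) (chartDeriv E x s v)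
        (𝒱.L.frame x s hs (σ s)) +
      𝒱.localProj x p (chartAt E x s) (𝒱.L.frame x s hs (𝒱.L.nabla10 E σ s v)) := by
  rw [nabla10_apply, nabla10_apply]
  simp only [map_smul, map_sub, frame_nabla_comp h𝒱 hA hs hs' hz hσ, chartDeriv_I_smul hs',
    smul_apply]
  match_scalars
  · linear_combination (-1 / 2 : ℂ) * Complex.I_mul_I
  · ring
  · ring

theorem frame_nabla01_comp (p : ℤ) (v : E) :
    𝒱.L.frame x s hs (𝒱.L.nabla01 E (𝒱.comp p σ) s v) =
      𝒱.localProj x p (chartAt E x s) (𝒱.L.frame x s hs (𝒱.L.nabla01 E σ s v)) := by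
  rw [nabla01_apply, nabla01_apply]
  simp only [map_smul, map_add, frame_nabla_comp h𝒱 hA hs hs' hz hσ, chartDeriv_I_smul hs',
    smul_apply]
  match_scalars
  · linear_combination (1 / 2 : ℂ) * Complex.I_mul_I
  · ring
  · ring

theorem frame_delbar (v : E) :
    𝒱.L.frame x s hs (𝒱.delbar σ s v) = 𝒱.L.frame x s hs (𝒱.L.nabla01 E σ s v) := by
  refine frame_finsum hA hs hz (B := fun _ => 1)
    (w := fun v => 𝒱.L.frame x s hs (𝒱.L.nabla01 E σ s v)) (fun p v => ?_) v
  rw [LinearMap.comp_apply, frame_proj hA.good h𝒱 hs hs' hz,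
    frame_nabla01_comp h𝒱 hA hs hs' hz hσ, ← mul_apply_eq_comp, localProj_mul h𝒱 hA hz, if_pos rfl]
  rfl

theorem frame_del (v : E) :
    𝒱.L.frame x s hs (𝒱.del σ s v) = 𝒱.L.frame x s hs (𝒱.L.nabla10 E σ s v) -
      𝒱.localHiggs x a b (chartAt E x s) (chartDeriv E x s v) (𝒱.L.frame x s hs (σ s)) := by
  refine frame_finsum hA hs hz (B := fun _ => 1) (w := fun v =>
    𝒱.L.frame x s hs (𝒱.L.nabla10 E σ s v) - 𝒱.localHiggs x a b (chartAt E x s)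
      (chartDeriv E x s v) (𝒱.L.frame x s hs (σ s))) (fun p v => ?_) v
  have hderiv := (isLocalVariation hA.good h𝒱).summandProj_mul_fderiv hA.good.mem_self hA.range hz
    (chartDeriv E x s v) p
  rw [LinearMap.comp_apply, frame_proj hA.good h𝒱 hs hs' hz,
    frame_nabla10_comp h𝒱 hA hs hs' hz hσ, map_add, one_apply_eq_self, map_sub, add_comm,
    sub_eq_add_neg, ← mul_apply_eq_comp, localProj_mul h𝒱 hA hz, if_pos rfl]
  exact congrArg (_ + ·) (congrArg (fun T => T (𝒱.L.frame x s hs (σ s))) hderiv)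

theorem frame_higgsOp (v : E) :
    𝒱.L.frame x s hs (𝒱.higgsOp σ s v) =
      𝒱.localHiggs x a b (chartAt E x s) (chartDeriv E x s v) (𝒱.L.frame x s hs (σ s)) := by
  refine frame_finsum hA hs hz
    (B := fun v => 𝒱.localHiggs x a b (chartAt E x s) (chartDeriv E x s v))
    (w := fun _ => 𝒱.L.frame x s hs (σ s)) (fun p v => ?_) v
  have hderiv := (isLocalVariation hA.good h𝒱).summandProj_sub_one_mul_fderiv hA.good.mem_self
    hA.range hz (chartDeriv E x s v) p
  rw [LinearMap.comp_apply, frame_proj hA.good h𝒱 hs hs' hz,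
    frame_nabla10_comp h𝒱 hA hs hs' hz hσ, map_add, ← mul_apply_eq_comp, ← mul_apply_eq_comp,
    localProj_mul h𝒱 hA hz, if_neg (by lia), zero_apply, add_zero]
  exact congrArg (fun T => T (𝒱.L.frame x s hs (σ s))) hderiv

omit hσ in
theorem frame_θ (v : E) (e : 𝒱.L.VC s) :
    𝒱.L.frame x s hs (𝒱.θ s v e) =
      𝒱.localHiggs x a b (chartAt E x s) (chartDeriv E x s v) (𝒱.L.frame x s hs e) := by
  suffices 𝒱.L.frame x s hs ∘ₗ 𝒱.θ s v =
      (𝒱.localHiggs x a b (chartAt E x s) (chartDeriv E x s v)).toLinearMap ∘ₗ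
        (𝒱.L.frame x s hs).toLinearMap from congrArg (fun T => T e) this
  refine (Module.finBasis ℂ (𝒱.L.VC s)).ext fun i => ?_
  set e := Module.finBasis ℂ (𝒱.L.VC s) i
  let σ := 𝒱.L.flatExt s e
  have hθ : 𝒱.θ s v e = 𝒱.higgsOp σ s v := by
    rw [θ, LinearMap.flip_apply, Module.Basis.constr_basis]
  have hconst := eventually_frameCoord_flatExt hs e
  have hσs : 𝒱.L.frame x s hs (σ s) = 𝒱.L.frame x s hs e := by
    rw [← frameCoord_of_mem hs]
    exact hconst.self_of_nhds
  have htendsto := hA.good.tendsto_symm hz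
  rw [(chartAt E x).left_inv hs'] at htendsto
  have hrep : localRep E x σ =ᶠ[𝓝 (chartAt E x s)] fun _ => 𝒱.L.frame x s hs e :=
    htendsto.eventually hconst
  change 𝒱.L.frame x s hs (𝒱.θ s v e) = _
  rw [hθ, frame_higgsOp h𝒱 hA hs hs' hz (hrep.differentiableAt_iff.2 (differentiableAt_const _)),
    hσs]
  rfl

end Higgs

end VGPMHS

namespace RatLocalSystem

section Flat

variable {E : Type*} [NormedAddCommGroup E] [NormedSpace ℂ E]
  {S : Type u} [TopologicalSpace S] [ChartedSpace E S] {L : RatLocalSystem.{u, v} S}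

theorem nabla_congr {σ τ : L.Section} {x : S} (h : ∀ᶠ s in 𝓝 x, σ s = τ s) (v : E) :
    L.nabla E σ x v = L.nabla E τ x v := by
  have hcoord : L.frameCoord x σ =ᶠ[𝓝 x] L.frameCoord x τ := by
    filter_upwards [h] with s hs
    simp only [frameCoord, hs]
  rw [nabla, nabla, dFrameCoord, dFrameCoord]
  exact congrArg (fun T : E →L[ℝ] Fin (L.rk x) → ℂ => (L.fibCoord x).symm (T v))
    (hcoord.mfderiv_eq (I := 𝓘(ℝ, E)) (I' := 𝓘(ℝ, Fin (L.rk x) → ℂ)))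

theorem isSmoothSubbundle_of_trivialization {G : ∀ s, Submodule ℂ (L.VC s)}
    (hG : ∀ x, ∃ (G₀ : Submodule ℂ (Fin (L.rk x) → ℂ))
      (T : E → (Fin (L.rk x) → ℂ) →L[ℂ] (Fin (L.rk x) → ℂ)),
      ∀ᶠ z in 𝓝 (chartAt E x x), ContDiffAt ℝ ∞ T z ∧ IsUnit (T z) ∧
        ∀ s (hs : s ∈ L.nhd x), s ∈ (chartAt E x).source → chartAt E x s = z →
          (G s).map (L.frame x s hs).toLinearMap = G₀.map (T z).toLinearMap)
    [IsManifold 𝓘(ℂ, E) ω S] : L.IsSmoothSubbundle E G := by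
  intro x
  obtain ⟨r, hr, hgood⟩ := exists_isGoodBall E L x
  replace hr := hgood r hr le_rfl
  obtain ⟨G₀, T, hT⟩ := hG x
  let B := Module.finBasis ℂ G₀
  refine ⟨_, fun i => sectionOf x fun z => T z (B i), ?_⟩
  have hx' := mem_chart_source E x
  filter_upwards [hr.eventually_ball hx' hr.mem_self,
    ((chartAt E x).continuousAt hx').eventually hT] with s ⟨hs', hz, hs⟩ ⟨hsmooth, hunit, hmap⟩
  have hTinj : Function.Injective (T (chartAt E x s)) := by
    obtain ⟨u, hu⟩ := hunit
    refine Function.LeftInverse.injective (g := u⁻¹.1) fun w => ?_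
    rw [← hu, ← mul_apply_eq_comp, Units.inv_mul, one_apply_eq_self]
  have hframe : L.frame x s hs ∘ (fun i => sectionOf x (fun z => T z (B i)) s) =
      ((T (chartAt E x s)).toLinearMap ∘ₗ G₀.subtype) ∘ B := funext fun i => frame_sectionOf hs _
  refine ⟨fun i => ?_, ?_, ?_⟩
  · rw [smoothAt_iff hs hs', contDiffAt_iff_of_eventuallyEq (g := fun z => T z (B i))]
    · exact contDiffAt_complexClm_apply hsmooth contDiffAt_const
    · filter_upwards [Metric.isOpen_ball.mem_nhds hz] with z hz using localRep_sectionOf hr _ hz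
  · refine LinearIndependent.of_comp (L.frame x s hs).toLinearMap ?_
    exact hframe ▸ B.linearIndependent.map' _
      (LinearMap.ker_eq_bot.2 (hTinj.comp G₀.subtype_injective))
  · apply Submodule.map_injective_of_injective (L.frame x s hs).injective
    refine (Submodule.map_span _ _).trans ?_
    rw [← Set.range_comp]
    refine (congrArg (fun f => Submodule.span ℂ (Set.range f)) hframe).trans ?_
    rw [Set.range_comp, ← Submodule.map_span, B.span_eq, Submodule.map_top, LinearMap.range_comp,
      Submodule.range_subtype]
    exact (hmap s hs hs' rfl).symm

variable [IsManifold 𝓘(ℂ, E) ω S]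

theorem eventually_localRep_nabla {σ : L.Section} {x : S} (hσ : L.SmoothAt E σ x)
    (Y : ∀ s : S, TangentSpace 𝓘(ℝ, E) s) :
    (localRep E x fun s => L.nabla E σ s (Y s)) =ᶠ[𝓝 (chartAt E x x)]
      fun z => fderiv ℝ (localRep E x σ) z (fieldRep x Y z) := by
  rw [smoothAt_iff (L.mem_nhd x) (mem_chart_source E x)] at hσ
  obtain ⟨r, hr, hgood⟩ := exists_isGoodBall E L x
  filter_upwards [(hσ.of_le (m := 1) (by norm_cast)).eventually (by simp),
    Metric.isOpen_ball.mem_nhds (hgood r hr le_rfl).mem_self] with z hσz hz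
  exact localRep_nabla (hgood r hr le_rfl) Y hz (hσz.differentiableAt (by simp))

theorem smoothAt_nabla {σ : L.Section} {x : S} {Y : ∀ s : S, TangentSpace 𝓘(ℝ, E) s}
    (hY : SmoothFieldAt Y x) (hσ : L.SmoothAt E σ x) :
    L.SmoothAt E (fun s => L.nabla E σ s (Y s)) x := by
  have hrep := eventually_localRep_nabla hσ Y
  rw [smoothAt_iff (L.mem_nhd x) (mem_chart_source E x)] at hσ ⊢
  rw [contDiffAt_iff_of_eventuallyEq hrep]
  exact (hσ.fderiv_right (m := ∞) (by simp)).clm_apply (contDiffAt_fieldRep hY)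

theorem nabla_sub {σ τ : L.Section} {x : S} (hσ : L.SmoothAt E σ x) (hτ : L.SmoothAt E τ x)
    (v : E) :
    L.nabla E (fun s => σ s - τ s) x v = L.nabla E σ x v - L.nabla E τ x v := by
  have hx := L.mem_nhd x
  have hx' := mem_chart_source E x
  replace hσ := ((smoothAt_iff hx hx').1 hσ).differentiableAt (by simp)
  replace hτ := ((smoothAt_iff hx hx').1 hτ).differentiableAt (by simp)
  have hrep : localRep E x (fun s => σ s - τ s) =ᶠ[𝓝 (chartAt E x x)]
      localRep E x σ - localRep E x τ := by
    obtain ⟨r, hr, hgood⟩ := exists_isGoodBall E L x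
    filter_upwards [Metric.isOpen_ball.mem_nhds (hgood r hr le_rfl).mem_self] with z hz
    obtain ⟨s, rfl, hs, hs'⟩ := (hgood r hr le_rfl).exists_eq_chart hz
    simp only [Pi.sub_apply, localRep_of_mem hs hs', map_sub]
  apply (L.frame x x hx).injective
  rw [map_sub, frame_nabla hx hx' (hrep.differentiableAt_iff.2 (hσ.sub hτ)), frame_nabla hx hx' hσ,
    frame_nabla hx hx' hτ, hrep.fderiv_eq, fderiv_sub hσ hτ, sub_apply]

theorem frame_nabla_nabla {σ : L.Section} {x : S} {Y : ∀ s : S, TangentSpace 𝓘(ℝ, E) s}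
    (hY : SmoothFieldAt Y x) (hσ : L.SmoothAt E σ x) (v : E) :
    L.frame x x (L.mem_nhd x) (L.nabla E (fun s => L.nabla E σ s (Y s)) x v) =
      fderiv ℝ (localRep E x σ) (chartAt E x x)
          (fderiv ℝ (fieldRep x Y) (chartAt E x x) (chartDeriv E x x v)) +
        fderiv ℝ (fderiv ℝ (localRep E x σ)) (chartAt E x x) (chartDeriv E x x v)
          (fieldRep x Y (chartAt E x x)) := by
  have hrep := eventually_localRep_nabla hσ Y
  rw [smoothAt_iff (L.mem_nhd x) (mem_chart_source E x)] at hσ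
  have hderiv := ((((hσ.fderiv_right (m := 1) (by norm_cast)).differentiableAt
    (by simp)).hasFDerivAt).clm_apply ((contDiffAt_fieldRep hY).differentiableAt
      (by simp)).hasFDerivAt).congr_of_eventuallyEq hrep
  rw [frame_nabla _ (mem_chart_source E x) hderiv.differentiableAt, hderiv.fderiv]
  rfl

theorem isFlat_nabla : L.IsFlat (L.nabla E) := by
  intro X Y σ x hX hY hσ
  have hx := L.mem_nhd x
  have hx' := mem_chart_source E x
  have hσ' := (smoothAt_iff hx hx').1 hσ
  have hsymm := hσ'.isSymmSndFDerivAt (by simp; norm_cast)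
  have hXY := frame_nabla_nabla hY hσ (X x)
  have hYX := frame_nabla_nabla hX hσ (Y x)
  have hbracket := frame_nabla hx hx' (hσ'.differentiableAt (by simp))
    (VectorField.mlieBracket 𝓘(ℝ, E) X Y x)
  rw [← fieldRep_chart hx'] at hXY hYX
  rw [chartDeriv_mlieBracket, map_sub] at hbracket
  rw [hsymm.eq] at hXY
  apply (L.frame x x hx).injective
  rw [map_sub, map_sub, map_zero]
  refine (congrArg₂ (· - ·) (congrArg₂ (· - ·) hXY hYX) hbracket).trans ?_
  abel

end Flat

end RatLocalSystem

/-! ### The Higgs field, the connection `∇ - θ` and the bundles `U^p` -/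

namespace VGPMHS

open RatLocalSystem

section Parallel

variable {E : Type*} [NormedAddCommGroup E] [NormedSpace ℂ E]
  {S : Type u} [TopologicalSpace S] [ChartedSpace E S] {𝒱 : VGPMHS.{u, v} E S}

theorem mem_U_iff (p : ℤ) (s : S) (e : 𝒱.L.VC s) : e ∈ 𝒱.U p s ↔ 𝒱.proj p s e = e := by
  have h : IsCompl (𝒱.U p s) (⨆ (r : ℤ) (_ : r ≠ p), 𝒱.U r s) :=
    (𝒱.isMixedHodgeStructure s).isCompl_deligneU p
  rw [proj, gradedProj, dif_pos h]
  exact (Submodule.projection_eq_self_iff h e).symm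

variable [IsManifold 𝓘(ℂ, E) ω S]

theorem localRep_θ (h𝒱 : 𝒱.IsUnipotent) {x : S} {r : ℝ} {a b : ℤ} (hA : 𝒱.IsAdapted x r a b)
    (Y : ∀ s : S, TangentSpace 𝓘(ℝ, E) s) (σ : 𝒱.L.Section) {z : E}
    (hz : z ∈ Metric.ball (chartAt E x x) r) :
    localRep E x (fun s => 𝒱.θ s (Y s) (σ s)) z =
      𝒱.localHiggs x a b z (fieldRep x Y z) (localRep E x σ z) := by
  obtain ⟨s, rfl, hs, hs'⟩ := hA.good.exists_eq_chart hz
  rw [localRep_of_mem hs hs', localRep_of_mem hs hs', fieldRep_chart hs']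
  exact frame_θ h𝒱 hA hs hs' hz (Y s) (σ s)

theorem eventually_localRep_θ (h𝒱 : 𝒱.IsUnipotent) {x : S} {r : ℝ} {a b : ℤ}
    (hA : 𝒱.IsAdapted x r a b) (Y : ∀ s : S, TangentSpace 𝓘(ℝ, E) s) (σ : 𝒱.L.Section) :
    (localRep E x fun s => 𝒱.θ s (Y s) (σ s)) =ᶠ[𝓝 (chartAt E x x)]
      fun z => 𝒱.localHiggs x a b z (fieldRep x Y z) (localRep E x σ z) := by
  filter_upwards [Metric.isOpen_ball.mem_nhds hA.good.mem_self] with z hz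
    using localRep_θ h𝒱 hA Y σ hz

variable (h𝒱 : 𝒱.IsUnipotent)

include h𝒱

theorem isSmoothForm_θ : 𝒱.L.IsSmoothForm 𝒱.θ := by
  intro X σ x hX hσ
  obtain ⟨r, a, b, hA⟩ := h𝒱.exists_isAdapted x
  rw [smoothAt_iff (𝒱.L.mem_nhd x) (mem_chart_source E x)] at hσ ⊢
  rw [contDiffAt_iff_of_eventuallyEq (eventually_localRep_θ h𝒱 hA X σ)]
  have hΘ := (contDiffAt_localHiggs h𝒱 hA hA.good.mem_self).restrict_scalars ℝ
  exact contDiffAt_complexClm_apply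
    (contDiffAt_complexClm_apply (hΘ.of_le le_top) (contDiffAt_fieldRep hX)) hσ

theorem map_θ_WC_le (k : ℤ) (x : S) (ξ : E) :
    (𝒱.WC k x).map (𝒱.θ x ξ) ≤ 𝒱.WC (k - 1) x := by
  obtain ⟨r, a, b, hA⟩ := h𝒱.exists_isAdapted x
  have hx := 𝒱.L.mem_nhd x
  rintro _ ⟨w, hw, rfl⟩
  rw [← frame_mem_localWeight_iff hx, frame_θ h𝒱 hA hx (mem_chart_source E x) hA.good.mem_self]
  exact (isLocalVariation hA.good h𝒱).fderiv_gradingOp_mem_weight hA.good.mem_self a b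
    hA.good.mem_self _ ((frame_mem_localWeight_iff hx).2 hw)

theorem delbar_eq_nabla01 {σ : 𝒱.L.Section} {x : S} (hσ : 𝒱.L.SmoothAt E σ x) :
    𝒱.delbar σ x = 𝒱.L.nabla01 E σ x := by
  obtain ⟨r, a, b, hA⟩ := h𝒱.exists_isAdapted x
  rw [smoothAt_iff (𝒱.L.mem_nhd x) (mem_chart_source E x)] at hσ
  ext v
  exact (𝒱.L.frame x x (𝒱.L.mem_nhd x)).injective (frame_delbar h𝒱 hA _ (mem_chart_source E x)
    hA.good.mem_self (hσ.differentiableAt (by simp)) v)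

theorem delbarAddDel_eq_nablaSubθ {σ : 𝒱.L.Section} {x : S} (hσ : 𝒱.L.SmoothAt E σ x) :
    𝒱.delbarAddDel σ x = 𝒱.nablaSubθ σ x := by
  obtain ⟨r, a, b, hA⟩ := h𝒱.exists_isAdapted x
  have hx := 𝒱.L.mem_nhd x
  have hx' := mem_chart_source E x
  have hσ' := ((smoothAt_iff hx hx').1 hσ).differentiableAt (by simp)
  ext v
  apply (𝒱.L.frame x x hx).injective
  rw [delbarAddDel, nablaSubθ, delbar_eq_nabla01 h𝒱 hσ, ← nabla10_add_nabla01, map_add, map_sub,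
    map_add, frame_del h𝒱 hA hx hx' hA.good.mem_self hσ',
    frame_θ h𝒱 hA hx hx' hA.good.mem_self]
  abel

theorem θ_commute (x : S) (v w : E) (e : 𝒱.L.VC x) :
    𝒱.θ x v (𝒱.θ x w e) = 𝒱.θ x w (𝒱.θ x v e) := by
  obtain ⟨r, a, b, hA⟩ := h𝒱.exists_isAdapted x
  have hx := 𝒱.L.mem_nhd x
  apply (𝒱.L.frame x x hx).injective
  simp only [frame_θ h𝒱 hA hx (mem_chart_source E x) hA.good.mem_self]
  exact congrArg (fun T => T (𝒱.L.frame x x hx e))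
    (localHiggs_commute h𝒱 hA hA.good.mem_self _ _)

theorem frame_nabla_θ_sub_θ_nabla {x : S} {r : ℝ} {a b : ℤ} (hA : 𝒱.IsAdapted x r a b)
    {Y : ∀ s : S, TangentSpace 𝓘(ℝ, E) s} {σ : 𝒱.L.Section} (hY : SmoothFieldAt Y x)
    (hσ : 𝒱.L.SmoothAt E σ x) (v : E) :
    𝒱.L.frame x x (𝒱.L.mem_nhd x) (𝒱.L.nabla E (fun s => 𝒱.θ s (Y s) (σ s)) x v -
        𝒱.θ x (Y x) (𝒱.L.nabla E σ x v)) =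
      fderiv ℂ (𝒱.localHiggs x a b) (chartAt E x x) (chartDeriv E x x v)
          (fieldRep x Y (chartAt E x x)) (𝒱.L.frame x x (𝒱.L.mem_nhd x) (σ x)) +
        𝒱.localHiggs x a b (chartAt E x x)
          (fderiv ℝ (fieldRep x Y) (chartAt E x x) (chartDeriv E x x v))
          (𝒱.L.frame x x (𝒱.L.mem_nhd x) (σ x)) := by
  have hx := 𝒱.L.mem_nhd x
  have hx' := mem_chart_source E x
  have hz := hA.good.mem_self
  have hσ' := ((smoothAt_iff hx hx').1 hσ).differentiableAt (by simp)
  have hΘ := ((contDiffAt_localHiggs h𝒱 hA hz).differentiableAt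
    (by simp)).hasFDerivAt.restrictScalars ℝ
  have hderiv := (hasFDerivAt_complexClm_apply (hasFDerivAt_complexClm_apply hΘ
    ((contDiffAt_fieldRep hY).differentiableAt (by simp)).hasFDerivAt)
    hσ'.hasFDerivAt).congr_of_eventuallyEq (eventually_localRep_θ h𝒱 hA Y σ)
  have hθ := frame_θ h𝒱 hA hx hx' hz (Y x) (𝒱.L.nabla E σ x v)
  rw [frame_nabla hx hx' hσ', ← fieldRep_chart hx'] at hθ
  rw [map_sub, frame_nabla hx hx' hderiv.differentiableAt, hderiv.fderiv, ← localRep_of_mem hx hx']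
  refine (congrArg₂ (· - ·) rfl hθ).trans ((add_sub_cancel_left _ _).trans ?_)
  exact add_comm (𝒱.localHiggs x a b _ _ _) _

theorem isFlatForm_nabla : 𝒱.L.IsFlatForm (𝒱.L.nabla E) 𝒱.θ := by
  intro X Y σ x hX hY hσ
  obtain ⟨r, a, b, hA⟩ := h𝒱.exists_isAdapted x
  have hx := 𝒱.L.mem_nhd x
  have hx' := mem_chart_source E x
  have hsymm := fderiv_localHiggs_symm h𝒱 hA hA.good.mem_self (fieldRep x X (chartAt E x x))
    (fieldRep x Y (chartAt E x x))
  have hXY := frame_nabla_θ_sub_θ_nabla h𝒱 hA hY hσ (X x)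
  have hYX := frame_nabla_θ_sub_θ_nabla h𝒱 hA hX hσ (Y x)
  have hbracket := frame_θ h𝒱 hA hx hx' hA.good.mem_self (VectorField.mlieBracket 𝓘(ℝ, E) X Y x)
    (σ x)
  rw [← fieldRep_chart hx'] at hXY hYX
  rw [chartDeriv_mlieBracket, map_sub, sub_apply] at hbracket
  rw [hsymm] at hXY
  apply (𝒱.L.frame x x hx).injective
  rw [map_sub, map_sub _ (_ - _), map_zero]
  refine (congrArg₂ (· - ·) (congrArg₂ (· - ·) hXY hYX) hbracket).trans ?_
  abel

theorem isFlat_nablaSubθ : 𝒱.L.IsFlat 𝒱.nablaSubθ := by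
  intro X Y σ x hX hY hσ
  have hsub : ∀ (Z Z' : ∀ s : S, TangentSpace 𝓘(ℝ, E) s), SmoothFieldAt Z' x →
      𝒱.nablaSubθ (fun s => 𝒱.nablaSubθ σ s (Z' s)) x (Z x) =
        𝒱.L.nabla E (fun s => 𝒱.L.nabla E σ s (Z' s)) x (Z x) -
          𝒱.L.nabla E (fun s => 𝒱.θ s (Z' s) (σ s)) x (Z x) -
          (𝒱.θ x (Z x) (𝒱.L.nabla E σ x (Z' x)) - 𝒱.θ x (Z x) (𝒱.θ x (Z' x) (σ x))) := by
    intro Z Z' hZ'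
    exact congrArg₂ (· - ·)
      (nabla_sub (smoothAt_nabla hZ' hσ) (isSmoothForm_θ h𝒱 Z' σ x hZ' hσ) (Z x))
      (map_sub (𝒱.θ x (Z x)) _ _)
  have hcurv : 𝒱.L.nabla E (fun s => 𝒱.L.nabla E σ s (Y s)) x (X x) -
    𝒱.L.nabla E (fun s => 𝒱.L.nabla E σ s (X s)) x (Y x) -
    𝒱.L.nabla E σ x (VectorField.mlieBracket 𝓘(ℝ, E) X Y x) = 0 := isFlat_nabla X Y σ x hX hY hσ
  have hθ := isFlatForm_nabla h𝒱 X Y σ x hX hY hσ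
  have hcomm := θ_commute h𝒱 x (X x) (Y x) (σ x)
  have hbracket : 𝒱.nablaSubθ σ x (VectorField.mlieBracket 𝓘(ℝ, E) X Y x) =
    𝒱.L.nabla E σ x (VectorField.mlieBracket 𝓘(ℝ, E) X Y x) -
    𝒱.θ x (VectorField.mlieBracket 𝓘(ℝ, E) X Y x) (σ x) := rfl
  refine (congrArg₂ (· - ·) (congrArg₂ (· - ·) (hsub X Y hY) (hsub Y X hX)) hbracket).trans ?_
  refine Eq.trans ?_ ((congrArg₂ (· - ·) hcurv hθ).trans (sub_zero 0))
  rw [hcomm]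
  abel

theorem isFlatForm_delbarAddDel : 𝒱.L.IsFlatForm 𝒱.delbarAddDel 𝒱.θ := by
  intro X Y σ x hX hY hσ
  rw [delbarAddDel_eq_nablaSubθ h𝒱 hσ,
    delbarAddDel_eq_nablaSubθ h𝒱 (isSmoothForm_θ h𝒱 X σ x hX hσ),
    delbarAddDel_eq_nablaSubθ h𝒱 (isSmoothForm_θ h𝒱 Y σ x hY hσ)]
  simp only [nablaSubθ, map_sub]
  rw [θ_commute h𝒱 x (X x) (Y x), ← isFlatForm_nabla h𝒱 X Y σ x hX hY hσ]
  abel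

theorem mem_U_iff_localProj {x : S} {r : ℝ} (hr : 𝒱.L.IsGoodBall E x r) {s : S}
    (hs : s ∈ 𝒱.L.nhd x) (hs' : s ∈ (chartAt E x).source)
    (hz : chartAt E x s ∈ Metric.ball (chartAt E x x) r) (p : ℤ) (e : 𝒱.L.VC s) :
    e ∈ 𝒱.U p s ↔ 𝒱.localProj x p (chartAt E x s) (𝒱.L.frame x s hs e) = 𝒱.L.frame x s hs e := by
  rw [mem_U_iff, ← frame_proj hr h𝒱 hs hs' hz]
  exact (𝒱.L.frame x s hs).injective.eq_iff.symm

theorem isParallel_U (p : ℤ) : 𝒱.L.IsParallel 𝒱.nablaSubθ (𝒱.U p) := by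
  intro σ x hσ hU v
  obtain ⟨r, a, b, hA⟩ := h𝒱.exists_isAdapted x
  have hx := 𝒱.L.mem_nhd x
  have hx' := mem_chart_source E x
  have hz := hA.good.mem_self
  rw [smoothAt_iff hx hx'] at hσ
  have hcomp : ∀ᶠ s in 𝓝 x, σ s = 𝒱.comp p σ s := by
    filter_upwards [hU] with s hs using ((mem_U_iff p s _).1 hs).symm
  have hnabla := frame_nabla_comp h𝒱 hA hx hx' hz (hσ.differentiableAt (by simp)) p v
  have hP : fderiv ℂ (𝒱.localProj x p) (chartAt E x x) (chartDeriv E x x v) =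
      𝒱.localHiggs x a b (chartAt E x x) (chartDeriv E x x v) *
        𝒱.localProj x p (chartAt E x x) -
      𝒱.localProj x p (chartAt E x x) *
        𝒱.localHiggs x a b (chartAt E x x) (chartDeriv E x x v) :=
    (isLocalVariation hA.good h𝒱).fderiv_summandProj hz hA.range hz (chartDeriv E x x v) p
  rw [← nabla_congr hcomp, hP, sub_apply, mul_apply_eq_comp, mul_apply_eq_comp,
    (mem_U_iff_localProj h𝒱 hA.good hx hx' hz p _).1 hU.self_of_nhds] at hnabla
  rw [mem_U_iff_localProj h𝒱 hA.good hx hx' hz, nablaSubθ, map_sub, map_sub,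
    frame_θ h𝒱 hA hx hx' hz]
  conv_rhs => rw [hnabla]
  abel

end Parallel

section Subbundle

variable {E : Type*} [NormedAddCommGroup E] [NormedSpace ℂ E]
  {S : Type u} [TopologicalSpace S] [ChartedSpace E S] (𝒱 : VGPMHS.{u, v} E S)

/-- The linear map from the fibre at the centre of the chart at `x` to the fibre at `z` which
carries each `U^p` to `U^p` by projecting along the other summands; the summands with index in
`[a, b]` are taken into account. -/
def localSplitting (x : S) (a b : ℤ) (z : E) : (Fin (𝒱.L.rk x) → ℂ) →L[ℂ] (Fin (𝒱.L.rk x) → ℂ) :=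
  ∑ q ∈ Finset.Icc a b, 𝒱.localProj x q z * 𝒱.localProj x q (chartAt E x x)

variable {𝒱} [IsManifold 𝓘(ℂ, E) ω S] (h𝒱 : 𝒱.IsUnipotent) {x : S} {r : ℝ} {a b : ℤ}
  (hA : 𝒱.IsAdapted x r a b)

include h𝒱 hA

theorem contDiffAt_localSplitting {z : E} (hz : z ∈ Metric.ball (chartAt E x x) r) :
    ContDiffAt ℂ ω (𝒱.localSplitting x a b) z :=
  ContDiffAt.sum fun q _ => (contDiffAt_localProj h𝒱 hA hz q).mul contDiffAt_const

theorem localSplitting_self : 𝒱.localSplitting x a b (chartAt E x x) = 1 := by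
  rw [← hA.range.sum_summandProj hA.good.mem_self]
  refine Finset.sum_congr rfl fun q _ => ?_
  rw [localProj_mul h𝒱 hA hA.good.mem_self, if_pos rfl]
  rfl

theorem localProj_mul_localSplitting {z : E} (hz : z ∈ Metric.ball (chartAt E x x) r) (p : ℤ) :
    𝒱.localProj x p z * 𝒱.localSplitting x a b z =
      𝒱.localSplitting x a b z * 𝒱.localProj x p (chartAt E x x) := by
  rw [localSplitting, Finset.mul_sum, Finset.sum_mul]
  refine Finset.sum_congr rfl fun q _ => ?_
  rw [← mul_assoc, localProj_mul h𝒱 hA hz, mul_assoc, localProj_mul h𝒱 hA hA.good.mem_self]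
  grind

theorem eventually_isUnit_localSplitting :
    ∀ᶠ z in 𝓝 (chartAt E x x), IsUnit (𝒱.localSplitting x a b z) := by
  refine (contDiffAt_localSplitting h𝒱 hA hA.good.mem_self).continuousAt.eventually
    (Units.isOpen.mem_nhds ?_)
  rw [localSplitting_self h𝒱 hA]
  exact isUnit_one

theorem map_frame_U {s : S} (hs : s ∈ 𝒱.L.nhd x) (hs' : s ∈ (chartAt E x).source)
    (hz : chartAt E x s ∈ Metric.ball (chartAt E x x) r) (p : ℤ) :
    (𝒱.U p s).map (𝒱.L.frame x s hs).toLinearMap =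
      (𝒱.localProj x p (chartAt E x s)).toLinearMap.range := by
  ext w
  rw [Submodule.mem_map_equiv, mem_U_iff_localProj h𝒱 hA.good hs hs' hz,
    LinearEquiv.apply_symm_apply]
  refine ⟨fun h => ⟨w, h⟩, ?_⟩
  rintro ⟨w, rfl⟩
  exact congrArg (fun T => T w) ((localProj_mul h𝒱 hA hz p p).trans (if_pos rfl))

omit hA in
theorem isSmoothSubbundle_U (p : ℤ) : 𝒱.L.IsSmoothSubbundle E (𝒱.U p) := by
  refine isSmoothSubbundle_of_trivialization fun x => ?_
  obtain ⟨r, a, b, hA⟩ := h𝒱.exists_isAdapted x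
  refine ⟨(𝒱.localProj x p (chartAt E x x)).toLinearMap.range, 𝒱.localSplitting x a b, ?_⟩
  filter_upwards [Metric.isOpen_ball.mem_nhds hA.good.mem_self,
    eventually_isUnit_localSplitting h𝒱 hA] with z hz hunit
  refine ⟨((contDiffAt_localSplitting h𝒱 hA hz).restrict_scalars ℝ).of_le le_top, hunit, ?_⟩
  rintro s hs hs' rfl
  have hsurj : (𝒱.localSplitting x a b (chartAt E x s)).toLinearMap.range = ⊤ := by
    obtain ⟨u, hu⟩ := hunit
    refine LinearMap.range_eq_top.2 (Function.RightInverse.surjective (g := u⁻¹.1) fun w => ?_)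
    rw [← hu]
    exact congrArg (fun T => T w) u.mul_inv
  rw [map_frame_U h𝒱 hA hs hs' hz, ← LinearMap.range_comp,
    ← LinearMap.range_comp_of_range_eq_top _ hsurj]
  exact congrArg (fun T => T.toLinearMap.range) (localProj_mul_localSplitting h𝒱 hA hz p)

end Subbundle

end VGPMHS

/-! ### Recovering a variation from `∇`, `θ` and one fibre -/

namespace RatLocalSystem

variable {S : Type u} [TopologicalSpace S] {L : RatLocalSystem.{u, v} S} {x s s' : S}

variable (L) in
/-- Parallel transport from `s` to `s'` in the flat trivialization around `x`. -/
def transition (hs : s ∈ L.nhd x) (hs' : s' ∈ L.nhd x) : L.Fib s ≃ₗ[ℚ] L.Fib s' :=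
  (L.transport x s hs).symm.trans (L.transport x s' hs')

theorem transition_transport (hs : s ∈ L.nhd x) (hs' : s' ∈ L.nhd x) (a : L.Fib x) :
    L.transition hs hs' (L.transport x s hs a) = L.transport x s' hs' a := by
  simp [transition]

theorem frame_transition (hs : s ∈ L.nhd x) (hs' : s' ∈ L.nhd x) (w : L.VC s) :
    L.frame x s' hs' ((L.transition hs hs').toLinearMap.baseChange ℂ w) = L.frame x s hs w := by
  obtain ⟨w, rfl⟩ := (L.transportC x s hs).surjective w
  have htransport : (L.transition hs hs').toLinearMap.baseChange ℂ (L.transportC x s hs w) =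
      L.transportC x s' hs' w := by
    rw [transportC_apply, transportC_apply, ← LinearMap.comp_apply, ← LinearMap.baseChange_comp]
    congr 2
    exact LinearMap.ext (transition_transport hs hs')
  rw [htransport]
  simp [frame]

end RatLocalSystem

theorem WeightFiltration.map_transition {S : Type u} [TopologicalSpace S]
    {L : RatLocalSystem.{u, v} S} (w : WeightFiltration L) {x s s' : S}
    (hs : s ∈ L.nhd x) (hs' : s' ∈ L.nhd x) (k : ℤ) :
    (w.W k s).map (L.transition hs hs').toLinearMap = w.W k s' := by
  rw [← w.flat k x s hs, ← w.flat k x s' hs', ← Submodule.map_comp]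
  congr 1
  exact LinearMap.ext (RatLocalSystem.transition_transport hs hs')

section Recovery

open RatLocalSystem VGPMHS

variable {E : Type*} [NormedAddCommGroup E] [NormedSpace ℂ E]
  {S : Type u} [TopologicalSpace S] [ChartedSpace E S]
  {𝒱 : VGPMHS.{u, v} E S} {𝒱' : VGPMHS.{u, v'} E S} {x s s' : S}

theorem VGPMHS.pol_transport (hs : s ∈ 𝒱.L.nhd x) {k : ℤ} {a b : 𝒱.wt.W k x} {a' b' : 𝒱.wt.W k s}
    (ha : 𝒱.L.transport x s hs a = a') (hb : 𝒱.L.transport x s hs b = b') :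
    𝒱.pol k s (𝒱.wt.grMk k s a') (𝒱.wt.grMk k s b') =
      𝒱.pol k x (𝒱.wt.grMk k x a) (𝒱.wt.grMk k x b) := by
  have grMk_transport : ∀ {a : 𝒱.wt.W k x} {a' : 𝒱.wt.W k s}, 𝒱.L.transport x s hs a = a' →
      (𝒱.wt.gr k).transport x s hs (𝒱.wt.grMk k x a) = 𝒱.wt.grMk k s a' := fun h =>
    congrArg Submodule.Quotient.mk (Subtype.ext h)
  have hflat := (𝒱.graded k).form_flat x s hs (𝒱.wt.grMk k x a) (𝒱.wt.grMk k x b)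
  rwa [grMk_transport ha, grMk_transport hb] at hflat

theorem VGPMHS.pol_transition (hs : s ∈ 𝒱.L.nhd x) (hs' : s' ∈ 𝒱.L.nhd x) {k : ℤ}
    {a b : 𝒱.wt.W k s} {a' b' : 𝒱.wt.W k s'} (ha : 𝒱.L.transition hs hs' a = a')
    (hb : 𝒱.L.transition hs hs' b = b') :
    𝒱.pol k s' (𝒱.wt.grMk k s' a') (𝒱.wt.grMk k s' b') =
      𝒱.pol k s (𝒱.wt.grMk k s a) (𝒱.wt.grMk k s b) := by
  have exists_transport : ∀ a : 𝒱.wt.W k s, ∃ a₀ : 𝒱.wt.W k x, 𝒱.L.transport x s hs a₀ = a := by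
    rintro ⟨a, ha⟩
    rw [← 𝒱.wt.flat k x s hs] at ha
    obtain ⟨a₀, ha₀, rfl⟩ := ha
    exact ⟨⟨a₀, ha₀⟩, rfl⟩
  obtain ⟨a₀, ha₀⟩ := exists_transport a
  obtain ⟨b₀, hb₀⟩ := exists_transport b
  rw [← ha₀, transition_transport] at ha
  rw [← hb₀, transition_transport] at hb
  rw [pol_transport hs ha₀ hb₀, pol_transport hs' ha hb]

theorem IsFiberIso.transition {Φ : 𝒱.L.VC s ≃ₗ[ℂ] 𝒱'.L.VC s} (h : IsFiberIso 𝒱 𝒱' s Φ)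
    {Φ' : 𝒱.L.VC s' ≃ₗ[ℂ] 𝒱'.L.VC s'} {C : (Fin (𝒱.L.rk x) → ℂ) → (Fin (𝒱'.L.rk x) → ℂ)}
    (hm : s ∈ 𝒱.L.nhd x) (hm' : s' ∈ 𝒱.L.nhd x) (hn : s ∈ 𝒱'.L.nhd x) (hn' : s' ∈ 𝒱'.L.nhd x)
    (hC : ∀ e, 𝒱'.L.frame x s hn (Φ e) = C (𝒱.L.frame x s hm e))
    (hC' : ∀ e, 𝒱'.L.frame x s' hn' (Φ' e) = C (𝒱.L.frame x s' hm' e))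
    (hF : ∀ p, (𝒱.F p s').map Φ'.toLinearMap = 𝒱'.F p s') : IsFiberIso 𝒱 𝒱' s' Φ' := by
  obtain ⟨φ, hφ, hφW, -, hφQ⟩ := h
  refine ⟨((𝒱.L.transition hm' hm).trans φ).trans (𝒱'.L.transition hn hn'), ?_, fun k => ?_, hF,
    fun k a b a' b' ha hb => ?_⟩
  · refine LinearMap.ext fun e => (𝒱'.L.frame x s' hn').injective ?_
    have hΦ : ∀ e, φ.toLinearMap.baseChange ℂ e = Φ e := fun e => congrArg (fun T => T e) hφ.symm
    rw [LinearEquiv.coe_trans, LinearEquiv.coe_trans, LinearMap.baseChange_comp,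
      LinearMap.baseChange_comp, LinearMap.comp_apply, LinearMap.comp_apply, frame_transition, hΦ,
      hC, frame_transition]
    exact hC' e
  · rw [LinearEquiv.coe_trans, LinearEquiv.coe_trans, Submodule.map_comp, Submodule.map_comp,
      𝒱.wt.map_transition, hφW, 𝒱'.wt.map_transition]
  · have hmem : ∀ a : 𝒱.wt.W k s', 𝒱.L.transition hm' hm a ∈ 𝒱.wt.W k s := fun a => by
      rw [← 𝒱.wt.map_transition hm' hm]
      exact Submodule.mem_map_of_mem a.2
    have hφmem : ∀ a : 𝒱.wt.W k s', φ (𝒱.L.transition hm' hm a) ∈ 𝒱'.wt.W k s := fun a => by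
      rw [← hφW]
      exact Submodule.mem_map_of_mem (hmem a)
    rw [pol_transition hn hn' (a := ⟨_, hφmem a⟩) (b := ⟨_, hφmem b⟩) ha hb,
      hφQ k ⟨_, hmem a⟩ ⟨_, hmem b⟩ _ _ rfl rfl]
    exact pol_transition hm' hm rfl rfl

/-- A bundle map at `x`, in the flat frames at `x`; a flat bundle isomorphism is given by it in a
neighbourhood of `x`. -/
def localIso (Φ : ∀ s, 𝒱.L.VC s ≃ₗ[ℂ] 𝒱'.L.VC s) (x : S) :
    (Fin (𝒱.L.rk x) → ℂ) ≃ₗ[ℂ] (Fin (𝒱'.L.rk x) → ℂ) :=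
  ((𝒱.L.frame x x (𝒱.L.mem_nhd x)).symm.trans (Φ x)).trans (𝒱'.L.frame x x (𝒱'.L.mem_nhd x))

theorem map_localIso_map_frame {Φ : ∀ s, 𝒱.L.VC s ≃ₗ[ℂ] 𝒱'.L.VC s} (hm : s ∈ 𝒱.L.nhd x)
    (hn : s ∈ 𝒱'.L.nhd x)
    (hC : ∀ e, 𝒱'.L.frame x s hn (Φ s e) = localIso Φ x (𝒱.L.frame x s hm e))
    (A : Submodule ℂ (𝒱.L.VC s)) :
    (A.map (𝒱.L.frame x s hm).toLinearMap).map (localIso Φ x).toLinearMap =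
      (A.map (Φ s).toLinearMap).map (𝒱'.L.frame x s hn).toLinearMap := by
  rw [← Submodule.map_comp, ← Submodule.map_comp]
  congr 1
  exact LinearMap.ext fun e => (hC e).symm

namespace IsFlatBundleIso

variable [IsManifold 𝓘(ℂ, E) ω S] {Φ : ∀ s, 𝒱.L.VC s ≃ₗ[ℂ] 𝒱'.L.VC s}
  (hΦ : IsFlatBundleIso 𝒱 𝒱' Φ) {r : ℝ}

include hΦ

theorem hasFDerivAt_localRep_sectionOf_const (hr : 𝒱.L.IsGoodBall E x r)
    (hr' : 𝒱'.L.IsGoodBall E x r) (w : Fin (𝒱.L.rk x) → ℂ) {z : E}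
    (hz : z ∈ Metric.ball (chartAt E x x) r) :
    HasFDerivAt (localRep E x fun s => Φ s (sectionOf (E := E) x (fun _ => w) s))
      (0 : E →L[ℝ] Fin (𝒱'.L.rk x) → ℂ) z := by
  obtain ⟨s, rfl, hs, hs'⟩ := hr.exists_eq_chart hz
  have hn : s ∈ 𝒱'.L.nhd x := (hr'.eventually_ball hs' hz).self_of_nhds.2.2
  set σ : 𝒱.L.Section := sectionOf (E := E) x fun _ => w
  have hσ : localRep E x σ =ᶠ[𝓝 (chartAt E x s)] fun _ => w := by
    filter_upwards [Metric.isOpen_ball.mem_nhds hz] with y hy using localRep_sectionOf hr _ hy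
  have hsmooth : 𝒱.L.SmoothAt E σ s := by
    rw [smoothAt_iff hs hs', contDiffAt_iff_of_eventuallyEq hσ]
    exact contDiffAt_const
  obtain ⟨hΦsmooth, hΦnabla⟩ := hΦ σ s hsmooth
  have hdiff := ((smoothAt_iff hn hs').1 hΦsmooth).differentiableAt (by simp)
  refine hdiff.hasFDerivAt.congr_fderiv (ContinuousLinearMap.ext fun u => ?_)
  obtain ⟨e, he⟩ := chartDeriv_isInvertible (E := E) hs'
  obtain ⟨v, rfl⟩ := e.surjective u
  have hflat : 𝒱.L.nabla E σ s v = 0 := by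
    apply (𝒱.L.frame x s hs).injective
    rw [frame_nabla hs hs' (hσ.differentiableAt_iff.2 (differentiableAt_const _)), hσ.fderiv_eq]
    simp
  have hderiv := frame_nabla hn hs' hdiff v
  rw [hΦnabla, hflat, map_zero, map_zero, ← he] at hderiv
  exact hderiv.symm

theorem frame_apply (hr : 𝒱.L.IsGoodBall E x r) (hr' : 𝒱'.L.IsGoodBall E x r)
    (hs : s ∈ 𝒱.L.nhd x) (hn : s ∈ 𝒱'.L.nhd x) (hs' : s ∈ (chartAt E x).source)
    (hz : chartAt E x s ∈ Metric.ball (chartAt E x x) r) (e : 𝒱.L.VC s) :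
    𝒱'.L.frame x s hn (Φ s e) = localIso Φ x (𝒱.L.frame x s hs e) := by
  set w := 𝒱.L.frame x s hs e
  have hderiv := fun y => hΦ.hasFDerivAt_localRep_sectionOf_const (z := y) hr hr' w
  have hconst := Metric.isOpen_ball.is_const_of_fderiv_eq_zero (𝕜 := ℝ)
    (convex_ball (chartAt E x x) r).isPreconnected
    (fun y hy => (hderiv y hy).differentiableAt.differentiableWithinAt)
    (fun y hy => (hderiv y hy).fderiv) hz hr.mem_self
  have hσs : sectionOf (E := E) x (fun _ => w) s = e :=
    (𝒱.L.frame x s hs).injective (frame_sectionOf hs _)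
  have hσx : sectionOf (E := E) x (fun _ => w) x = (𝒱.L.frame x x (𝒱.L.mem_nhd x)).symm w := by
    rw [LinearEquiv.eq_symm_apply, frame_sectionOf]
  rwa [localRep_of_mem hn hs', localRep_of_mem (𝒱'.L.mem_nhd x) (mem_chart_source E x), hσs, hσx]
    at hconst

variable (h𝒱 : 𝒱.IsUnipotent) (h𝒱' : 𝒱'.IsUnipotent) (hθ : IsHiggsIso 𝒱 𝒱' Φ) {a b : ℤ}
  (hA : 𝒱.IsAdapted x r a b) (hA' : 𝒱'.IsAdapted x r a b)

include h𝒱 h𝒱' hθ hA hA'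

theorem localHiggs_comm {z : E} (hz : z ∈ Metric.ball (chartAt E x x) r) (v : E)
    (w : Fin (𝒱.L.rk x) → ℂ) :
    𝒱'.localHiggs x a b z v (localIso Φ x w) = localIso Φ x (𝒱.localHiggs x a b z v w) := by
  obtain ⟨s, rfl, hs, hs'⟩ := hA.good.exists_eq_chart hz
  have hn : s ∈ 𝒱'.L.nhd x := (hA'.good.eventually_ball hs' hz).self_of_nhds.2.2
  obtain ⟨e, he⟩ := chartDeriv_isInvertible (E := E) hs'
  obtain ⟨u, rfl⟩ := e.surjective v
  obtain ⟨w, rfl⟩ := (𝒱.L.frame x s hs).surjective w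
  have hC := hΦ.frame_apply hA.good hA'.good hs hn hs' hz
  have hframe := frame_θ h𝒱 hA hs hs' hz u w
  have hframe' := frame_θ h𝒱' hA' hn hs' hz u (Φ s w)
  rw [hθ, hC, hframe, hC, ← he] at hframe'
  exact hframe'.symm

theorem map_localHodge (hm : s ∈ 𝒱.L.nhd x) (hn : s ∈ 𝒱'.L.nhd x)
    (hs : s ∈ (chartAt E x).source) (hz : chartAt E x s ∈ Metric.ball (chartAt E x x) r)
    (h : IsFiberIso 𝒱 𝒱' s (Φ s)) {y : E} (hy : y ∈ Metric.ball (chartAt E x x) r) (p : ℤ) :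
    (𝒱.localHodge x p y).map (localIso Φ x).toLinearMap = 𝒱'.localHodge x p y := by
  obtain ⟨φ, hφ, hφW, hφF, -⟩ := h
  have hC := hΦ.frame_apply hA.good hA'.good hm hn hs hz
  refine (isLocalVariation hA.good h𝒱).map_hodge_eq_of_comm (isLocalVariation hA'.good h𝒱')
    hA.good.mem_self hz hy hA.range hA'.range (localIso Φ x)
    (fun y hy => hΦ.localHiggs_comm h𝒱 h𝒱' hθ hA hA' hy) (fun w => ?_) (fun k => ?_)
    (fun p => ?_) p
  · obtain ⟨e, rfl⟩ := (𝒱.L.frame x s hm).surjective w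
    have hreal : conjC _ (Φ s e) = Φ s (conjC _ e) := by
      have hΦφ : ∀ e, Φ s e = φ.toLinearMap.baseChange ℂ e := fun e => congrArg (fun T => T e) hφ
      rw [hΦφ, hΦφ, conjC_baseChange]
    rw [← hC, localConj_frame, localConj_frame, ← hC, hreal]
  · rw [← map_frame_WC hm, ← map_frame_WC hn, map_localIso_map_frame hm hn hC, hφ, WC, WC,
      ← baseChange_map_eq_map_baseChange, hφW]
  · rw [localHodge_of_mem hm hs, localHodge_of_mem hn hs, map_localIso_map_frame hm hn hC, hφF]

theorem isFiberIso_of_isFiberIso (hs : s ∈ (chartAt E x).source)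
    (hz : chartAt E x s ∈ Metric.ball (chartAt E x x) r) (hs' : s' ∈ (chartAt E x).source)
    (hz' : chartAt E x s' ∈ Metric.ball (chartAt E x x) r) (h : IsFiberIso 𝒱 𝒱' s (Φ s)) :
    IsFiberIso 𝒱 𝒱' s' (Φ s') := by
  have hm := (hA.good.eventually_ball hs hz).self_of_nhds.2.2
  have hm' := (hA.good.eventually_ball hs' hz').self_of_nhds.2.2
  have hn := (hA'.good.eventually_ball hs hz).self_of_nhds.2.2
  have hn' := (hA'.good.eventually_ball hs' hz').self_of_nhds.2.2
  have hC' := hΦ.frame_apply hA.good hA'.good hm' hn' hs' hz'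
  refine h.transition hm hm' hn hn' (hΦ.frame_apply hA.good hA'.good hm hn hs hz) hC' fun p => ?_
  have hmap := hΦ.map_localHodge h𝒱 h𝒱' hθ hA hA' hm hn hs hz h hz' p
  rw [localHodge_of_mem hm' hs', localHodge_of_mem hn' hs', map_localIso_map_frame hm' hn' hC']
    at hmap
  exact Submodule.map_injective_of_injective (𝒱'.L.frame x s' hn').injective hmap

omit hA hA'

theorem isFiberIso [PreconnectedSpace S] {s₀ : S} (h₀ : IsFiberIso 𝒱 𝒱' s₀ (Φ s₀)) (s : S) :
    IsFiberIso 𝒱 𝒱' s (Φ s) := by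
  have hloc : IsLocallyConstant fun s => IsFiberIso 𝒱 𝒱' s (Φ s) := by
    rw [IsLocallyConstant.iff_eventually_eq]
    intro x
    obtain ⟨r₁, hr₁, good⟩ := exists_isGoodBall E 𝒱.L x
    obtain ⟨r₂, hr₂, good'⟩ := exists_isGoodBall E 𝒱'.L x
    have hr : 0 < min r₁ r₂ := lt_min hr₁ hr₂
    obtain ⟨a₁, b₁, adapted⟩ := h𝒱.eventually_isAdapted (good _ hr (min_le_left _ _))
    obtain ⟨a₂, b₂, adapted'⟩ := h𝒱'.eventually_isAdapted (good' _ hr (min_le_right _ _))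
    have hA := adapted (min a₁ a₂) (min_le_left _ _) (max b₁ b₂) (le_max_left _ _)
    have hA' := adapted' (min a₁ a₂) (min_le_right _ _) (max b₁ b₂) (le_max_right _ _)
    have hx := mem_chart_source E x
    have hz₀ := hA.good.mem_self
    filter_upwards [hA.good.eventually_ball hx hz₀] with s ⟨hs, hz, _⟩
    exact propext ⟨hΦ.isFiberIso_of_isFiberIso h𝒱 h𝒱' hθ hA hA' hs hz hx hz₀,
      hΦ.isFiberIso_of_isFiberIso h𝒱 h𝒱' hθ hA hA' hx hz₀ hs hz⟩
  exact (hloc.apply_eq_of_preconnectedSpace s₀ s).mp h₀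

end IsFlatBundleIso

end Recovery

end

theorem theorem5p30_general
    {E : Type*} [NormedAddCommGroup E] [NormedSpace ℂ E]
    {S : Type u} [TopologicalSpace S] [ChartedSpace E S] [IsManifold 𝓘(ℂ, E) ω S]
    (𝒱 : VGPMHS.{u, v} E S) (h𝒱 : 𝒱.IsUnipotent) :
    (𝒱.L.IsSmoothForm 𝒱.θ ∧
      ∀ (k : ℤ) (x : S) (ξ : E), (𝒱.WC k x).map (𝒱.θ x ξ) ≤ 𝒱.WC (k - 1) x) ∧
    (∀ (σ : 𝒱.L.Section) (x : S), 𝒱.L.SmoothAt E σ x → 𝒱.delbar σ x = 𝒱.L.nabla01 E σ x) ∧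
    (∀ (σ : 𝒱.L.Section) (x : S), 𝒱.L.SmoothAt E σ x →
      𝒱.delbarAddDel σ x = 𝒱.nablaSubθ σ x) ∧
    𝒱.L.IsFlat 𝒱.nablaSubθ ∧
    𝒱.L.IsFlatForm (𝒱.L.nabla E) 𝒱.θ ∧
    𝒱.L.IsFlatForm 𝒱.delbarAddDel 𝒱.θ ∧
    (∀ p, 𝒱.L.IsSmoothSubbundle E (𝒱.U p) ∧ 𝒱.L.IsParallel 𝒱.nablaSubθ (𝒱.U p)) ∧
    (PreconnectedSpace S →
      ∀ (𝒱' : VGPMHS.{u, v'} E S), 𝒱'.IsUnipotent →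
        ∀ Φ : (∀ s, 𝒱.L.VC s ≃ₗ[ℂ] 𝒱'.L.VC s),
          IsFlatBundleIso 𝒱 𝒱' Φ → IsHiggsIso 𝒱 𝒱' Φ →
          ∀ s₀ : S, IsFiberIso 𝒱 𝒱' s₀ (Φ s₀) → ∀ s : S, IsFiberIso 𝒱 𝒱' s (Φ s)) :=
  ⟨⟨VGPMHS.isSmoothForm_θ h𝒱, VGPMHS.map_θ_WC_le h𝒱⟩,
    fun _ _ => VGPMHS.delbar_eq_nabla01 h𝒱,
    fun _ _ => VGPMHS.delbarAddDel_eq_nablaSubθ h𝒱,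
    VGPMHS.isFlat_nablaSubθ h𝒱,
    VGPMHS.isFlatForm_nabla h𝒱,
    VGPMHS.isFlatForm_delbarAddDel h𝒱,
    fun p => ⟨VGPMHS.isSmoothSubbundle_U h𝒱 p, VGPMHS.isParallel_U h𝒱 p⟩,
    fun _ _ h𝒱' _ hΦ hθ _ h₀ => hΦ.isFiberIso h𝒱 h𝒱' hθ h₀⟩

theorem theorem5p30
    {E : Type*} [NormedAddCommGroup E] [NormedSpace ℂ E] [FiniteDimensional ℂ E]
    {S : Type u} [TopologicalSpace S] [ChartedSpace E S] [IsManifold 𝓘(ℂ, E) ω S]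
    (𝒱 : VGPMHS.{u, v} E S) (h𝒱 : 𝒱.IsUnipotent) :
    -- the Higgs field is a smooth form, and lowers the weight filtration
    (𝒱.L.IsSmoothForm 𝒱.θ ∧
      ∀ (k : ℤ) (x : S) (ξ : E), (𝒱.WC k x).map (𝒱.θ x ξ) ≤ 𝒱.WC (k - 1) x) ∧
    -- the complex structures coincide
    (∀ (σ : 𝒱.L.Section) (x : S), 𝒱.L.SmoothAt E σ x → 𝒱.delbar σ x = 𝒱.L.nabla01 E σ x) ∧
    -- `∂̄ + ∂ = ∇ - θ` is a flat connection
    (∀ (σ : 𝒱.L.Section) (x : S), 𝒱.L.SmoothAt E σ x →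
      𝒱.delbarAddDel σ x = 𝒱.nablaSubθ σ x) ∧
    𝒱.L.IsFlat 𝒱.nablaSubθ ∧
    -- the Higgs field is flat relative both to `∇` and to `∂̄ + ∂`
    𝒱.L.IsFlatForm (𝒱.L.nabla E) 𝒱.θ ∧
    𝒱.L.IsFlatForm 𝒱.delbarAddDel 𝒱.θ ∧
    -- the summands `𝓤^p` are smooth subbundles, parallel for `∇ - θ`
    (∀ p, 𝒱.L.IsSmoothSubbundle E (𝒱.U p) ∧ 𝒱.L.IsParallel 𝒱.nablaSubθ (𝒱.U p)) ∧
    -- the variation is recovered from `∇`, `θ` and a single fibre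
    (PreconnectedSpace S →
      ∀ (𝒱' : VGPMHS.{u, v'} E S), 𝒱'.IsUnipotent →
        ∀ Φ : (∀ s, 𝒱.L.VC s ≃ₗ[ℂ] 𝒱'.L.VC s),
          IsFlatBundleIso 𝒱 𝒱' Φ → IsHiggsIso 𝒱 𝒱' Φ →
          ∀ s₀ : S, IsFiberIso 𝒱 𝒱' s₀ (Φ s₀) → ∀ s : S, IsFiberIso 𝒱 𝒱' s (Φ s)) :=
  theorem5p30_general 𝒱 h𝒱
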